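/- Let $\mathcal F$ be a finite set of colors. All algebras are complex, associative, not necessarily unital; $\sqcup$ is the free product (coproduct) of algebras. An $\mathcal F$-faced algebra is an algebra $A$ freely generated by given subalgebras $A^{q}$, $q\in\mathcal F$; homomorphisms of $\mathcal F$-faced algebras are algebra homomorphisms mapping faces into the corresponding faces; $A_1\sqcup A_2$ is $\mathcal F$-faced with faces $A_1^{q}\sqcup A_2^{q}$. A *universal product* assigns to linear functionals $\varphi_i\colon A_i\to\mathbb C$ on $\mathcal F$-faced algebras ($i=1,2$) a linear functional $\varphi_1\odot\varphi_2$ on $A_1\sqcup A_2$ such that $(\varphi_1\circ h_1)\odot(\varphi_2\circ h_2)=(\varphi_1\odot\varphi_2)\circ(h_1\sqcup h_2)$ for all homomorphisms $h_i$ of $\mathcal F$-faced algebras, $(\varphi_1\odot\varphi_2)\odot\varphi_3=\varphi_1\odot(\varphi_2\odot\varphi_3)$, and $(\varphi_1\odot\varphi_2)|_{A_i}=\varphi_i$ (with the canonical identifications of free products). It is *symmetric* if $\varphi_1\odot\varphi_2=\varphi_2\odot\varphi_1$. No positivity is required. For a word $\mathbf f\in\mathcal F^n$ let $\mathcal P(\mathbf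 f)$ be the set of set partitions of $[n]=\{1,\dots,n\}$ whose points (legs) are colored by $\mathbf f$. Partitions of colored finite totally ordered sets are identified with partitions of words via the increasing enumeration. A family of weights $\alpha=(\alpha_\pi)$, $\alpha_\pi\in\mathbb C$, $\pi\in\mathcal P(\mathbf f)$, $\mathbf f\in\mathcal F^*$, is *admissible* if 1. $\alpha_{1_{\mathbf f}}=1$ for the maximal partition $1_{\mathbf f}$ of every word $\mathbf f$; 2. $\alpha_{\{\{1\},\{2\}\}}=1$ for every coloring $\mathbf f\in\mathcal F^2$; 3. $\alpha_\pi=\alpha_{\mathrm{red}(\pi)}$, where $\mathrm{red}(\pi)$ is obtained by merging each maximal interval of legs having the same color and lying in the same block into one leg; 4. $\alpha_\pi=\alpha_{\pi'}\cdot\alpha_{\{\beta_1,\beta_2\}}$ whenever $i\in\beta_1$, $i+1\in\beta_2$ have the same color for two different blocks $\beta_1\ne\beta_2$ of $\pi$, where $\pi'$ is obtained from $\pi$ by uniting $\beta_1$ and $\beta_2$; 5. $\alpha_\pi=\alpha_\sigma$ whenever $\pi$ and $\sigma$ differ only in the colors of the first and last leg; 6. $\alpha_{\overline\pi}=\overline{\alpha_\pi}$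 for the mirror image $\overline\pi$ of $\pi$. The weights $\alpha$ are called the *highest coefficients* of a symmetric universal product $\odot$ if for all $k,n\ge1$, every surjection $\mathbf b\colon[n]\to[k]$, every $\mathbf f\in\mathcal F^n$, all linear functionals $\varphi_\kappa$ on $\mathcal F$-faced algebras $A_\kappa$ ($\kappa\in[k]$) and all $a_\ell\in A_{\mathbf b(\ell)}^{\mathbf f(\ell)}$, $$\left.\frac{\partial^k}{\partial t_1\cdots\partial t_k}\bigl((t_1\varphi_1)\odot\cdots\odot(t_k\varphi_k)\bigr)(a_1\cdots a_n)\right|_{t=0}=\alpha_{\pi}\prod_{\kappa=1}^k\varphi_\kappa\Bigl(\overrightarrow{\prod}_{\mathbf b(\ell)=\kappa}a_\ell\Bigr)$$ (the derivative exists), where $\pi\in\mathcal P(\mathbf f)$ is the partition with blocks $\mathbf b^{-1}(\kappa)$ and the products are taken in increasing order of $\ell$. For a vector space $V=\bigoplus_{q\in\mathcal F}V^q$ let $T_0(V)=\bigoplus_{n\ge1}V^{\otimes n}$, and for a linear functional $\psi$ on $T_0(V)$ and $x_i\in V^{\mathbf f(i)}$ put $$\exp_\alpha(\psi)(x_1\otimes\cdots\otimes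 x_n)=\sum_{\pi\in\mathcal P(\mathbf f)}\alpha_\pi\prod_{\beta\in\pi}\psi(x_\beta),\qquad x_\beta=x_{i_1}\otimes\cdots\otimes x_{i_r}\ \text{ for }\beta=\{i_1<\cdots<i_r\}.$$ If $\alpha_{1_{\mathbf f}}=1$ for all $\mathbf f$, this is a bijection of the dual space of $T_0(V)$, with inverse $\log_\alpha$. For a functional $\varphi$ on an $\mathcal F$-faced algebra $A$ let $\hat\varphi(a_1\otimes\cdots\otimes a_n)=\varphi(a_1\cdots a_n)$ on $T_0(\bigoplus_q A^q)$. The direct sum $\psi_1\oplus\psi_2$ of functionals on $T_0(V_1)$ and $T_0(V_2)$ is extended to $T_0(V_1\oplus V_2)$ by $0$ on tensors $v_1\otimes\cdots\otimes v_n$ having factors both from $V_1$ and from $V_2$. **Theorem.** Let $\alpha$ be an admissible family of weights. Then there exists a unique symmetric universal product $\odot$ with highest coefficients $\alpha$. It is given by $$(\varphi_1\odot\varphi_2)(a_1\cdots a_n)=\exp_\alpha\bigl(\log_\alpha\hat\varphi_1\oplus\log_\alpha\hat\varphi_2\bigr)(a_1\otimes\cdots\otimes a_n)$$ for all linear functionals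 $\varphi_1,\varphi_2$ on $\mathcal F$-faced algebras $A_1,A_2$, all $n\ge1$ and all $a_1,\dots,a_n\in\bigcup_{\kappa\in\{1,2\},\,q\in\mathcal F}A_\kappa^{q}$; in particular the functional on the right, on $T_0\bigl(\bigoplus_q(A_1^q\oplus A_2^q)\bigr)$, descends to the free product $A_1\sqcup A_2$. -/

import Mathlib

universe u

noncomputable section

/-! ### The free product of two (not necessarily unital) complex algebras -/

namespace FreeProd

set_option linter.unusedSectionVars false

variable (A B : Type u) [NonUnitalRing A] [Module ℂ A] [IsScalarTower ℂ A A] [SMulCommClass ℂ A A]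
  [NonUnitalRing B] [Module ℂ B] [IsScalarTower ℂ B B] [SMulCommClass ℂ B B]

/-- The relations `a ⊗ a' = a a'` and `b ⊗ b' = b b'` in the tensor algebra `T(A ⊕ B)`. -/
inductive Rel : TensorAlgebra ℂ (A × B) → TensorAlgebra ℂ (A × B) → Prop
  | left (a a' : A) :
      Rel (TensorAlgebra.ι ℂ (a, 0) * TensorAlgebra.ι ℂ (a', 0)) (TensorAlgebra.ι ℂ (a * a', 0))
  | right (b b' : B) :
      Rel (TensorAlgebra.ι ℂ (0, b) * TensorAlgebra.ι ℂ (0, b')) (TensorAlgebra.ι ℂ (0, b * b'))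

/-- The quotient of `T(A ⊕ B)` by the relations; it is the unitization of the free product. -/
abbrev Unital : Type u := RingQuot (Rel A B)

/-- The canonical linear map `A ⊕ B → T(A ⊕ B) / relations`. -/
def gen : A × B →ₗ[ℂ] Unital A B :=
  (RingQuot.mkAlgHom ℂ (Rel A B)).toLinearMap ∘ₗ TensorAlgebra.ι ℂ

/-- The free product `A ⊔ B`, i.e. `T₀(A ⊕ B)` modulo the relations, realised as the non-unital
subalgebra generated by `A ⊕ B` in `T(A ⊕ B)` modulo the relations. -/
def sub : NonUnitalSubalgebra ℂ (Unital A B) := NonUnitalAlgebra.adjoin ℂ (Set.range (gen A B))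

lemma gen_mem (x : A × B) : gen A B x ∈ sub A B :=
  NonUnitalAlgebra.subset_adjoin ℂ ⟨x, rfl⟩

variable {A B}

lemma gen_left_mul (a a' : A) : gen A B (a, 0) * gen A B (a', 0) = gen A B (a * a', 0) := by
  have h := RingQuot.mkAlgHom_rel ℂ (Rel.left (B := B) a a')
  simpa [gen] using h

lemma gen_right_mul (b b' : B) : gen A B (0, b) * gen A B (0, b') = gen A B (0, b * b') := by
  have h := RingQuot.mkAlgHom_rel ℂ (Rel.right (A := A) b b')
  simpa [gen] using h

/-- The embedding of the first factor. -/
def inl' : A →ₙₐ[ℂ] sub A B where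
  toFun a := ⟨gen A B (a, 0), gen_mem A B _⟩
  map_smul' c a := by
    ext
    simpa using (gen A B).map_smul c (a, 0)
  map_zero' := by
    ext
    exact (gen A B).map_zero
  map_add' a a' := by
    ext
    simpa using (gen A B).map_add (a, 0) (a', 0)
  map_mul' a a' := by
    ext
    exact (gen_left_mul a a').symm

/-- The embedding of the second factor. -/
def inr' : B →ₙₐ[ℂ] sub A B where
  toFun b := ⟨gen A B (0, b), gen_mem A B _⟩
  map_smul' c b := by
    ext
    simpa using (gen A B).map_smul c (0, b)
  map_zero' := by
    ext
    exact (gen A B).map_zero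
  map_add' b b' := by
    ext
    simpa using (gen A B).map_add (0, b) (0, b')
  map_mul' b b' := by
    ext
    exact (gen_right_mul b b').symm

variable (A B) in
/-- The type of elements of the free product. -/
def Carrier : Type u := sub A B

instance : NonUnitalRing (Carrier A B) := inferInstanceAs (NonUnitalRing (sub A B))
instance : Module ℂ (Carrier A B) := inferInstanceAs (Module ℂ (sub A B))
instance : IsScalarTower ℂ (Carrier A B) (Carrier A B) :=
  inferInstanceAs (IsScalarTower ℂ (sub A B) (sub A B))
instance : SMulCommClass ℂ (Carrier A B) (Carrier A B) :=
  inferInstanceAs (SMulCommClass ℂ (sub A B) (sub A B))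

/-- The embedding of the first factor. -/
def inl : A →ₙₐ[ℂ] Carrier A B := inl'

/-- The embedding of the second factor. -/
def inr : B →ₙₐ[ℂ] Carrier A B := inr'

variable {C : Type u} [NonUnitalRing C] [Module ℂ C] [IsScalarTower ℂ C C] [SMulCommClass ℂ C C]

lemma hom_ext' {g g' : sub A B →ₙₐ[ℂ] C} (hl : ∀ a, g (inl' a) = g' (inl' a))
    (hr : ∀ b, g (inr' b) = g' (inr' b)) : g = g' := by
  have key : ∀ (x : Unital A B) (hx : x ∈ sub A B), g ⟨x, hx⟩ = g' ⟨x, hx⟩ := by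
    intro x hx
    induction hx using NonUnitalAlgebra.adjoin_induction with
    | mem x hx =>
      obtain ⟨⟨a, b⟩, rfl⟩ := hx
      have h : (⟨gen A B (a, b), gen_mem A B _⟩ : sub A B) = inl' a + inr' b := by
        ext
        have := (gen A B).map_add (a, 0) (0, b)
        simpa [inl', inr'] using this
      change g (⟨gen A B (a, b), gen_mem A B _⟩ : sub A B) =
        g' (⟨gen A B (a, b), gen_mem A B _⟩ : sub A B)
      rw [h, map_add, map_add, hl, hr]
    | add x y hx hy ihx ihy =>
      have := congrArg₂ (· + ·) ihx ihy
      simp only [← map_add] at this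
      exact this
    | zero => exact (map_zero g).trans (map_zero g').symm
    | mul x y hx hy ihx ihy =>
      have := congrArg₂ (· * ·) ihx ihy
      simp only [← map_mul] at this
      exact this
    | smul r x hx ih =>
      have := congrArg (r • ·) ih
      simp only [← map_smul] at this
      exact this
  ext ⟨x, hx⟩
  exact key x hx

/-- Two homomorphisms on the free product that agree on both factors are equal. -/
lemma hom_ext {g g' : Carrier A B →ₙₐ[ℂ] C} (hl : ∀ a, g (inl a) = g' (inl a))
    (hr : ∀ b, g (inr b) = g' (inr b)) : g = g' :=
  hom_ext' (A := A) (B := B) hl hr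

/-- The unital extension of `f ⊔ g` with values in the unitization of `C`. -/
def liftUnital (f : A →ₙₐ[ℂ] C) (g : B →ₙₐ[ℂ] C) : Unital A B →ₐ[ℂ] Unitization ℂ C :=
  RingQuot.liftAlgHom ℂ ⟨TensorAlgebra.lift ℂ
    ((Unitization.inrHom ℂ ℂ C) ∘ₗ
      ((f : A →ₗ[ℂ] C) ∘ₗ LinearMap.fst ℂ A B + (g : B →ₗ[ℂ] C) ∘ₗ LinearMap.snd ℂ A B)), by
    intro x y h
    cases h <;> simp [← Unitization.inr_mul]⟩

lemma liftUnital_gen (f : A →ₙₐ[ℂ] C) (g : B →ₙₐ[ℂ] C) (a : A) (b : B) :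
    liftUnital f g (gen A B (a, b)) = ((f a + g b : C) : Unitization ℂ C) := by
  simp [liftUnital, gen]

lemma liftUnital_fst (f : A →ₙₐ[ℂ] C) (g : B →ₙₐ[ℂ] C) (x : Unital A B) (hx : x ∈ sub A B) :
    (liftUnital f g x).fst = 0 := by
  induction hx using NonUnitalAlgebra.adjoin_induction with
  | mem x hx =>
    obtain ⟨⟨a, b⟩, rfl⟩ := hx
    simp [liftUnital_gen]
  | add x y hx hy ihx ihy => simp [ihx, ihy]
  | zero => simp
  | mul x y hx hy ihx ihy => simp [ihx, ihy]
  | smul r x hx ih => simp [ih]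

/-- The homomorphism `f ⊔ g : A ⊔ B → C`, on the underlying subalgebra. -/
def lift' (f : A →ₙₐ[ℂ] C) (g : B →ₙₐ[ℂ] C) : sub A B →ₙₐ[ℂ] C where
  toFun x := (liftUnital f g x).snd
  map_smul' c x := by simp
  map_zero' := by simp
  map_add' x y := by simp
  map_mul' x y := by
    simp [liftUnital_fst f g x x.2, liftUnital_fst f g y y.2]

/-- The homomorphism `f ⊔ g : A ⊔ B → C`. -/
def lift (f : A →ₙₐ[ℂ] C) (g : B →ₙₐ[ℂ] C) : Carrier A B →ₙₐ[ℂ] C := lift' f g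

@[simp] lemma lift_inl (f : A →ₙₐ[ℂ] C) (g : B →ₙₐ[ℂ] C) (a : A) : lift f g (inl a) = f a := by
  change (liftUnital f g (gen A B (a, 0))).snd = f a
  rw [liftUnital_gen]
  simp

@[simp] lemma lift_inr (f : A →ₙₐ[ℂ] C) (g : B →ₙₐ[ℂ] C) (b : B) : lift f g (inr b) = g b := by
  change (liftUnital f g (gen A B (0, b))).snd = g b
  rw [liftUnital_gen]
  simp

/-- If `A` and `B` are freely generated by families of subalgebras, then their free product is
freely generated by the subalgebras `A^q ⊔ B^q`. -/
lemma free_of_free {F : Type} (SA : F → NonUnitalSubalgebra ℂ A) (SB : F → NonUnitalSubalgebra ℂ B)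
    (freeA : ∀ h : ∀ q, SA q →ₙₐ[ℂ] C, ∃! g : A →ₙₐ[ℂ] C, ∀ q (x : SA q), g x = h q x)
    (freeB : ∀ h : ∀ q, SB q →ₙₐ[ℂ] C, ∃! g : B →ₙₐ[ℂ] C, ∀ q (x : SB q), g x = h q x)
    (S : F → NonUnitalSubalgebra ℂ (Carrier A B))
    (hS : ∀ q, S q = NonUnitalAlgebra.adjoin ℂ
      ((inl : A →ₙₐ[ℂ] Carrier A B) '' (SA q : Set A) ∪
        (inr : B →ₙₐ[ℂ] Carrier A B) '' (SB q : Set B)))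
    (h : ∀ q, S q →ₙₐ[ℂ] C) :
    ∃! g : Carrier A B →ₙₐ[ℂ] C, ∀ q (x : S q), g x = h q x := by
  have hl : ∀ q, ∀ x ∈ SA q, (inl x : Carrier A B) ∈ S q := fun q x hx => by
    rw [hS]
    exact NonUnitalAlgebra.subset_adjoin ℂ (Or.inl ⟨x, hx, rfl⟩)
  have hr : ∀ q, ∀ x ∈ SB q, (inr x : Carrier A B) ∈ S q := fun q x hx => by
    rw [hS]
    exact NonUnitalAlgebra.subset_adjoin ℂ (Or.inr ⟨x, hx, rfl⟩)
  let iA : ∀ q, SA q →ₙₐ[ℂ] S q := fun q =>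
    NonUnitalAlgHom.codRestrict (inl.comp (NonUnitalSubalgebraClass.subtype (SA q)))
      (S q) (fun x => hl q x x.2)
  let iB : ∀ q, SB q →ₙₐ[ℂ] S q := fun q =>
    NonUnitalAlgHom.codRestrict (inr.comp (NonUnitalSubalgebraClass.subtype (SB q)))
      (S q) (fun x => hr q x x.2)
  obtain ⟨gA, hgA, uA⟩ := freeA (fun q => (h q).comp (iA q))
  obtain ⟨gB, hgB, uB⟩ := freeB (fun q => (h q).comp (iB q))
  refine ⟨lift gA gB, ?_, ?_⟩
  · intro q
    have key : ∀ (y : Carrier A B), y ∈ NonUnitalAlgebra.adjoin ℂ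
        ((inl : A →ₙₐ[ℂ] Carrier A B) '' (SA q : Set A) ∪
          (inr : B →ₙₐ[ℂ] Carrier A B) '' (SB q : Set B)) →
        ∃ hy : y ∈ S q, lift gA gB y = h q ⟨y, hy⟩ := by
      intro y hy
      induction hy using NonUnitalAlgebra.adjoin_induction with
      | mem y hy =>
        rcases hy with ⟨a, ha, rfl⟩ | ⟨b, hb, rfl⟩
        · refine ⟨hl q a ha, ?_⟩
          rw [lift_inl]
          exact hgA q ⟨a, ha⟩
        · refine ⟨hr q b hb, ?_⟩
          rw [lift_inr]
          exact hgB q ⟨b, hb⟩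
      | add x y hx hy ihx ihy =>
        obtain ⟨mx, ex⟩ := ihx
        obtain ⟨my, ey⟩ := ihy
        refine ⟨add_mem mx my, ?_⟩
        rw [map_add, ex, ey, ← map_add]
        rfl
      | zero =>
        refine ⟨zero_mem _, ?_⟩
        rw [map_zero]
        exact (map_zero (h q)).symm
      | mul x y hx hy ihx ihy =>
        obtain ⟨mx, ex⟩ := ihx
        obtain ⟨my, ey⟩ := ihy
        refine ⟨mul_mem mx my, ?_⟩
        rw [map_mul, ex, ey, ← map_mul]
        rfl
      | smul r x hx ih =>
        obtain ⟨mx, ex⟩ := ih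
        refine ⟨SMulMemClass.smul_mem r mx, ?_⟩
        rw [map_smul, ex, ← map_smul]
        rfl
    rintro ⟨y, hy⟩
    obtain ⟨_, e⟩ := key y (hS q ▸ hy)
    exact e
  · intro g hg
    have e1 : g.comp inl = gA := uA _ (fun q x => hg q (iA q x))
    have e2 : g.comp inr = gB := uB _ (fun q x => hg q (iB q x))
    apply hom_ext
    · intro a
      rw [lift_inl, ← e1]
      rfl
    · intro b
      rw [lift_inr, ← e2]
      rfl

end FreeProd

/-! ### Multi-faced algebras -/

/-- An `F`-faced algebra: an algebra which is freely generated by given subalgebras, its faces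
(the algebra is the coproduct of its faces). -/
structure MFAlg (F : Type) where
  carrier : Type u
  [ring : NonUnitalRing carrier]
  [module : Module ℂ carrier]
  [isScalarTower : IsScalarTower ℂ carrier carrier]
  [smulCommClass : SMulCommClass ℂ carrier carrier]
  face : F → NonUnitalSubalgebra ℂ carrier
  free : ∀ (C : Type u) [NonUnitalRing C] [Module ℂ C] [IsScalarTower ℂ C C] [SMulCommClass ℂ C C]
    (h : ∀ q, face q →ₙₐ[ℂ] C), ∃! g : carrier →ₙₐ[ℂ] C, ∀ q (x : face q), g x = h q x

namespace MFAlg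

variable {F : Type}

instance : CoeSort (MFAlg.{u} F) (Type u) := ⟨carrier⟩

attribute [instance] ring module isScalarTower smulCommClass

/-- Linear functionals on a multi-faced algebra. -/
abbrev Functional (A : MFAlg.{u} F) : Type u := A →ₗ[ℂ] ℂ

/-- Multi-faced algebra homomorphisms. -/
structure Hom (A B : MFAlg.{u} F) where
  toHom : A →ₙₐ[ℂ] B
  map_face : ∀ q, ∀ x ∈ A.face q, toHom x ∈ B.face q

instance (A B : MFAlg.{u} F) : CoeFun (Hom A B) (fun _ => A → B) := ⟨fun h => h.toHom⟩

/-- The identity homomorphism. -/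
def Hom.id (A : MFAlg.{u} F) : Hom A A := ⟨NonUnitalAlgHom.id ℂ A, fun _ _ hx => hx⟩

/-- The composition `g ∘ h`. -/
def Hom.comp {A B C : MFAlg.{u} F} (g : Hom B C) (h : Hom A B) : Hom A C :=
  ⟨g.toHom.comp h.toHom, fun q x hx => g.map_face q _ (h.map_face q x hx)⟩

/-- The functional `φ ∘ h`. -/
def Functional.comp {A B : MFAlg.{u} F} (φ : Functional B) (h : Hom A B) : Functional A :=
  LinearMap.comp φ (h.toHom : A →ₗ[ℂ] B)

/-- The free product of multi-faced algebras. The face of colour `q` is the subalgebra generated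
by the faces of colour `q` of both factors. -/
def coprod (A B : MFAlg.{u} F) : MFAlg.{u} F where
  carrier := FreeProd.Carrier A B
  face q := NonUnitalAlgebra.adjoin ℂ
    (FreeProd.inl '' (A.face q : Set A) ∪ FreeProd.inr '' (B.face q : Set B))
  free C _ _ _ _ h :=
    FreeProd.free_of_free A.face B.face (A.free C) (B.free C) _ (fun _ => rfl) h

/-- The embedding `A₁ → A₁ ⊔ A₂`. -/
def inl (A B : MFAlg.{u} F) : Hom A (A.coprod B) :=
  ⟨FreeProd.inl, fun _ x hx => NonUnitalAlgebra.subset_adjoin (A := FreeProd.Carrier A B) ℂ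
    (Or.inl ⟨x, hx, rfl⟩)⟩

/-- The embedding `A₂ → A₁ ⊔ A₂`. -/
def inr (A B : MFAlg.{u} F) : Hom B (A.coprod B) :=
  ⟨FreeProd.inr, fun _ x hx => NonUnitalAlgebra.subset_adjoin (A := FreeProd.Carrier A B) ℂ
    (Or.inr ⟨x, hx, rfl⟩)⟩

/-- The homomorphism `h₁ ⊔ h₂ : A₁ ⊔ A₂ → C`. -/
def lift {A B C : MFAlg.{u} F} (h₁ : Hom A C) (h₂ : Hom B C) : Hom (A.coprod B) C :=
  ⟨FreeProd.lift h₁.toHom h₂.toHom, by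
    intro q x hx
    suffices key : NonUnitalAlgebra.adjoin ℂ
        ((FreeProd.inl : A →ₙₐ[ℂ] FreeProd.Carrier A B) '' (A.face q : Set A) ∪
          (FreeProd.inr : B →ₙₐ[ℂ] FreeProd.Carrier A B) '' (B.face q : Set B)) ≤
        NonUnitalSubalgebra.comap (FreeProd.lift h₁.toHom h₂.toHom) (C.face q) from key hx
    refine NonUnitalAlgebra.adjoin_le ?_
    rintro _ (⟨a, ha, rfl⟩ | ⟨b, hb, rfl⟩)
    · change FreeProd.lift h₁.toHom h₂.toHom (FreeProd.inl a) ∈ C.face q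
      rw [FreeProd.lift_inl]
      exact h₁.map_face q a ha
    · change FreeProd.lift h₁.toHom h₂.toHom (FreeProd.inr b) ∈ C.face q
      rw [FreeProd.lift_inr]
      exact h₂.map_face q b hb⟩

/-- The homomorphism `h₁ ⊔ h₂ : B₁ ⊔ B₂ → A₁ ⊔ A₂`. -/
def map {A₁ A₂ B₁ B₂ : MFAlg.{u} F} (h₁ : Hom B₁ A₁) (h₂ : Hom B₂ A₂) :
    Hom (B₁.coprod B₂) (A₁.coprod A₂) :=
  lift ((inl A₁ A₂).comp h₁) ((inr A₁ A₂).comp h₂)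

/-- The canonical isomorphism `A ⊔ B → B ⊔ A`. -/
def swap (A B : MFAlg.{u} F) : Hom (A.coprod B) (B.coprod A) := lift (inr B A) (inl B A)

/-- The canonical isomorphism `(A ⊔ B) ⊔ C → A ⊔ (B ⊔ C)`. -/
def assoc (A B C : MFAlg.{u} F) :
    Hom ((A.coprod B).coprod C) (A.coprod (B.coprod C)) :=
  lift (lift (inl A (B.coprod C)) ((inr A (B.coprod C)).comp (inl B C)))
    ((inr A (B.coprod C)).comp (inr B C))

/-- The iterated free product `(⋯(A 0 ⊔ A 1) ⊔ ⋯) ⊔ A k`. -/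
def iterCoprod : (k : ℕ) → (Fin (k + 1) → MFAlg.{u} F) → MFAlg.{u} F
  | 0, A => A 0
  | k + 1, A => (iterCoprod k (fun i => A i.castSucc)).coprod (A (Fin.last (k + 1)))

/-- The embedding of the factor `A i` into the iterated free product. -/
def iterEmb : (k : ℕ) → (A : Fin (k + 1) → MFAlg.{u} F) → (i : Fin (k + 1)) →
    Hom (A i) (iterCoprod k A)
  | 0, A, i => Fin.cases (motive := fun i => Hom (A i) (A 0)) (Hom.id _) (fun j => j.elim0) i
  | k + 1, A, i => Fin.lastCases (motive := fun i => Hom (A i) (iterCoprod (k + 1) A))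
      (inr _ _) (fun j => (inl _ _).comp (iterEmb k (fun i => A i.castSucc) j)) i

end MFAlg

/-! ### Universal products -/

/-- The product `a₁ ⋯ aₙ` of a nonempty list in a non-unital algebra (and `0` for the empty list,
which is never used). -/
def ordProd {A : Type u} [NonUnitalRing A] : List A → A
  | [] => 0
  | [a] => a
  | a :: b :: l => a * ordProd (b :: l)

/-- A multi-faced universal product (in the algebraic sense). -/
structure UniversalProduct (F : Type) where
  op : {A B : MFAlg.{u} F} → A.Functional → B.Functional → (A.coprod B).Functional
  universality : ∀ {A₁ A₂ B₁ B₂ : MFAlg.{u} F} (φ₁ : A₁.Functional) (φ₂ : A₂.Functional)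
    (h₁ : MFAlg.Hom B₁ A₁) (h₂ : MFAlg.Hom B₂ A₂),
    op (φ₁.comp h₁) (φ₂.comp h₂) = (op φ₁ φ₂).comp (MFAlg.map h₁ h₂)
  associativity : ∀ {A₁ A₂ A₃ : MFAlg.{u} F} (φ₁ : A₁.Functional) (φ₂ : A₂.Functional)
    (φ₃ : A₃.Functional), op (op φ₁ φ₂) φ₃ = (op φ₁ (op φ₂ φ₃)).comp (MFAlg.assoc A₁ A₂ A₃)
  restrict_left : ∀ {A₁ A₂ : MFAlg.{u} F} (φ₁ : A₁.Functional) (φ₂ : A₂.Functional),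
    (op φ₁ φ₂).comp (MFAlg.inl A₁ A₂) = φ₁
  restrict_right : ∀ {A₁ A₂ : MFAlg.{u} F} (φ₁ : A₁.Functional) (φ₂ : A₂.Functional),
    (op φ₁ φ₂).comp (MFAlg.inr A₁ A₂) = φ₂

/-! ### Weights on multi-faced partitions -/

/-- Weights on partitions: a number for every word `f` in the colours and every set partition of
its positions. Set partitions are given by their equivalence relations. -/
abbrev Weights (F : Type) : Type := (n : ℕ) → (Fin n → F) → Setoid (Fin n) → ℂ

namespace Partition

variable {n : ℕ}

open Classical in
/-- The block of `π` containing `i`. -/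
def block (π : Setoid (Fin n)) (i : Fin n) : Finset (Fin n) := Finset.univ.filter (fun j => π i j)

open Classical in
/-- The set of blocks of `π`. -/
def blocks (π : Setoid (Fin n)) : Finset (Finset (Fin n)) := Finset.univ.image (block π)

/-- The order preserving enumeration of the elements of `β`. -/
def enum (β : Finset (Fin n)) : Fin β.card → Fin n := β.orderEmbOfFin rfl

/-- The partition obtained from `π` by uniting the block of `i` with the block of `j`. -/
def unite (π : Setoid (Fin n)) (i j : Fin n) : Setoid (Fin n) :=
  π ⊔ Relation.EqvGen.setoid (fun a b => a = i ∧ b = j)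

open Classical in
/-- The union of the block of `i` and the block of `j`. -/
def twoBlocks (π : Setoid (Fin n)) (i j : Fin n) : Finset (Fin n) := block π i ∪ block π j

/-- `s ∼ t` if all `r` between `s` and `t` have the same colour and belong to the same block. -/
def RedRel {F : Type} (f : Fin n → F) (π : Setoid (Fin n)) (s t : Fin n) : Prop :=
  ∀ r, min s t ≤ r → r ≤ max s t → f r = f s ∧ π r s

/-- The coloured partition `(f', π')` is the reduction of `(f, π)`, where `q` is the quotient map:
it is monotone, identifies exactly the equivalent points, and is compatible with colours and
blocks. -/
def IsReduction {F : Type} {m : ℕ} (f : Fin n → F) (π : Setoid (Fin n)) (f' : Fin m → F)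
    (π' : Setoid (Fin m)) (q : Fin n → Fin m) : Prop :=
  Monotone q ∧ Function.Surjective q ∧ (∀ s t, q s = q t ↔ RedRel f π s t) ∧
    (∀ s, f s = f' (q s)) ∧ ∀ s t, π s t ↔ π' (q s) (q t)

instance : Finite (Setoid (Fin n)) :=
  Finite.of_injective (fun π : Setoid (Fin n) => fun i j => π i j) (fun π σ h => by
    ext i j
    exact iff_of_eq (congrFun (congrFun h i) j))

instance : Fintype (Setoid (Fin n)) := Fintype.ofFinite _

lemma card_lt_of_mem_blocks {π : Setoid (Fin n)} (hπ : π ≠ ⊤) {β : Finset (Fin n)}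
    (hβ : β ∈ blocks π) : β.card < n := by
  classical
  obtain ⟨i, -, rfl⟩ := Finset.mem_image.1 hβ
  by_contra hlt
  have h1 : (block π i).card = Fintype.card (Fin n) := by
    refine le_antisymm (Finset.card_le_univ _) ?_
    simpa using hlt
  have h2 : ∀ j, π i j := fun j => by
    have : j ∈ block π i := by
      rw [Finset.eq_univ_of_card _ h1]
      exact Finset.mem_univ j
    simpa [block] using this
  apply hπ
  ext a b
  simpa using π.trans (π.symm (h2 a)) (h2 b)

end Partition

open Partition in
/-- Admissible weights. -/
structure Weights.Admissible {F : Type} (α : Weights F) : Prop where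
  one_block : ∀ (n : ℕ) (f : Fin n → F), α n f ⊤ = 1
  two_point : ∀ f : Fin 2 → F, α 2 f ⊥ = 1
  reduction : ∀ (n m : ℕ) (f : Fin n → F) (π : Setoid (Fin n)) (f' : Fin m → F)
    (π' : Setoid (Fin m)) (q : Fin n → Fin m), IsReduction f π f' π' q → α n f π = α m f' π'
  split : ∀ (n : ℕ) (f : Fin n → F) (π : Setoid (Fin n)) (i j : Fin n),
    i.val + 1 = j.val → f i = f j → ¬ π i j →
    α n f π = α n f (unite π i j) *
      α (twoBlocks π i j).card (f ∘ enum (twoBlocks π i j)) (π.comap (enum (twoBlocks π i j)))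
  change_color : ∀ (n : ℕ) (f g : Fin n → F) (π : Setoid (Fin n)),
    (∀ i : Fin n, 0 < i.val → i.val + 1 < n → f i = g i) → α n f π = α n g π
  mirror : ∀ (n : ℕ) (f : Fin n → F) (π : Setoid (Fin n)),
    α n (f ∘ Fin.rev) (π.comap Fin.rev) = starRingEnd ℂ (α n f π)

/-! ### Highest coefficients -/

/-- `c` is the mixed partial derivative `∂ᵏ g / ∂t₁ ⋯ ∂tₖ` at `t = 0` (which exists). -/
def HasMixedPartial : (k : ℕ) → ((Fin k → ℂ) → ℂ) → ℂ → Prop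
  | 0, g, c => g Fin.elim0 = c
  | k + 1, g, c => ∃ g' : ℂ → ℂ,
      (∀ t : ℂ, HasMixedPartial k (fun s => g (Fin.cons t s)) (g' t)) ∧ HasDerivAt g' c 0

namespace UniversalProduct

variable {F : Type}

/-- A universal product is symmetric if `φ₁ ⊙ φ₂ = φ₂ ⊙ φ₁`. -/
def IsSymmetric (P : UniversalProduct.{u} F) : Prop :=
  ∀ {A B : MFAlg.{u} F} (φ₁ : A.Functional) (φ₂ : B.Functional),
    P.op φ₁ φ₂ = (P.op φ₂ φ₁).comp (MFAlg.swap A B)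

/-- The iterated product `φ 0 ⊙ φ 1 ⊙ ⋯ ⊙ φ k`. -/
def iter (P : UniversalProduct.{u} F) : (k : ℕ) → (A : Fin (k + 1) → MFAlg.{u} F) →
    ((i : Fin (k + 1)) → (A i).Functional) → (MFAlg.iterCoprod k A).Functional
  | 0, _, φ => φ 0
  | k + 1, A, φ => P.op (P.iter k (fun i => A i.castSucc) (fun i => φ i.castSucc))
      (φ (Fin.last (k + 1)))

/-- The weights `α` on partitions are the highest coefficients of the universal product `P`:
if the `ℓ`-th factor of `a₁ ⋯ aₙ` lies in the face of colour `f ℓ` of the algebra with number `b ℓ`,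
where every number occurs, then the linearized part `∂ᵏ/∂t₁⋯∂tₖ (t₁φ₁ ⊙ ⋯ ⊙ tₖφₖ)(a₁ ⋯ aₙ)` at
`t = 0` is `α_π · ∏_κ φ_κ(∏_{b ℓ = κ} a_ℓ)` (products in the original order of the factors), where
the blocks of `π` are the fibres of `b`. Here `a_ℓ` is written `a (b ℓ) ℓ`; the other values of `a`
are irrelevant. -/
def HasHighestCoefficients (P : UniversalProduct.{u} F) (α : Weights F) : Prop :=
  ∀ (k n : ℕ) (b : Fin n → Fin (k + 1)) (f : Fin n → F), Function.Surjective b →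
  ∀ (A : Fin (k + 1) → MFAlg.{u} F) (φ : ∀ κ, (A κ).Functional) (a : ∀ κ, Fin n → A κ),
  (∀ ℓ, a (b ℓ) ℓ ∈ (A (b ℓ)).face (f ℓ)) →
  HasMixedPartial (k + 1)
    (fun t => P.iter k A (fun κ => t κ • φ κ)
      (ordProd (List.ofFn (fun ℓ => MFAlg.iterEmb k A (b ℓ) (a (b ℓ) ℓ)))))
    (α n f (Setoid.ker b) *
      ∏ κ, φ κ (ordProd (((List.finRange n).filter (fun ℓ => b ℓ = κ)).map (a κ))))

end UniversalProduct

/-! ### Exponential and logarithm -/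

/-- A linear functional on `T₀(⊕ V^q)`, recorded by its values on the elementary tensors
`v₁ ⊗ ⋯ ⊗ vₙ` (`n ≥ 1`) whose factors are taken from a spanning set `L` of letters. -/
abbrev WordFun (L : Type u) : Type u := (n : ℕ) → (Fin n → L) → ℂ

namespace WordFun

variable {F : Type} {L L₁ L₂ : Type u}

open Partition

/-- `exp_α(ψ)(x₁ ⊗ ⋯ ⊗ xₙ) = ∑_π α_π ∏_{β ∈ π} ψ(x_β)`, where `col` is the colour of a letter. -/
def exp (α : Weights F) (col : L → F) (ψ : WordFun L) : WordFun L := fun n w =>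
  ∑ π : Setoid (Fin n), α n (col ∘ w) π * ∏ β ∈ blocks π, ψ β.card (w ∘ enum β)

open Classical in
/-- The recursion `log_α(Φ)(x) = Φ(x) - ∑_{|π| > 1} α_π ∏_{β ∈ π} log_α(Φ)(x_β)`. -/
def log (α : Weights F) (col : L → F) (Φ : WordFun L) : (n : ℕ) → (Fin n → L) → ℂ
  | n, w => Φ n w - ∑ π : {π : Setoid (Fin n) // π ≠ ⊤}, α n (col ∘ w) π.1 *
      ∏ β : {β : Finset (Fin n) // β ∈ blocks π.1}, log α col Φ β.1.card (w ∘ enum β.1)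
termination_by n => n
decreasing_by exact card_lt_of_mem_blocks π.2 β.2

/-- The direct sum `ψ₁ ⊕ ψ₂`, which vanishes on tensors with factors from both sides. -/
def directSum (ψ₁ : WordFun L₁) (ψ₂ : WordFun L₂) : WordFun (L₁ ⊕ L₂) := fun n w =>
  if h : ∀ i, (w i).isLeft then ψ₁ n (fun i => (w i).getLeft (h i))
  else if h : ∀ i, (w i).isRight then ψ₂ n (fun i => (w i).getRight (h i))
  else 0

end WordFun

namespace MFAlg

variable {F : Type}

/-- The letters of `T₀(⊕_q A^q)`: elements of the faces. -/
abbrev Letter (A : MFAlg.{u} F) : Type u := Σ q : F, A.face q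

/-- The functional `φ̂ = φ ∘ μ` on `T₀(⊕_q A^q)`. -/
def Functional.hat {A : MFAlg.{u} F} (φ : A.Functional) : WordFun A.Letter := fun _ w =>
  φ (ordProd (List.ofFn (fun i => ((w i).2 : A))))

/-- The logarithm of `φ̂`, i.e. the `α`-cumulants of `φ`. -/
def Functional.logHat {A : MFAlg.{u} F} (α : Weights F) (φ : A.Functional) : WordFun A.Letter :=
  WordFun.log α Sigma.fst φ.hat

/-- The functional `exp_α(log_α φ̂₁ ⊕ log_α φ̂₂)` on `T₀(⊕_q (A₁^q ⊕ A₂^q))`. -/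
def cumulantProduct {A₁ A₂ : MFAlg.{u} F} (α : Weights F) (φ₁ : A₁.Functional)
    (φ₂ : A₂.Functional) : WordFun (A₁.Letter ⊕ A₂.Letter) :=
  WordFun.exp α (Sum.elim Sigma.fst Sigma.fst)
    (WordFun.directSum (φ₁.logHat α) (φ₂.logHat α))

/-- The image in `A₁ ⊔ A₂` of a letter from `A₁` or `A₂`. -/
def letterToCoprod (A₁ A₂ : MFAlg.{u} F) : A₁.Letter ⊕ A₂.Letter → A₁.coprod A₂ :=
  Sum.elim (fun x => inl A₁ A₂ (x.2 : A₁)) (fun x => inr A₁ A₂ (x.2 : A₂))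

end MFAlg

end

/-!
Write `exp` and `log` for `exp_α` and `log_α`.

*Existence.* The functional `exp (log φ̂₁ ⊕ log φ̂₂)` is defined on words in letters from the
faces. It descends to the free product if it is linear in every letter, which is clear, and takes
the same value after two neighbouring letters from the same face are multiplied. By the conditions
on `α` that concern two neighbouring legs of the same colour (reduction and splitting), the latter
property of a functional `Φ = exp ψ` is equivalent to a formula for the cumulants with products as
entries: the value of `ψ` on a word with two letters `x_i x_{i+1}` multiplied is the value on the
original word plus the sum, over all ways of splitting the word into two subwords separating these
letters, of the weighted products of the values on the subwords (`WordFun.MergesCumulants.exp`,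
`WordFun.MergesMoments.log`). This formula obviously passes to direct sums
(`WordFun.MergesCumulants.directSum`). On the free product a consistent functional on words is
turned into a linear functional by letting the free product act on the consistent functionals by
right translations (`MFAlg.exists_functional_of_consistent`). Associativity and symmetry follow
from `log (φ₁ ⊙ φ₂)^ = log φ̂₁ ⊕ log φ̂₂`, and so do the highest coefficients, since `log (t φ̂) =
t φ̂ + O(t²)`: only the partition into the fibres of `b` contributes to the mixed derivative
(`MFAlg.cumulantUniversalProduct_hasHighestCoefficients`).

*Uniqueness.* By universality, a symmetric universal product is determined by the convolutions `φ
⋆ ψ = (φ ⊙ ψ) ∘ Δ`, `Δ x = x⁽¹⁾ + x⁽²⁾`, on the free multi-faced algebras in finitely many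
coloured letters, and even by their values on the word in which every letter occurs once. The
convolution makes the functionals on a free algebra a commutative monoid with unit `0`
(`ConvFun`), and substitutions of linear combinations of letters for letters are additive. Three
facts determine it.
- The values of `φ ⋆ ψ` on words without repetitions depend only on the values of `φ` and `ψ` on
  such words (`ConvFun.EqOnInj.add`): two functionals with the same values on such words are
  pulled back, along two different substitutions, from a single functional in twice as many
  letters, which can be chosen such that additional letters do not matter on words without
  repetitions.
- Let `ψ_S` be the part of `ψ` concentrated on words in which exactly the letters from `S` occur,
  each of them once. The convolution of the `ψ_S` over the blocks `S` of a partition `π` takes the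
  value `α_π ∏ ψ_S(x_S)` on the word of all letters, by the hypothesis on the highest
  coefficients: as `ψ_S` is linear in each letter of `S`, scaling `ψ_S` is the same as scaling a
  letter, so that the function to be differentiated is `c t₁ ⋯ t_k`
  (`ConvFun.val_sum_of_support`).
- By multilinearity, the value of the convolution of all `ψ_S` on the word of all letters is a sum
  over all maps from letters to sets, of which only the block maps of partitions contribute. Hence
  it is the value of `exp ψ` (`ConvFun.val_partSum_id`).

So `φ` agrees on words without repetitions with the convolution of the parts `(log φ)_S`. If the
cumulants of `φ₁` and `φ₂` are concentrated on disjoint sets of letters, then at most one of `(log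
φ₁)_S` and `(log φ₂)_S` does not vanish, and `φ₁ ⋆ φ₂` is `exp (log φ₁ + log φ₂)` on the word of
all letters (`ConvFun.val_add_eq_exp`). Pulling back `φ₁ ⊙ φ₂` to the free algebra on the letters
of a given word yields the formula of the theorem (`UniversalProduct.op_eq_cumulantProduct`).
-/


noncomputable section

/-! ### Blocks of partitions -/

namespace Partition

variable {n m : ℕ}

lemma mem_block {π : Setoid (Fin n)} {i j : Fin n} : j ∈ block π i ↔ π i j := by
  simp [block]

lemma self_mem_block (π : Setoid (Fin n)) (i : Fin n) : i ∈ block π i :=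
  mem_block.2 (π.refl i)

lemma mem_blocks {π : Setoid (Fin n)} {β : Finset (Fin n)} :
    β ∈ blocks π ↔ ∃ i, block π i = β := by
  simp [blocks]

lemma block_mem_blocks (π : Setoid (Fin n)) (i : Fin n) : block π i ∈ blocks π :=
  mem_blocks.2 ⟨i, rfl⟩

lemma block_eq_iff {π : Setoid (Fin n)} {i j : Fin n} : block π i = block π j ↔ π i j := by
  constructor
  · intro h
    rw [← mem_block, h]
    exact self_mem_block π j
  · intro h
    ext x
    rw [mem_block, mem_block]
    exact ⟨fun hx => π.trans (π.symm h) hx, fun hx => π.trans h hx⟩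

lemma eq_block_of_mem {π : Setoid (Fin n)} {β : Finset (Fin n)} (hβ : β ∈ blocks π) {i : Fin n}
    (hi : i ∈ β) : β = block π i := by
  obtain ⟨j, rfl⟩ := mem_blocks.1 hβ
  exact block_eq_iff.2 (mem_block.1 hi)

lemma mem_erase_block {π : Setoid (Fin n)} {β : Finset (Fin n)} {i : Fin n} :
    β ∈ (blocks π).erase (block π i) ↔ β ∈ blocks π ∧ i ∉ β := by
  rw [Finset.mem_erase]
  constructor
  · rintro ⟨h1, h2⟩
    exact ⟨h2, fun hi => h1 (eq_block_of_mem h2 hi)⟩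
  · rintro ⟨h1, h2⟩
    refine ⟨?_, h1⟩
    rintro rfl
    exact h2 (self_mem_block π i)

lemma card_pos_of_mem_blocks {π : Setoid (Fin n)} {β : Finset (Fin n)} (hβ : β ∈ blocks π) :
    0 < β.card := by
  obtain ⟨i, rfl⟩ := mem_blocks.1 hβ
  exact Finset.card_pos.2 ⟨i, self_mem_block π i⟩

lemma blocks_top (hn : 0 < n) : blocks (⊤ : Setoid (Fin n)) = {Finset.univ} := by
  ext β
  rw [mem_blocks, Finset.mem_singleton]
  have h : ∀ i, block (⊤ : Setoid (Fin n)) i = Finset.univ := fun i => by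
    ext j
    simp [mem_block]
  constructor
  · rintro ⟨i, rfl⟩
    exact h i
  · rintro rfl
    exact ⟨⟨0, hn⟩, h _⟩

/-- Any strictly increasing parametrisation of `β` may replace the enumeration of `β`. -/
lemma enum_transport {γ : Sort*} {β : Finset (Fin n)} {g : Fin m → Fin n} (hg : StrictMono g)
    (hr : ∀ x, x ∈ β ↔ ∃ y, g y = x) (Q : (k : ℕ) → (Fin k → Fin n) → γ) :
    Q β.card (enum β) = Q m g := by
  have hc : β.card = m := by
    have : β = Finset.univ.image g := by
      ext x
      simp [hr]
    rw [this, Finset.card_image_of_injective _ hg.injective]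
    simp
  subst hc
  congr 1
  exact (Finset.orderEmbOfFin_unique rfl (fun x => (hr _).2 ⟨x, rfl⟩) hg).symm

lemma enum_strictMono (β : Finset (Fin n)) : StrictMono (enum β) :=
  (β.orderEmbOfFin rfl).strictMono

lemma mem_iff_enum {β : Finset (Fin n)} (x : Fin n) : x ∈ β ↔ ∃ y, enum β y = x := by
  have h := Finset.range_orderEmbOfFin β (rfl : β.card = β.card)
  rw [← Finset.mem_coe, ← h]
  rfl

lemma enum_mem (β : Finset (Fin n)) (y : Fin β.card) : enum β y ∈ β :=
  (mem_iff_enum _).2 ⟨y, rfl⟩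

end Partition

/-! ### Exponential and logarithm -/

namespace WordFun

variable {F : Type} {L : Type u} {L' : Type*} {n m : ℕ}

open Partition

/-- The value of `ψ` on the subword of `w` with positions in `β`. -/
def ev (ψ : WordFun L) (w : Fin n → L) (β : Finset (Fin n)) : ℂ := ψ β.card (w ∘ enum β)

lemma ev_eq (ψ : WordFun L) (w : Fin n → L) {β : Finset (Fin n)} {g : Fin m → Fin n}
    (hg : StrictMono g) (hr : ∀ x, x ∈ β ↔ ∃ y, g y = x) : ev ψ w β = ψ m (w ∘ g) :=
  enum_transport hg hr (fun k e => ψ k (w ∘ e))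

lemma ev_univ (ψ : WordFun L) (w : Fin n → L) : ev ψ w Finset.univ = ψ n w :=
  ev_eq ψ w strictMono_id (by simp)

/-- Evaluation on subwords is compatible with strictly increasing reparametrisations. -/
lemma ev_comp (ψ : WordFun L) (w : Fin n → L) {g : Fin m → Fin n} (hg : StrictMono g)
    (γ : Finset (Fin m)) {β : Finset (Fin n)} (hβ : ∀ x, x ∈ β ↔ ∃ y ∈ γ, g y = x) :
    ev ψ (w ∘ g) γ = ev ψ w β := by
  symm
  apply ev_eq ψ w (hg.comp (enum_strictMono γ))
  intro x
  rw [hβ]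
  constructor
  · rintro ⟨y, hy, rfl⟩
    obtain ⟨z, rfl⟩ := (mem_iff_enum y).1 hy
    exact ⟨z, rfl⟩
  · rintro ⟨z, rfl⟩
    exact ⟨_, enum_mem γ z, rfl⟩

lemma ev_congr (ψ : WordFun L) {w w' : Fin n → L} {β : Finset (Fin n)}
    (h : ∀ i ∈ β, w i = w' i) : ev ψ w β = ev ψ w' β := by
  unfold ev
  congr 1
  funext y
  exact h _ (enum_mem β y)

variable (α : Weights F) (col : L → F)

lemma exp_eq_ev (ψ : WordFun L) (w : Fin n → L) :
    exp α col ψ n w = ∑ π : Setoid (Fin n), α n (col ∘ w) π * ∏ β ∈ blocks π, ev ψ w β := rfl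

open Classical in
lemma log_eq (Φ : WordFun L) (w : Fin n → L) :
    log α col Φ n w = Φ n w - ∑ π ∈ Finset.univ.filter (fun π : Setoid (Fin n) => π ≠ ⊤),
      α n (col ∘ w) π * ∏ β ∈ blocks π, ev (log α col Φ) w β := by
  rw [log]
  congr 1
  rw [Finset.sum_subtype (p := fun π : Setoid (Fin n) => π ≠ ⊤) (F := inferInstance)
    (Finset.univ.filter _)
    (fun π => by simp)]
  refine Finset.sum_congr (by ext; simp) (fun π _ => ?_)
  congr 1
  rw [Finset.prod_subtype (p := fun β => β ∈ blocks π.1) (blocks π.1) (fun β => Iff.rfl)]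
  rfl

variable {α} (hα : ∀ (n : ℕ) (f : Fin n → F), α n f ⊤ = 1)

include hα

open Classical in
lemma exp_eq_add (ψ : WordFun L) (hn : 0 < n) (w : Fin n → L) :
    exp α col ψ n w = ψ n w + ∑ π ∈ Finset.univ.filter (fun π : Setoid (Fin n) => π ≠ ⊤),
      α n (col ∘ w) π * ∏ β ∈ blocks π, ev ψ w β := by
  rw [exp_eq_ev, ← Finset.add_sum_erase _ _ (Finset.mem_univ ⊤), hα, blocks_top hn,
    Finset.prod_singleton, ev_univ, one_mul]
  congr 1
  refine Finset.sum_congr ?_ (fun _ _ => rfl)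
  ext
  simp

lemma exp_log (Φ : WordFun L) (hn : 0 < n) (w : Fin n → L) :
    exp α col (log α col Φ) n w = Φ n w := by
  classical
  rw [exp_eq_add col hα _ hn, log_eq]
  ring

/-- On nonempty words, `log` is the only solution of `exp ψ = Φ`. -/
lemma log_unique (Φ ψ : WordFun L) (h : ∀ n, 0 < n → ∀ w, exp α col ψ n w = Φ n w) :
    ∀ n, 0 < n → ∀ w, log α col Φ n w = ψ n w := by
  classical
  intro n
  induction n using Nat.strong_induction_on with
  | _ n ih =>
    intro hn w
    rw [log_eq, ← h n hn, exp_eq_add col hα _ hn, sub_eq_iff_eq_add]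
    congr 1
    refine Finset.sum_congr rfl (fun π hπ => ?_)
    congr 1
    refine Finset.prod_congr rfl (fun β hβ => ?_)
    exact (ih _ (card_lt_of_mem_blocks (Finset.mem_filter.1 hπ).2 hβ)
      (card_pos_of_mem_blocks hβ) _).symm

omit hα in
lemma exp_congr {ψ ψ' : WordFun L} (h : ∀ n, 0 < n → ∀ w, ψ n w = ψ' n w) (w : Fin n → L) :
    exp α col ψ n w = exp α col ψ' n w :=
  Finset.sum_congr rfl fun _ _ => congrArg _ <| Finset.prod_congr rfl fun _ hβ =>
    h _ (card_pos_of_mem_blocks hβ) _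

lemma log_congr {Φ Φ' : WordFun L} (h : ∀ n, 0 < n → ∀ w, Φ n w = Φ' n w) :
    ∀ n, 0 < n → ∀ w, log α col Φ n w = log α col Φ' n w :=
  log_unique col hα _ _ fun n hn w => by rw [exp_log col hα _ hn, h n hn]

omit hα in
lemma exp_comp (col' : L' → F) (g : L → L') (hg : ∀ x, col' (g x) = col x) (ψ : WordFun L')
    (w : Fin n → L) :
    exp α col (fun n w => ψ n (g ∘ w)) n w = exp α col' ψ n (g ∘ w) := by
  have : col' ∘ g ∘ w = col ∘ w := funext fun i => hg _
  unfold exp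
  rw [this]
  rfl

/-- The logarithm is natural with respect to colour preserving maps of letters. -/
lemma log_comp (col' : L' → F) (g : L → L') (hg : ∀ x, col' (g x) = col x) (Φ : WordFun L')
    (hn : 0 < n) (w : Fin n → L) :
    log α col (fun n w => Φ n (g ∘ w)) n w = log α col' Φ n (g ∘ w) :=
  log_unique col hα (fun n w => Φ n (g ∘ w)) (fun n w => log α col' Φ n (g ∘ w)) (fun n hn w => by
    rw [exp_comp col col' g hg, exp_log col' hα _ hn]) n hn w

/-- If `Φ` vanishes on all words containing a letter from `Z`, then so does its logarithm. -/
lemma log_eq_zero_of_mem (Z : Set L) (Φ : WordFun L)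
    (h : ∀ n w, (∃ i : Fin n, w i ∈ Z) → Φ n w = 0) (w : Fin n → L)
    (hw : ∃ i, w i ∈ Z) : log α col Φ n w = 0 := by
  classical
  have hn : 0 < n := by
    obtain ⟨i, -⟩ := hw
    exact i.pos
  rw [log_unique col hα Φ (fun n w => if ∃ i, w i ∈ Z then 0 else log α col Φ n w) ?_ n hn,
    if_pos hw]
  intro n hn w
  by_cases hZ : ∃ i, w i ∈ Z
  · rw [h n w hZ, exp_eq_ev]
    obtain ⟨i, hi⟩ := hZ
    refine Finset.sum_eq_zero fun π _ => mul_eq_zero_of_right _ ?_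
    refine Finset.prod_eq_zero (block_mem_blocks π i) ?_
    obtain ⟨y, hy⟩ := (mem_iff_enum i).1 (self_mem_block π i)
    exact if_pos ⟨y, by simpa [hy] using hi⟩
  · rw [← exp_log col hα Φ hn]
    refine Finset.sum_congr rfl fun π _ => congrArg _ <| Finset.prod_congr rfl fun β _ => ?_
    exact if_neg fun ⟨y, hy⟩ => hZ ⟨_, hy⟩

omit hα

lemma prod_blocks_eq (π : Setoid (Fin n)) (i : Fin n) (g : Finset (Fin n) → ℂ) :
    ∏ β ∈ blocks π, g β = g (block π i) * ∏ β ∈ (blocks π).erase (block π i), g β :=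
  (Finset.mul_prod_erase _ _ (block_mem_blocks π i)).symm

/-- `ψ` is linear in every letter, with respect to linear combinations `x = c y + z` recorded by
the ternary relations `R c`. -/
def IsLinear (R : ℂ → L → L → L → Prop) (ψ : WordFun L) : Prop :=
  ∀ (n : ℕ) (i : Fin n) (c : ℂ) (w w' w'' : Fin n → L), (∀ j, j ≠ i → w j = w' j) →
    (∀ j, j ≠ i → w j = w'' j) → R c (w i) (w' i) (w'' i) → ψ n w = c * ψ n w' + ψ n w''

/-- If `ψ` is linear on words of the length of the block of `i`, then the product of the values of
`ψ` on all blocks is linear in the letter at `i`. -/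
lemma prod_ev_linear {R : ℂ → L → L → L → Prop} {ψ : WordFun L} {n : ℕ} {π : Setoid (Fin n)}
    {i : Fin n} {c : ℂ} {w w' w'' : Fin n → L}
    (hψ : ∀ (j : Fin (block π i).card) (w w' w'' : Fin (block π i).card → L),
      (∀ k, k ≠ j → w k = w' k) → (∀ k, k ≠ j → w k = w'' k) → R c (w j) (w' j) (w'' j) →
      ψ _ w = c * ψ _ w' + ψ _ w'')
    (h' : ∀ j, j ≠ i → w j = w' j) (h'' : ∀ j, j ≠ i → w j = w'' j)
    (hR : R c (w i) (w' i) (w'' i)) :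
    ∏ β ∈ blocks π, ev ψ w β =
      c * ∏ β ∈ blocks π, ev ψ w' β + ∏ β ∈ blocks π, ev ψ w'' β := by
  simp only [prod_blocks_eq π i]
  have e' : ∏ β ∈ (blocks π).erase (block π i), ev ψ w' β =
      ∏ β ∈ (blocks π).erase (block π i), ev ψ w β :=
    Finset.prod_congr rfl fun β hβ => ev_congr _ fun j hj =>
      (h' j fun e => (mem_erase_block.1 hβ).2 (e ▸ hj)).symm
  have e'' : ∏ β ∈ (blocks π).erase (block π i), ev ψ w'' β =
      ∏ β ∈ (blocks π).erase (block π i), ev ψ w β :=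
    Finset.prod_congr rfl fun β hβ => ev_congr _ fun j hj =>
      (h'' j fun e => (mem_erase_block.1 hβ).2 (e ▸ hj)).symm
  rw [e', e'']
  obtain ⟨y, hy⟩ := (mem_iff_enum i).1 (self_mem_block π i)
  have : ev ψ w (block π i) = c * ev ψ w' (block π i) + ev ψ w'' (block π i) := by
    refine hψ y _ _ _ (fun k hk => h' _ fun e => hk ?_) (fun k hk => h'' _ fun e => hk ?_) ?_
    · exact (enum_strictMono _).injective (e.trans hy.symm)
    · exact (enum_strictMono _).injective (e.trans hy.symm)
    · simpa [hy] using hR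
  rw [this]
  ring

lemma IsLinear.exp {R : ℂ → L → L → L → Prop} {ψ : WordFun L} (hψ : IsLinear R ψ)
    (hR : ∀ c x y z, R c x y z → col x = col y ∧ col x = col z) :
    IsLinear R (WordFun.exp α col ψ) := by
  intro n i c w w' w'' h' h'' hi
  have c' : col ∘ w' = col ∘ w := funext fun j => by
    by_cases hj : j = i
    · subst hj
      exact (hR _ _ _ _ hi).1.symm
    · simp [h' j hj]
  have c'' : col ∘ w'' = col ∘ w := funext fun j => by
    by_cases hj : j = i
    · subst hj
      exact (hR _ _ _ _ hi).2.symm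
    · simp [h'' j hj]
  simp only [exp_eq_ev, c', c'', Finset.mul_sum, ← Finset.sum_add_distrib]
  refine Finset.sum_congr rfl fun π _ => ?_
  rw [prod_ev_linear (fun j w w' w'' => hψ _ j c w w' w'') h' h'' hi]
  ring

lemma IsLinear.log {R : ℂ → L → L → L → Prop} {Φ : WordFun L} (hΦ : IsLinear R Φ)
    (hR : ∀ c x y z, R c x y z → col x = col y ∧ col x = col z) :
    IsLinear R (WordFun.log α col Φ) := by
  classical
  intro n
  induction n using Nat.strong_induction_on with
  | _ n ih =>
    intro i c w w' w'' h' h'' hi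
    have c' : col ∘ w' = col ∘ w := funext fun j => by
      by_cases hj : j = i
      · subst hj
        exact (hR _ _ _ _ hi).1.symm
      · simp [h' j hj]
    have c'' : col ∘ w'' = col ∘ w := funext fun j => by
      by_cases hj : j = i
      · subst hj
        exact (hR _ _ _ _ hi).2.symm
      · simp [h'' j hj]
    simp only [log_eq, c', c'']
    rw [hΦ n i c w w' w'' h' h'' hi, mul_sub, Finset.mul_sum, sub_add_sub_comm,
      ← Finset.sum_add_distrib]
    congr 1
    refine Finset.sum_congr rfl fun π hπ => ?_
    rw [prod_ev_linear (fun j w w' w'' => ih _ (card_lt_of_mem_blocks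
      (Finset.mem_filter.1 hπ).2 (block_mem_blocks π i)) j c w w' w'') h' h'' hi]
    ring

end WordFun

end

noncomputable section

namespace Partition

variable {F : Type} {n m : ℕ}

/-! ### Reduction of coloured partitions -/

/-- The relation `RedRel` is compatible with pullbacks along monotone surjections. -/
lemma redRel_comap {s : Fin n → Fin m} (hs : Monotone s) (hs' : Function.Surjective s)
    (f : Fin m → F) (σ : Setoid (Fin m)) (a b : Fin n) :
    RedRel (f ∘ s) (σ.comap s) a b ↔ RedRel f σ (s a) (s b) := by
  constructor
  · intro h r h1 h2
    obtain ⟨x, rfl⟩ := hs' r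
    -- a preimage outside the interval may be replaced by an end point of the interval
    rcases le_or_gt (min a b) x with hx | hx
    · rcases le_or_gt x (max a b) with hx' | hx'
      · exact h x hx hx'
      · have : s x = s (max a b) := le_antisymm (by rwa [hs.map_max]) (hs hx'.le)
        rw [this]
        exact h _ min_le_max le_rfl
    · have : s x = s (min a b) := le_antisymm (hs hx.le) (by rwa [hs.map_min])
      rw [this]
      exact h _ le_rfl min_le_max
  · intro h r h1 h2
    exact h (s r) (by rw [← hs.map_min]; exact hs h1) (by rw [← hs.map_max]; exact hs h2)

lemma IsReduction.comap {k : ℕ} {s : Fin n → Fin m} (hs : Monotone s)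
    (hs' : Function.Surjective s) {f : Fin m → F} {σ : Setoid (Fin m)} {f' : Fin k → F}
    {σ' : Setoid (Fin k)} {q : Fin m → Fin k} (h : IsReduction f σ f' σ' q) :
    IsReduction (f ∘ s) (σ.comap s) f' σ' (q ∘ s) := by
  obtain ⟨h1, h2, h3, h4, h5⟩ := h
  refine ⟨h1.comp hs, h2.comp hs', fun a b => ?_, fun a => h4 _, fun a b => h5 _ _⟩
  rw [redRel_comap hs hs']
  exact h3 _ _

lemma predAbove_val (i : Fin n) (x : Fin (n + 1)) :
    (i.predAbove x).val = if i.val < x.val then x.val - 1 else x.val := by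
  unfold Fin.predAbove
  simp only [Fin.lt_def, Fin.val_castSucc]
  split_ifs <;> simp

lemma predAbove_surjective (i : Fin n) : Function.Surjective i.predAbove := fun y => by
  by_cases h : y.val ≤ i.val
  · exact ⟨y.castSucc, Fin.ext (by rw [predAbove_val]; simp; omega)⟩
  · exact ⟨y.succ, Fin.ext (by rw [predAbove_val]; simp; omega)⟩

lemma predAbove_mono (i : Fin n) : Monotone i.predAbove := fun a b h => by
  rw [Fin.le_def] at *
  rw [predAbove_val, predAbove_val]
  split_ifs <;> omega

@[simp] lemma predAbove_castSucc (i : Fin n) : i.predAbove i.castSucc = i :=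
  Fin.ext (by rw [predAbove_val]; simp)

@[simp] lemma predAbove_succ (i : Fin n) : i.predAbove i.succ = i :=
  Fin.ext (by rw [predAbove_val]; simp)

/-- Two legs identified by the map merging `i` and `i + 1` are equal or are these two legs. -/
lemma eq_or_of_predAbove_eq {i : Fin n} {x y : Fin (n + 1)} (h : i.predAbove x = i.predAbove y) :
    x = y ∨ (x = i.castSucc ∧ y = i.succ) ∨ (x = i.succ ∧ y = i.castSucc) := by
  have := congrArg Fin.val h
  rw [predAbove_val, predAbove_val] at this
  simp only [Fin.ext_iff, Fin.val_castSucc, Fin.val_succ]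
  split_ifs at this <;> omega

/-- A partition in which the neighbours `i` and `i + 1` are equivalent is pulled back from the
points in which these neighbours are merged. -/
lemma exists_comap_predAbove {i : Fin n} {σ' : Setoid (Fin (n + 1))} (h : σ' i.castSucc i.succ) :
    ∃ σ : Setoid (Fin n), σ.comap i.predAbove = σ' := by
  obtain ⟨t, ht⟩ := (predAbove_surjective i).hasRightInverse
  have key : ∀ x, σ' (t (i.predAbove x)) x := fun x => by
    rcases eq_or_of_predAbove_eq (ht (i.predAbove x)) with e | ⟨e1, e2⟩ | ⟨e1, e2⟩
    · rw [e]
    · rw [e1, e2]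
      exact h
    · rw [e1, e2]
      exact σ'.symm h
  refine ⟨σ'.comap t, ?_⟩
  ext x y
  change σ' (t (i.predAbove x)) (t (i.predAbove y)) ↔ σ' x y
  exact ⟨fun e => σ'.trans (σ'.symm (key x)) (σ'.trans e (key y)),
    fun e => σ'.trans (key x) (σ'.trans e (σ'.symm (key y)))⟩

/-- Every coloured partition has a reduction: merge equivalent neighbours until there are none. -/
lemma exists_isReduction (n : ℕ) (f : Fin n → F) (σ : Setoid (Fin n)) :
    ∃ (m : ℕ) (f' : Fin m → F) (σ' : Setoid (Fin m)) (q : Fin n → Fin m),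
      IsReduction f σ f' σ' q := by
  induction n with
  | zero =>
    exact ⟨0, f, σ, id, monotone_id, Function.surjective_id, fun s => s.elim0, fun s => s.elim0,
      fun s => s.elim0⟩
  | succ n ih =>
    by_cases h : ∃ i : Fin n, f i.castSucc = f i.succ ∧ σ i.castSucc i.succ
    · obtain ⟨i, hf, hσ⟩ := h
      obtain ⟨τ, rfl⟩ := exists_comap_predAbove hσ
      obtain ⟨t, ht⟩ := (predAbove_surjective i).hasRightInverse
      obtain ⟨m, f', σ', q, hq⟩ := ih (f ∘ t) τ
      have hf' : (f ∘ t) ∘ i.predAbove = f := funext fun x => by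
        rcases eq_or_of_predAbove_eq (ht (i.predAbove x)) with e | ⟨e1, e2⟩ | ⟨e1, e2⟩ <;>
          simp_all
      have := hq.comap (predAbove_mono i) (predAbove_surjective i)
      rw [hf'] at this
      exact ⟨m, f', σ', _, this⟩
    · have key : ∀ a b : Fin (n + 1), a < b → ¬ RedRel f σ a b := by
        intro a b hab hr
        obtain ⟨i, rfl⟩ : ∃ i : Fin n, i.castSucc = a :=
          ⟨⟨a.val, by have := b.isLt; rw [Fin.lt_def] at hab; omega⟩, rfl⟩
        have hib : i.succ ≤ b := by
          rw [Fin.lt_def] at hab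
          rw [Fin.le_def]
          simp at *
          omega
        obtain ⟨h1, h2⟩ := hr i.succ (by simp [Fin.le_def]) (by simp [hib])
        exact h ⟨i, h1.symm, σ.symm h2⟩
      refine ⟨n + 1, f, σ, id, monotone_id, Function.surjective_id, fun a b => ⟨?_, fun hr => ?_⟩,
        fun _ => rfl, fun _ _ => Iff.rfl⟩
      · rintro rfl r h1 h2
        obtain rfl : r = a := le_antisymm (by simpa using h2) (by simpa using h1)
        exact ⟨rfl, σ.refl _⟩
      · rcases lt_trichotomy a b with hab | hab | hab
        · exact absurd hr (key a b hab)
        · exact hab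
        · refine absurd (fun r h1 h2 => ?_) (key b a hab)
          have hr' : ∀ r, min a b ≤ r → r ≤ max a b → f r = f a ∧ σ r a := hr
          have hb := hr' b (min_le_right _ _) (le_max_right _ _)
          have := hr' r (by rwa [min_comm]) (by rwa [max_comm])
          exact ⟨this.1.trans hb.1.symm, σ.trans this.2 (σ.symm hb.2)⟩

/-- Admissible weights do not change when equivalent neighbours of the same colour are merged. -/
lemma weight_comap {α : Weights F} (hα : α.Admissible) {s : Fin n → Fin m} (hs : Monotone s)
    (hs' : Function.Surjective s) (f : Fin m → F) (σ : Setoid (Fin m)) :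
    α n (f ∘ s) (σ.comap s) = α m f σ := by
  obtain ⟨k, f', σ', q, h⟩ := exists_isReduction m f σ
  rw [hα.reduction _ _ _ _ _ _ _ h, hα.reduction _ _ _ _ _ _ _ (h.comap hs hs')]

/-! ### Separating two legs of a block -/

lemma unite_iff {π : Setoid (Fin n)} {i j a b : Fin n} :
    unite π i j a b ↔ π a b ∨ (π a i ∧ π j b) ∨ (π a j ∧ π i b) := by
  constructor
  · intro h
    let S : Setoid (Fin n) :=
      { r := fun a b => π a b ∨ (π a i ∧ π j b) ∨ (π a j ∧ π i b)
        iseqv := by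
          have sy : ∀ {x y}, π x y → π y x := fun h => π.symm h
          have tr : ∀ {x y z}, π x y → π y z → π x z := fun h h' => π.trans h h'
          refine ⟨fun x => Or.inl (π.refl x), fun {x y} h => ?_, fun {x y z} h h' => ?_⟩
          · rcases h with h | ⟨h1, h2⟩ | ⟨h1, h2⟩
            · exact Or.inl (sy h)
            · exact Or.inr (Or.inr ⟨sy h2, sy h1⟩)
            · exact Or.inr (Or.inl ⟨sy h2, sy h1⟩)
          · rcases h with h | ⟨h1, h2⟩ | ⟨h1, h2⟩ <;> rcases h' with h' | ⟨h3, h4⟩ | ⟨h3, h4⟩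
            · exact Or.inl (tr h h')
            · exact Or.inr (Or.inl ⟨tr h h3, h4⟩)
            · exact Or.inr (Or.inr ⟨tr h h3, h4⟩)
            · exact Or.inr (Or.inl ⟨h1, tr h2 h'⟩)
            · exact Or.inr (Or.inl ⟨h1, h4⟩)
            · exact Or.inl (tr h1 h4)
            · exact Or.inr (Or.inr ⟨h1, tr h2 h'⟩)
            · exact Or.inl (tr h1 h4)
            · exact Or.inr (Or.inr ⟨h1, h4⟩) }
    have hS : unite π i j ≤ S := by
      refine sup_le (fun {x y} hxy => Or.inl hxy) ?_
      refine Setoid.eqvGen_le ?_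
      rintro x y ⟨rfl, rfl⟩
      exact Or.inr (Or.inl ⟨π.refl _, π.refl _⟩)
    exact hS h
  · have h1 : π ≤ unite π i j := le_sup_left
    have h2 : unite π i j i j :=
      (le_sup_right : Relation.EqvGen.setoid (fun a b => a = i ∧ b = j) ≤ unite π i j)
        (Relation.EqvGen.rel _ _ ⟨rfl, rfl⟩)
    rintro (h | ⟨h, h'⟩ | ⟨h, h'⟩)
    · exact h1 h
    · exact (unite π i j).trans (h1 h) ((unite π i j).trans h2 (h1 h'))
    · exact (unite π i j).trans (h1 h) ((unite π i j).trans ((unite π i j).symm h2) (h1 h'))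

/-- The partition obtained from `σ` by separating the legs in `B` from the legs outside `B`. -/
def cut (σ : Setoid (Fin n)) (B : Finset (Fin n)) : Setoid (Fin n) := σ ⊓ Setoid.ker (· ∈ B)

lemma cut_iff {σ : Setoid (Fin n)} {B : Finset (Fin n)} {a b : Fin n} :
    cut σ B a b ↔ σ a b ∧ (a ∈ B ↔ b ∈ B) := by
  change σ a b ∧ ((a ∈ B) = (b ∈ B)) ↔ _
  rw [eq_iff_iff]

section cut

variable {σ : Setoid (Fin n)} {B : Finset (Fin n)} {i j : Fin n}

lemma unite_self (π : Setoid (Fin n)) (i j : Fin n) : unite π i j i j :=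
  unite_iff.2 (Or.inr (Or.inl ⟨π.refl _, π.refl _⟩))

/-- Together with `unite_cut` and `block_cut`: the partitions that separate `i` and `j` correspond
to the pairs of a partition `σ` with `σ i j` and a part `B` of the block of `i` and `j` that
contains `i` but not `j`. -/
lemma cut_unite {π : Setoid (Fin n)} (hij : ¬ π i j) : cut (unite π i j) (block π i) = π := by
  ext a b
  rw [cut_iff, unite_iff, mem_block, mem_block]
  have sy : ∀ {x y}, π x y → π y x := fun h => π.symm h
  have tr : ∀ {x y z}, π x y → π y z → π x z := fun h h' => π.trans h h'
  constructor
  · rintro ⟨h | ⟨h, h'⟩ | ⟨h, h'⟩, hB⟩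
    · exact h
    · exact absurd (tr (hB.1 (sy h)) (sy h')) hij
    · exact absurd (tr (hB.2 h') h) hij
  · intro h
    exact ⟨Or.inl h, fun h' => tr h' h, fun h' => tr h' (sy h)⟩

lemma not_cut (hi : i ∈ B) (hj : j ∉ B) : ¬ cut σ B i j := by
  rw [cut_iff]
  tauto

lemma unite_cut (hσ : σ i j) (hB : B ⊆ block σ i) (hi : i ∈ B) (hj : j ∉ B) :
    unite (cut σ B) i j = σ := by
  have sy : ∀ {x y}, σ x y → σ y x := fun h => σ.symm h
  have tr : ∀ {x y z}, σ x y → σ y z → σ x z := fun h h' => σ.trans h h'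
  have hB' : ∀ {x}, x ∈ B → σ i x := fun h => mem_block.1 (hB h)
  ext a b
  simp only [unite_iff, cut_iff]
  constructor
  · rintro (h | ⟨h, h'⟩ | ⟨h, h'⟩)
    · exact h.1
    · exact tr h.1 (tr hσ h'.1)
    · exact tr h.1 (tr (sy hσ) h'.1)
  · intro h
    by_cases ha : a ∈ B <;> by_cases hb : b ∈ B
    · exact Or.inl ⟨h, by tauto⟩
    · have h1 := hB' ha
      exact Or.inr (Or.inl ⟨⟨sy h1, by tauto⟩, tr (sy hσ) (tr h1 h), by tauto⟩)
    · have h1 := hB' hb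
      exact Or.inr (Or.inr ⟨⟨tr h (tr (sy h1) hσ), by tauto⟩, h1, by tauto⟩)
    · exact Or.inl ⟨h, by tauto⟩

lemma block_cut (hB : B ⊆ block σ i) (hi : i ∈ B) : block (cut σ B) i = B := by
  ext x
  rw [mem_block, cut_iff]
  constructor
  · rintro ⟨-, h⟩
    exact h.1 hi
  · intro h
    exact ⟨mem_block.1 (hB h), by tauto⟩

lemma block_cut' (hσ : σ i j) (hj : j ∉ B) : block (cut σ B) j = block σ i \ B := by
  ext x
  rw [mem_block, cut_iff, Finset.mem_sdiff, mem_block]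
  constructor
  · rintro ⟨h1, h⟩
    exact ⟨σ.trans hσ h1, by tauto⟩
  · rintro ⟨h1, h⟩
    exact ⟨σ.trans (σ.symm hσ) h1, by tauto⟩

lemma twoBlocks_cut (hσ : σ i j) (hB : B ⊆ block σ i) (hi : i ∈ B) (hj : j ∉ B) :
    twoBlocks (cut σ B) i j = block σ i := by
  unfold twoBlocks
  rw [block_cut hB hi, block_cut' hσ hj]
  ext x
  have := @hB x
  simp only [Finset.mem_union, Finset.mem_sdiff]
  tauto

/-- Cutting replaces the block of `i` by the two blocks `B` and `block σ i \ B`. -/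
lemma prod_blocks_cut (hσ : σ i j) (hB : B ⊆ block σ i) (hi : i ∈ B) (hj : j ∉ B)
    (g : Finset (Fin n) → ℂ) :
    ∏ β ∈ blocks (cut σ B), g β =
      (∏ β ∈ (blocks σ).erase (block σ i), g β) * (g B * g (block σ i \ B)) := by
  have hne : block (cut σ B) j ∈ (blocks (cut σ B)).erase (block (cut σ B) i) :=
    mem_erase_block.2 ⟨block_mem_blocks _ _,
      fun h => not_cut hi hj ((cut σ B).symm (mem_block.1 h))⟩
  rw [← Finset.mul_prod_erase _ _ (block_mem_blocks (cut σ B) i),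
    ← Finset.mul_prod_erase _ _ hne, block_cut' hσ hj]
  have : ((blocks (cut σ B)).erase (block (cut σ B) i)).erase (block σ i \ B) =
      (blocks σ).erase (block σ i) := by
    ext β
    rw [Finset.mem_erase, mem_erase_block, mem_erase_block, ← block_cut' hσ hj]
    constructor
    · rintro ⟨h1, h2, h3⟩
      refine ⟨?_, h3⟩
      obtain ⟨x, rfl⟩ := mem_blocks.1 h2
      have hx : ¬ σ i x := fun hx => by
        by_cases hxB : x ∈ B
        · exact h3 (mem_block.2 (cut_iff.2 ⟨σ.symm hx, by tauto⟩))
        · exact h1 (block_eq_iff.2 (cut_iff.2 ⟨σ.trans (σ.symm hx) hσ, by tauto⟩))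
      refine mem_blocks.2 ⟨x, ?_⟩
      ext y
      rw [mem_block, mem_block, cut_iff]
      refine ⟨fun h => ⟨h, ?_⟩, fun h => h.1⟩
      have hx' : x ∉ B := fun h' => hx (mem_block.1 (hB h'))
      have hy' : y ∉ B := fun h' => hx (σ.trans (mem_block.1 (hB h')) (σ.symm h))
      tauto
    · rintro ⟨h2, h3⟩
      obtain ⟨x, rfl⟩ := mem_blocks.1 h2
      have hx : ¬ σ i x := fun h => h3 (mem_block.2 (σ.symm h))
      have e : block (cut σ B) x = block σ x := by
        ext y
        rw [mem_block, mem_block, cut_iff]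
        refine ⟨fun h => h.1, fun h => ⟨h, ?_⟩⟩
        have hx' : x ∉ B := fun h' => hx (mem_block.1 (hB h'))
        have hy' : y ∉ B := fun h' => hx (σ.trans (mem_block.1 (hB h')) (σ.symm h))
        tauto
      refine ⟨fun h => ?_, e ▸ block_mem_blocks _ _, h3⟩
      rw [h, mem_block] at h3
      exact hx (σ.trans hσ (mem_block.1 (h ▸ self_mem_block σ x : x ∈ block (cut σ B) j) |>
        fun h => (cut_iff.1 h).1))
  rw [this, block_cut hB hi]
  ring

end cut

end Partition

end

noncomputable section

/-! ### Products of neighbouring letters -/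

namespace WordFun

variable {F : Type} {L : Type u} {n m : ℕ}

open Partition

variable (α : Weights F) (col : L → F)

/-- `ψ(x_B)` plus the sum, over all ways of splitting `B` into two blocks separating `i` and `j`, of
the weighted products of the values of `ψ` on the two blocks. If `i` and `j` are neighbours of the
same colour, this is the cumulant of the word in which these two letters are multiplied. -/
def mergedEv (ψ : WordFun L) (w : Fin n → L) (i j : Fin n) (B : Finset (Fin n)) : ℂ :=
  ev ψ w B + ∑ B₁ ∈ B.powerset.filter (fun B₁ => i ∈ B₁ ∧ j ∉ B₁),
    α B.card (col ∘ w ∘ enum B) ((Setoid.ker (· ∈ B₁)).comap (enum B)) *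
      (ev ψ w B₁ * ev ψ w (B \ B₁))

variable {α}

/-- The splitting condition on the weights for a partition in which the block of `i` and `i + 1` is
split into `B` and its complement. -/
lemma weight_cut (hα : α.Admissible) {w : Fin n → L} {σ : Setoid (Fin n)} {i j : Fin n}
    (hij : i.val + 1 = j.val) (hc : col (w i) = col (w j)) (hσ : σ i j) {B : Finset (Fin n)}
    (hB : B ⊆ block σ i) (hi : i ∈ B) (hj : j ∉ B) :
    α n (col ∘ w) (cut σ B) = α n (col ∘ w) σ * α (block σ i).card (col ∘ w ∘ enum (block σ i))
      ((Setoid.ker (· ∈ B)).comap (enum (block σ i))) := by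
  rw [hα.split n (col ∘ w) (cut σ B) i j hij hc (not_cut hi hj), unite_cut hσ hB hi hj,
    twoBlocks_cut hσ hB hi hj]
  congr 2
  ext x y
  change cut σ B _ _ ↔ (Setoid.ker (· ∈ B)) _ _
  rw [cut_iff]
  change _ ↔ ((_ ∈ B) = (_ ∈ B))
  rw [eq_iff_iff, and_iff_right]
  exact σ.trans (σ.symm (mem_block.1 (enum_mem _ x))) (mem_block.1 (enum_mem _ y))

open Classical in
/-- The sum over all partitions, arranged by the partitions which arise by uniting the blocks of two
neighbours of the same colour. -/
lemma exp_eq_sum_mergedEv (hα : α.Admissible) (ψ : WordFun L) {w : Fin n → L} {i j : Fin n}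
    (hij : i.val + 1 = j.val) (hc : col (w i) = col (w j)) :
    exp α col ψ n w = ∑ σ ∈ Finset.univ.filter (fun σ : Setoid (Fin n) => σ i j),
      α n (col ∘ w) σ * ((∏ β ∈ (blocks σ).erase (block σ i), ev ψ w β) *
        mergedEv α col ψ w i j (block σ i)) := by
  rw [exp_eq_ev, ← Finset.sum_filter_add_sum_filter_not _ (fun σ : Setoid (Fin n) => σ i j)]
  simp only [mergedEv, mul_add, Finset.sum_add_distrib]
  congr 1
  · refine Finset.sum_congr rfl fun σ _ => ?_
    rw [prod_blocks_eq σ i]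
    ring
  · simp only [Finset.mul_sum]
    rw [Finset.sum_sigma']
    refine Finset.sum_bij' (fun π _ => ⟨unite π i j, block π i⟩) (fun x _ => cut x.1 x.2)
      ?_ ?_ ?_ ?_ ?_
    · intro π hπ
      have hπ' : ¬ π i j := (Finset.mem_filter.1 hπ).2
      simp only [Finset.mem_sigma, Finset.mem_filter, Finset.mem_univ, true_and,
        Finset.mem_powerset]
      refine ⟨unite_self π i j, fun x hx => ?_, self_mem_block π i, fun h => hπ' (mem_block.1 h)⟩
      exact mem_block.2 (unite_iff.2 (Or.inl (mem_block.1 hx)))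
    · rintro ⟨σ, B⟩ h
      simp only [Finset.mem_sigma, Finset.mem_filter, Finset.mem_univ, true_and,
        Finset.mem_powerset] at h
      simpa using not_cut h.2.2.1 h.2.2.2
    · intro π hπ
      exact cut_unite (Finset.mem_filter.1 hπ).2
    · rintro ⟨σ, B⟩ h
      simp only [Finset.mem_sigma, Finset.mem_filter, Finset.mem_univ, true_and,
        Finset.mem_powerset] at h
      obtain ⟨h1, h2, h3, h4⟩ := h
      simp only [unite_cut h1 h2 h3 h4, block_cut h2 h3]
    · intro π hπ
      have hπ' : ¬ π i j := (Finset.mem_filter.1 hπ).2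
      have h1 := unite_self π i j
      have h2 : block π i ⊆ block (unite π i j) i := fun x hx =>
        mem_block.2 (unite_iff.2 (Or.inl (mem_block.1 hx)))
      have h3 := self_mem_block π i
      have h4 : j ∉ block π i := fun h => hπ' (mem_block.1 h)
      have e1 := weight_cut col hα hij hc h1 h2 h3 h4
      have e2 := prod_blocks_cut h1 h2 h3 h4 (ev ψ w)
      rw [cut_unite hπ'] at e1 e2
      rw [e1, e2]
      ring

/-- `mergedEv` on the subword with positions in the range of `g`. -/
lemma mergedEv_comp (ψ : WordFun L) (w : Fin n → L) {g : Fin m → Fin n} (hg : StrictMono g)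
    {B : Finset (Fin n)} (hB : ∀ x, x ∈ B ↔ ∃ y, g y = x) (a b : Fin m) :
    mergedEv α col ψ (w ∘ g) a b Finset.univ = mergedEv α col ψ w (g a) (g b) B := by
  classical
  have hgi : ∀ x (C : Finset (Fin m)), g x ∈ C.image g ↔ x ∈ C := fun x C => by
    simp [hg.injective.eq_iff]
  unfold mergedEv
  congr 1
  · exact ev_comp ψ w hg _ (by simpa using hB)
  · refine Finset.sum_bij' (fun C _ => C.image g) (fun C _ => Finset.univ.filter (g · ∈ C))
      ?_ ?_ ?_ ?_ ?_
    · intro C hC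
      simp only [Finset.mem_filter, Finset.mem_powerset, hgi] at hC ⊢
      refine ⟨fun x hx => ?_, hC.2⟩
      obtain ⟨y, -, rfl⟩ := Finset.mem_image.1 hx
      exact (hB _).2 ⟨y, rfl⟩
    · intro C hC
      simp only [Finset.mem_filter, Finset.mem_powerset] at hC ⊢
      simpa using hC.2
    · intro C hC
      ext x
      simp only [Finset.mem_filter, Finset.mem_univ, true_and, hgi]
    · intro C hC
      simp only [Finset.mem_filter, Finset.mem_powerset] at hC
      ext x
      simp only [Finset.mem_image, Finset.mem_filter, Finset.mem_univ, true_and]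
      constructor
      · rintro ⟨y, hy, rfl⟩
        exact hy
      · intro hx
        obtain ⟨y, rfl⟩ := (hB x).1 (hC.1 hx)
        exact ⟨y, hx, rfl⟩
    · intro C hC
      have e1 := enum_transport (γ := ℂ) (strictMono_id (α := Fin m)) (β := Finset.univ) (by simp)
        (fun k e => α k (col ∘ (w ∘ g) ∘ e) ((Setoid.ker (· ∈ C)).comap e))
      have e2 := enum_transport (γ := ℂ) hg hB
        (fun k e => α k (col ∘ w ∘ e) ((Setoid.ker (· ∈ C.image g)).comap e))
      rw [e1, e2]
      congr 1
      · congr 1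
        ext x y
        change ((x ∈ C) = (y ∈ C)) ↔ ((g x ∈ C.image g) = (g y ∈ C.image g))
        rw [hgi, hgi]
      · congr 1
        · exact ev_comp ψ w hg _ (by simp)
        · refine ev_comp ψ w hg _ fun x => ?_
          simp only [Finset.mem_sdiff, Finset.mem_univ, true_and]
          constructor
          · rintro ⟨h1, h2⟩
            obtain ⟨y, rfl⟩ := (hB x).1 h1
            rw [hgi] at h2
            exact ⟨y, h2, rfl⟩
          · rintro ⟨y, hy, rfl⟩
            rw [hgi]
            exact ⟨(hB _).2 ⟨y, rfl⟩, hy⟩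

/-- The word `w'` arises from `w` by replacing the letters at `i` and `i + 1` by a single letter
which is related to them by `R` (it will be their product). -/
def IsMerge (R : L → L → L → Prop) (w : Fin (n + 1) → L) (w' : Fin n → L) (i : Fin n) : Prop :=
  R (w i.castSucc) (w i.succ) (w' i) ∧ ∀ x, i.predAbove x ≠ i → w x = w' (i.predAbove x)

/-- The positions of `w` which are mapped into `β` when `i` and `i + 1` are merged. -/
def unmerge (i : Fin n) (β : Finset (Fin n)) : Finset (Fin (n + 1)) :=
  Finset.univ.filter (i.predAbove · ∈ β)

lemma mem_unmerge {i : Fin n} {β : Finset (Fin n)} {x : Fin (n + 1)} :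
    x ∈ unmerge i β ↔ i.predAbove x ∈ β := by
  simp [unmerge]

lemma block_comap_predAbove (i : Fin n) (σ : Setoid (Fin n)) (x : Fin (n + 1)) :
    block (σ.comap i.predAbove) x = unmerge i (block σ (i.predAbove x)) := by
  ext y
  rw [mem_block, mem_unmerge, mem_block]
  rfl

/-- The extension to the unmerged positions of an enumeration of merged positions. -/
def unmergeMap (p : Fin m) (g : Fin m → Fin n) (x : Fin (m + 1)) : Fin (n + 1) :=
  if x ≤ p.castSucc then (g (p.predAbove x)).castSucc else (g (p.predAbove x)).succ

section unmergeMap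

variable {p : Fin m} {g : Fin m → Fin n} (hg : StrictMono g)

include hg

lemma unmergeMap_strictMono : StrictMono (unmergeMap p g) := by
  intro x y hxy
  have hxy' : x.val < y.val := hxy
  have hx := predAbove_val p x
  have hy := predAbove_val p y
  have hm : p.predAbove x < p.predAbove y → (g (p.predAbove x)).val < (g (p.predAbove y)).val :=
    fun h => hg h
  have hm' : (g (p.predAbove x)).val ≤ (g (p.predAbove y)).val :=
    hg.monotone (predAbove_mono p hxy.le)
  simp only [Fin.lt_def, hx, hy] at hm
  unfold unmergeMap
  simp only [Fin.le_def, Fin.lt_def, Fin.val_castSucc]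
  split_ifs at * <;> simp <;> omega

lemma predAbove_unmergeMap (x : Fin (m + 1)) :
    (g p).predAbove (unmergeMap p g x) = g (p.predAbove x) := by
  have hx := predAbove_val p x
  have h1 : p.predAbove x ≤ p → (g (p.predAbove x)).val ≤ (g p).val := fun h => hg.monotone h
  have h2 : p ≤ p.predAbove x → (g p).val ≤ (g (p.predAbove x)).val := fun h => hg.monotone h
  simp only [Fin.le_def, hx] at h1 h2
  apply Fin.ext
  rw [predAbove_val]
  unfold unmergeMap
  simp only [Fin.le_def, Fin.val_castSucc]
  split_ifs at * <;> simp at * <;> omega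

lemma mem_unmerge_iff {β : Finset (Fin n)} (hr : ∀ x, x ∈ β ↔ ∃ y, g y = x) (x : Fin (n + 1)) :
    x ∈ unmerge (g p) β ↔ ∃ y, unmergeMap p g y = x := by
  rw [mem_unmerge, hr]
  constructor
  · rintro ⟨y, hy⟩
    have hv := congrArg Fin.val hy
    rw [predAbove_val] at hv
    by_cases hx : x.val ≤ (g p).val
    · have hyp : y ≤ p := hg.le_iff_le.1 (by rw [Fin.le_def]; split_ifs at hv <;> omega)
      refine ⟨y.castSucc, ?_⟩
      have hs : p.predAbove y.castSucc = y := Fin.ext (by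
        rw [predAbove_val]
        simp [hyp])
      unfold unmergeMap
      rw [hs, if_pos (by simpa using hyp)]
      apply Fin.ext
      simp
      split_ifs at hv <;> omega
    · have hyp : p ≤ y := hg.le_iff_le.1 (by rw [Fin.le_def]; split_ifs at hv <;> omega)
      refine ⟨y.succ, ?_⟩
      have hyp' : p.val ≤ y.val := hyp
      have hs : p.predAbove y.succ = y := Fin.ext (by
        rw [predAbove_val]
        simp
        omega)
      unfold unmergeMap
      have hn : ¬ y.succ ≤ p.castSucc := fun h => by
        have : y.val + 1 ≤ p.val := h
        omega
      rw [hs, if_neg hn]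
      apply Fin.ext
      simp
      split_ifs at hv <;> omega
  · rintro ⟨y, rfl⟩
    exact ⟨p.predAbove y, (predAbove_unmergeMap hg y).symm⟩

omit hg in
lemma unmergeMap_castSucc : unmergeMap p g p.castSucc = (g p).castSucc := by
  simp [unmergeMap]

omit hg in
lemma unmergeMap_succ : unmergeMap p g p.succ = (g p).succ := by
  simp [unmergeMap]

lemma IsMerge.comp {R : L → L → L → Prop} {w : Fin (n + 1) → L} {w' : Fin n → L}
    (h : IsMerge R w w' (g p)) : IsMerge R (w ∘ unmergeMap p g) (w' ∘ g) p := by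
  refine ⟨?_, fun x hx => ?_⟩
  · simp only [Function.comp, unmergeMap_castSucc, unmergeMap_succ]
    exact h.1
  · simp only [Function.comp, ← predAbove_unmergeMap hg]
    refine h.2 _ ?_
    rw [predAbove_unmergeMap hg]
    exact fun e => hx (hg.injective e)

end unmergeMap

variable (α) in
/-- `ψ` satisfies the formula for cumulants with products as entries, where `R x y z` stands for
`x y = z`. -/
def MergesCumulants (R : L → L → L → Prop) (ψ : WordFun L) : Prop :=
  ∀ (n : ℕ) (i : Fin n) (w : Fin (n + 1) → L) (w' : Fin n → L), IsMerge R w w' i →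
    mergedEv α col ψ w i.castSucc i.succ Finset.univ = ψ n w'

/-- `Φ` takes the same value on a word and on the word with two merged letters. -/
def MergesMoments (R : L → L → L → Prop) (Φ : WordFun L) : Prop :=
  ∀ (n : ℕ) (i : Fin n) (w : Fin (n + 1) → L) (w' : Fin n → L), IsMerge R w w' i →
    Φ (n + 1) w = Φ n w'

variable {R : L → L → L → Prop} (hR : ∀ a b c, R a b c → col a = col c ∧ col b = col c)
include hR

/-- The expansion of `exp ψ` on a word, by the partitions of the word with two merged letters. -/
lemma exp_eq_sum_unmerge (hα : α.Admissible) (ψ : WordFun L) {w : Fin (n + 1) → L}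
    {w' : Fin n → L} {i : Fin n} (h : IsMerge R w w' i) :
    exp α col ψ (n + 1) w = ∑ σ : Setoid (Fin n),
      α n (col ∘ w') σ * ((∏ β ∈ (blocks σ).erase (block σ i), ev ψ w' β) *
        mergedEv α col ψ w i.castSucc i.succ (unmerge i (block σ i))) := by
  classical
  obtain ⟨c1, c2⟩ := hR _ _ _ h.1
  have hc : col ∘ w = (col ∘ w') ∘ i.predAbove := funext fun x => by
    by_cases hx : i.predAbove x = i
    · rcases eq_or_of_predAbove_eq (hx.trans (predAbove_castSucc i).symm) with e | ⟨e, -⟩ | ⟨e, -⟩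
      · simp [e, c1]
      · simp [e, c1]
      · simp [e, c2]
    · simp [h.2 x hx]
  rw [exp_eq_sum_mergedEv (i := i.castSucc) (j := i.succ) col hα ψ (by simp) (c1.trans c2.symm)]
  symm
  refine Finset.sum_bij (fun σ _ => σ.comap i.predAbove) ?_ ?_ ?_ ?_
  · intro σ _
    simp only [Finset.mem_filter, Finset.mem_univ, true_and]
    change σ (i.predAbove i.castSucc) (i.predAbove i.succ)
    simp
  · intro σ _ τ _ e
    obtain ⟨t, ht⟩ := (predAbove_surjective i).hasRightInverse
    ext x y
    have : σ.comap i.predAbove (t x) (t y) ↔ τ.comap i.predAbove (t x) (t y) := by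
      rw [e]
    change σ (i.predAbove (t x)) (i.predAbove (t y)) ↔ τ (i.predAbove (t x)) (i.predAbove (t y))
      at this
    rwa [ht, ht] at this
  · intro σ' hσ'
    obtain ⟨σ, hσ⟩ := exists_comap_predAbove (Finset.mem_filter.1 hσ').2
    exact ⟨σ, Finset.mem_univ _, hσ⟩
  · intro σ _
    rw [hc, weight_comap hα (predAbove_mono i) (predAbove_surjective i), block_comap_predAbove,
      predAbove_castSucc]
    congr 2
    refine Finset.prod_bij (fun β _ => unmerge i β) ?_ ?_ ?_ ?_
    · intro β hβ
      obtain ⟨h1, h2⟩ := mem_erase_block.1 hβ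
      obtain ⟨x, rfl⟩ := mem_blocks.1 h1
      obtain ⟨y, rfl⟩ := predAbove_surjective i x
      have h3 : i.castSucc ∉ unmerge i (block σ (i.predAbove y)) := by
        rwa [mem_unmerge, predAbove_castSucc]
      have := block_comap_predAbove i σ i.castSucc
      rw [predAbove_castSucc] at this
      rw [← this, mem_erase_block]
      refine ⟨?_, h3⟩
      rw [← block_comap_predAbove]
      exact block_mem_blocks _ _
    · intro β _ γ _ e
      ext x
      obtain ⟨y, rfl⟩ := predAbove_surjective i x
      rw [← mem_unmerge, ← mem_unmerge]
      rw [e]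
    · intro β hβ
      have := block_comap_predAbove i σ i.castSucc
      rw [predAbove_castSucc] at this
      rw [← this] at hβ
      obtain ⟨h1, h2⟩ := mem_erase_block.1 hβ
      obtain ⟨x, rfl⟩ := mem_blocks.1 h1
      refine ⟨block σ (i.predAbove x), mem_erase_block.2 ⟨block_mem_blocks _ _, ?_⟩,
        (block_comap_predAbove i σ x).symm⟩
      rw [block_comap_predAbove, mem_unmerge, predAbove_castSucc] at h2
      exact h2
    · intro β hβ
      have h2 := (mem_erase_block.1 hβ).2
      -- away from `i` the map merging the two letters is injective
      obtain ⟨t, ht⟩ := (predAbove_surjective i).hasRightInverse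
      have hmono : StrictMono (t ∘ enum β) := fun x y hxy => by
        have h' := enum_strictMono β hxy
        by_contra hle
        have := predAbove_mono i (not_lt.1 hle)
        simp only [Function.comp, ht _] at this
        exact absurd h' (not_lt.2 this)
      have hw : w ∘ t ∘ enum β = w' ∘ enum β := funext fun x => by
        have := h.2 (t (enum β x)) (by
          rw [ht]
          intro e
          exact h2 (e ▸ enum_mem β x))
        simp [this, ht _]
      have := ev_eq ψ w (β := unmerge i β) hmono (fun x => ?_)
      · rw [this, hw]
        rfl
      · rw [mem_unmerge]
        constructor
        · intro hx
          obtain ⟨y, hy⟩ := (mem_iff_enum _).1 hx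
          refine ⟨y, ?_⟩
          have hne : i.predAbove x ≠ i := fun e => h2 (e ▸ hx)
          simp only [Function.comp, hy]
          rcases eq_or_of_predAbove_eq (ht (i.predAbove x)) with e | ⟨-, e⟩ | ⟨-, e⟩
          · exact e
          · exact absurd (by rw [e, predAbove_succ]) hne
          · exact absurd (by rw [e, predAbove_castSucc]) hne
        · rintro ⟨y, rfl⟩
          simp only [Function.comp, ht _]
          exact enum_mem β y

omit hR in
lemma mergedEv_unmerge {ψ : WordFun L} {w : Fin (n + 1) → L} {w' : Fin n → L} {i : Fin n}
    (h : IsMerge R w w' i) {β : Finset (Fin n)} (hi : i ∈ β)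
    (hψ : ∀ (p : Fin β.card) (w : Fin (β.card + 1) → L) (w' : Fin β.card → L), IsMerge R w w' p →
      mergedEv α col ψ w p.castSucc p.succ Finset.univ = ψ _ w') :
    mergedEv α col ψ w i.castSucc i.succ (unmerge i β) = ev ψ w' β := by
  obtain ⟨p, rfl⟩ := (mem_iff_enum i).1 hi
  have hg := enum_strictMono β
  rw [← unmergeMap_castSucc (g := enum β), ← unmergeMap_succ (g := enum β),
    ← mergedEv_comp col ψ w (unmergeMap_strictMono hg) (mem_unmerge_iff hg mem_iff_enum)]
  exact hψ p _ _ (h.comp hg)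

/-- If the cumulants `ψ` satisfy the formula for products as entries, then the moments `exp ψ` do
not change when two neighbouring letters are multiplied. -/
lemma MergesCumulants.exp (hα : α.Admissible) {ψ : WordFun L} (hψ : MergesCumulants α col R ψ) :
    MergesMoments R (WordFun.exp α col ψ) := by
  intro n i w w' h
  rw [exp_eq_sum_unmerge col hR hα ψ h, exp_eq_ev]
  refine Finset.sum_congr rfl fun σ _ => ?_
  rw [mergedEv_unmerge col h (self_mem_block σ i) (hψ _), prod_blocks_eq σ i]
  ring

/-- The converse of `MergesCumulants.exp`, by induction on the length of the word. -/
lemma MergesMoments.log (hα : α.Admissible) {Φ : WordFun L} (hΦ : MergesMoments R Φ) :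
    MergesCumulants α col R (WordFun.log α col Φ) := by
  classical
  intro n
  induction n using Nat.strong_induction_on with
  | _ n ih =>
    intro i w w' h
    have e1 := hΦ n i w w' h
    rw [← exp_log col hα.one_block Φ (Nat.succ_pos n), ← exp_log col hα.one_block Φ i.pos,
      exp_eq_sum_unmerge col hR hα _ h, exp_eq_ev] at e1
    -- all summands except for the ones of the maximal partition agree by induction
    rw [← Finset.add_sum_erase _ _ (Finset.mem_univ ⊤),
      ← Finset.add_sum_erase (a := (⊤ : Setoid (Fin n))) _ _ (Finset.mem_univ ⊤)] at e1
    have e2 : ∀ σ ∈ (Finset.univ : Finset (Setoid (Fin n))).erase ⊤,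
        α n (col ∘ w') σ * ((∏ β ∈ (blocks σ).erase (block σ i),
          ev (WordFun.log α col Φ) w' β) *
          mergedEv α col (WordFun.log α col Φ) w i.castSucc i.succ (unmerge i (block σ i))) =
        α n (col ∘ w') σ * ∏ β ∈ blocks σ, ev (WordFun.log α col Φ) w' β := by
      intro σ hσ
      rw [mergedEv_unmerge col h (self_mem_block σ i) (ih _ (card_lt_of_mem_blocks
        (Finset.ne_of_mem_erase hσ) (block_mem_blocks σ i))), prod_blocks_eq σ i]
      ring
    rw [Finset.sum_congr rfl e2, add_left_inj, hα.one_block, one_mul, one_mul,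
      prod_blocks_eq ⊤ i] at e1
    have hb : block (⊤ : Setoid (Fin n)) i = Finset.univ := by
      ext j
      simp [mem_block]
    have hu : unmerge i (Finset.univ : Finset (Fin n)) = Finset.univ := by
      ext j
      simp [mem_unmerge]
    have he : (blocks (⊤ : Setoid (Fin n))).erase Finset.univ = ∅ := by
      rw [blocks_top i.pos]
      simp
    rw [hb, hu, he, Finset.prod_empty, one_mul, mul_one, ev_univ] at e1
    exact e1

end WordFun

end

noncomputable section

/-! ### Ordered products and generators -/

section ordProd

variable {A B : Type u} [NonUnitalRing A] [NonUnitalRing B]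

lemma ordProd_cons (a : A) {l : List A} (hl : l ≠ []) : ordProd (a :: l) = a * ordProd l := by
  cases l with
  | nil => exact absurd rfl hl
  | cons b l => rfl

variable [Module ℂ A] [IsScalarTower ℂ A A] [SMulCommClass ℂ A A]
  [Module ℂ B] [IsScalarTower ℂ B B] [SMulCommClass ℂ B B]

omit [IsScalarTower ℂ A A] [SMulCommClass ℂ A A] in
lemma inr_ordProd {l : List A} (hl : l ≠ []) :
    ((ordProd l : A) : Unitization ℂ A) = (l.map (fun a : A => (a : Unitization ℂ A))).prod := by
  induction l with
  | nil => exact absurd rfl hl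
  | cons a l ih =>
    by_cases h : l = []
    · subst h
      simp [ordProd]
    · rw [ordProd_cons a h, Unitization.inr_mul, ih h]
      simp

lemma ordProd_append {l l' : List A} (hl : l ≠ []) (hl' : l' ≠ []) :
    ordProd (l ++ l') = ordProd l * ordProd l' := by
  apply Unitization.inr_injective (R := ℂ)
  rw [Unitization.inr_mul, inr_ordProd hl, inr_ordProd hl', inr_ordProd (by simp [hl])]
  simp

omit [IsScalarTower ℂ A A] [SMulCommClass ℂ A A] [IsScalarTower ℂ B B]
  [SMulCommClass ℂ B B] in
lemma map_ordProd (h : A →ₙₐ[ℂ] B) (l : List A) : h (ordProd l) = ordProd (l.map h) := by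
  induction l with
  | nil => exact map_zero h
  | cons a l ih =>
    by_cases hl : l = []
    · subst hl
      rfl
    · rw [ordProd_cons a hl, map_mul, ih, List.map_cons, ordProd_cons _ (by simpa using hl)]

/-- A linear functional is determined by its values on products of generators. -/
lemma functional_ext {S : Set A} (hS : ∀ a, a ∈ NonUnitalAlgebra.adjoin ℂ S) {φ ψ : A →ₗ[ℂ] ℂ}
    (h : ∀ l : List A, l ≠ [] → (∀ x ∈ l, x ∈ S) → φ (ordProd l) = ψ (ordProd l)) : φ = ψ := by
  ext a
  have ha := hS a
  rw [← NonUnitalSubalgebra.mem_toSubmodule, NonUnitalAlgebra.adjoin_eq_span] at ha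
  refine LinearMap.eqOn_span (fun x hx => ?_) ha
  suffices key : ∃ l : List A, l ≠ [] ∧ (∀ x ∈ l, x ∈ S) ∧ ordProd l = x by
    obtain ⟨l, h1, h2, rfl⟩ := key
    exact h l h1 h2
  induction hx using Subsemigroup.closure_induction with
  | mem x hx => exact ⟨[x], by simp, by simpa using hx, rfl⟩
  | mul x y _ _ ihx ihy =>
    obtain ⟨l, h1, h2, rfl⟩ := ihx
    obtain ⟨l', h1', h2', rfl⟩ := ihy
    exact ⟨l ++ l', by simp [h1], fun x hx => (List.mem_append.1 hx).elim (h2 x) (h2' x),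
      ordProd_append h1 h1'⟩

end ordProd

namespace MFAlg

variable {F : Type}

/-- A set generates a multi-faced algebra if the subalgebra generated by it contains all faces: by
freeness, the embeddings of the faces extend to a retraction of the algebra to this subalgebra. -/
lemma mem_adjoin_of_face (A : MFAlg.{u} F) {S : Set A}
    (hS : ∀ q, ∀ x ∈ A.face q, x ∈ NonUnitalAlgebra.adjoin ℂ S) (a : A) :
    a ∈ NonUnitalAlgebra.adjoin ℂ S := by
  let T := NonUnitalAlgebra.adjoin ℂ S
  let h : ∀ q, A.face q →ₙₐ[ℂ] T := fun q =>
    NonUnitalAlgHom.codRestrict (NonUnitalSubalgebraClass.subtype (A.face q)) T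
      (fun x => hS q x x.2)
  obtain ⟨g, hg, -⟩ := A.free T h
  obtain ⟨g', -, hu⟩ := A.free A (fun q => NonUnitalSubalgebraClass.subtype (A.face q))
  have e1 : (NonUnitalSubalgebraClass.subtype T).comp g = g' := hu _ fun q x => by
    change ((g x : T) : A) = x
    rw [hg q x]
    rfl
  have e2 : NonUnitalAlgHom.id ℂ A = g' := hu _ fun q x => rfl
  have : ((g a : T) : A) = a := DFunLike.congr_fun (e1.trans e2.symm) a
  rw [← this]
  exact (g a).2

lemma mem_adjoin_coprod {A B : MFAlg.{u} F} {S : Set (A.coprod B)}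
    (hA : ∀ q, ∀ x ∈ A.face q, inl A B x ∈ NonUnitalAlgebra.adjoin ℂ S)
    (hB : ∀ q, ∀ x ∈ B.face q, inr A B x ∈ NonUnitalAlgebra.adjoin ℂ S) (a : A.coprod B) :
    a ∈ NonUnitalAlgebra.adjoin ℂ S := by
  refine mem_adjoin_of_face _ (fun q x hx => ?_) a
  refine NonUnitalAlgebra.adjoin_le (S := NonUnitalAlgebra.adjoin ℂ S) ?_ hx
  rintro _ (⟨a, ha, rfl⟩ | ⟨b, hb, rfl⟩)
  · exact hA q a ha
  · exact hB q b hb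

/-- If `S` generates `A`, then homomorphisms from `A` map into the subalgebra generated by a set
which contains the image of `S`. -/
lemma hom_mem_adjoin {A B : MFAlg.{u} F} (h : Hom A B) {S : Set A} {T : Set B}
    (hS : ∀ a, a ∈ NonUnitalAlgebra.adjoin ℂ S) (hT : ∀ x ∈ S, h x ∈ NonUnitalAlgebra.adjoin ℂ T)
    (a : A) : h a ∈ NonUnitalAlgebra.adjoin ℂ T :=
  NonUnitalAlgebra.adjoin_le (S := (NonUnitalAlgebra.adjoin ℂ T).comap h.toHom) hT (hS a)

lemma Hom.ext_iff' {A B : MFAlg.{u} F} {g h : Hom A B} : g = h ↔ ∀ x, g x = h x := by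
  constructor
  · rintro rfl x
    rfl
  · intro e
    cases g
    cases h
    congr
    ext x
    exact e x

variable {A B C : MFAlg.{u} F}

@[simp] lemma lift_inl (g : Hom A C) (h : Hom B C) (x : A) : lift g h (inl A B x) = g x :=
  FreeProd.lift_inl _ _ _

@[simp] lemma lift_inr (g : Hom A C) (h : Hom B C) (x : B) : lift g h (inr A B x) = h x :=
  FreeProd.lift_inr _ _ _

@[simp] lemma Hom.comp_apply (g : Hom B C) (h : Hom A B) (x : A) : g.comp h x = g (h x) := rfl

@[simp] lemma Functional.comp_apply (φ : B.Functional) (h : Hom A B) (x : A) :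
    φ.comp h x = φ (h x) := rfl

lemma Hom.map_ordProd (h : Hom A B) (l : List A) : h (ordProd l) = ordProd (l.map h) :=
  _root_.map_ordProd h.toHom l

end MFAlg

/-! ### Functionals on lists of letters -/

section Lists

variable {L : Type u} (Lin : ℂ → L → L → L → Prop) (Mul : L → L → L → Prop)

/-- The functionals on lists which are linear in every letter and take the same value on lists in
which two neighbouring letters are multiplied. The relations `Lin c x y z` and `Mul x y z` stand for
`x = c y + z` and `x y = z`. -/
def consistent : Submodule ℂ (List L → ℂ) where
  carrier := {Φ | (∀ c x y z, Lin c x y z → ∀ u v, Φ (u ++ x :: v) =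
      c * Φ (u ++ y :: v) + Φ (u ++ z :: v)) ∧
    ∀ x y z, Mul x y z → ∀ u v, Φ (u ++ x :: y :: v) = Φ (u ++ z :: v)}
  add_mem' := by
    rintro Φ Ψ ⟨h1, h2⟩ ⟨h3, h4⟩
    refine ⟨fun c x y z h u v => ?_, fun x y z h u v => ?_⟩
    · simp only [Pi.add_apply, h1 c x y z h, h3 c x y z h]
      ring
    · simp only [Pi.add_apply, h2 x y z h, h4 x y z h]
  zero_mem' := by
    refine ⟨fun c x y z h u v => ?_, fun x y z h u v => ?_⟩ <;> simp
  smul_mem' := by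
    rintro r Φ ⟨h1, h2⟩
    refine ⟨fun c x y z h u v => ?_, fun x y z h u v => ?_⟩
    · simp only [Pi.smul_apply, smul_eq_mul, h1 c x y z h]
      ring
    · simp only [Pi.smul_apply, h2 x y z h]

/-- The operator `(R_x Φ)(u) = Φ(u x)` on consistent functionals. -/
def appendOp (x : L) : Module.End ℂ (consistent Lin Mul) where
  toFun Φ := ⟨fun u => Φ.1 (u ++ [x]), fun c a b d h u v => by
      simpa using Φ.2.1 c a b d h u (v ++ [x]), fun a b d h u v => by
      simpa using Φ.2.2 a b d h u (v ++ [x])⟩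
  map_add' Φ Ψ := rfl
  map_smul' c Φ := rfl

variable {Lin Mul}

lemma appendOp_lin {c : ℂ} {x y z : L} (h : Lin c x y z) :
    appendOp Lin Mul x = c • appendOp Lin Mul y + appendOp Lin Mul z := by
  ext Φ u
  exact Φ.2.1 c x y z h u []

lemma appendOp_mul {x y z : L} (h : Mul x y z) :
    appendOp Lin Mul x * appendOp Lin Mul y = appendOp Lin Mul z := by
  ext Φ u
  change Φ.1 (u ++ [x] ++ [y]) = Φ.1 (u ++ [z])
  simpa using Φ.2.2 x y z h u []

lemma ordProd_appendOp {l : List L} (hl : l ≠ []) (Φ : consistent Lin Mul) (u : List L) :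
    (ordProd (l.map (appendOp Lin Mul)) Φ).1 u = Φ.1 (u ++ l) := by
  induction l generalizing u with
  | nil => exact absurd rfl hl
  | cons x l ih =>
    by_cases h : l = []
    · subst h
      rfl
    · rw [List.map_cons, ordProd_cons _ (by simpa using h)]
      change (ordProd (l.map (appendOp Lin Mul)) Φ).1 (u ++ [x]) = _
      rw [ih h]
      simp

end Lists

namespace MFAlg

variable {F : Type}

/-- `x`, `y` and `z` lie in the same face, and `x = c y + z`. -/
inductive LetterLin (A : MFAlg.{u} F) (c : ℂ) : A.Letter → A.Letter → A.Letter → Prop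
  | mk (q : F) (y z : A.face q) : LetterLin A c ⟨q, c • y + z⟩ ⟨q, y⟩ ⟨q, z⟩

/-- `x`, `y` and `z` lie in the same face, and `x y = z`. -/
inductive LetterMul (A : MFAlg.{u} F) : A.Letter → A.Letter → A.Letter → Prop
  | mk (q : F) (x y : A.face q) : LetterMul A ⟨q, x⟩ ⟨q, y⟩ ⟨q, x * y⟩

/-- The homomorphism from `A` to operators on consistent functionals that maps the letters to the
corresponding operators. -/
lemma exists_hom_appendOp (A : MFAlg.{u} F) {L : Type u} (e : A.Letter → L)
    (Lin : ℂ → L → L → L → Prop) (Mul : L → L → L → Prop)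
    (hLin : ∀ c x y z, A.LetterLin c x y z → Lin c (e x) (e y) (e z))
    (hMul : ∀ x y z, A.LetterMul x y z → Mul (e x) (e y) (e z)) :
    ∃ g : A →ₙₐ[ℂ] Module.End ℂ (consistent Lin Mul),
      ∀ x : A.Letter, g (x.2 : A) = appendOp Lin Mul (e x) := by
  have hl : ∀ q c (y z : A.face q), appendOp Lin Mul (e ⟨q, c • y + z⟩) =
      c • appendOp Lin Mul (e ⟨q, y⟩) + appendOp Lin Mul (e ⟨q, z⟩) := fun q c y z =>
    appendOp_lin (hLin _ _ _ _ ⟨q, y, z⟩)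
  have h0 : ∀ q, appendOp Lin Mul (e ⟨q, 0⟩) = 0 := fun q => by
    have := hl q 1 0 0
    rw [smul_zero, add_zero, one_smul] at this
    ext Φ u
    exact left_eq_add.1 (congrArg (fun T : Module.End ℂ (consistent Lin Mul) => (T Φ).1 u) this)
  obtain ⟨g, hg, -⟩ := A.free (Module.End ℂ (consistent Lin Mul)) fun q =>
    { toFun := fun x => appendOp Lin Mul (e ⟨q, x⟩)
      map_smul' := fun c x => by simpa [h0] using hl q c x 0
      map_zero' := h0 q
      map_add' := fun x y => by simpa using hl q 1 x y
      map_mul' := fun x y => (appendOp_mul (hMul _ _ _ ⟨q, x, y⟩)).symm }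
  exact ⟨g, fun x => hg x.1 x.2⟩

end MFAlg

/-! ### Words and lists -/

section Words

variable {L L₁ L₂ : Type u} {n : ℕ}

lemma exists_ofFn_merge {R : L → L → L → Prop} {w : Fin (n + 1) → L} {w' : Fin n → L} {i : Fin n}
    (h : WordFun.IsMerge R w w' i) : ∃ u v x y z, R x y z ∧ List.ofFn w = u ++ x :: y :: v ∧
      List.ofFn w' = u ++ z :: v := by
  induction n with
  | zero => exact i.elim0
  | succ n ih =>
    induction i using Fin.cases with
    | zero =>
      refine ⟨[], List.ofFn fun j : Fin n => w' j.succ, w 0, w 1, w' 0, h.1, ?_, ?_⟩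
      · rw [List.ofFn_succ, List.ofFn_succ, List.nil_append]
        congr 3
        funext j
        have hj : (0 : Fin (n + 1)).predAbove j.succ.succ = j.succ := Fin.ext (by
          rw [Partition.predAbove_val]
          simp)
        rw [h.2 _ (by rw [hj]; exact Fin.succ_ne_zero j), hj]
      · rw [List.ofFn_succ, List.nil_append]
    | succ i =>
      have hp : ∀ x : Fin (n + 1), i.succ.predAbove x.succ = (i.predAbove x).succ := fun x =>
        Fin.ext (by
          have := i.isLt
          rw [Partition.predAbove_val, Fin.val_succ, Fin.val_succ, Fin.val_succ,
            Partition.predAbove_val]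
          split_ifs <;> omega)
      obtain ⟨u, v, x, y, z, h1, h2, h3⟩ := ih (w := fun j => w j.succ) (w' := fun j => w' j.succ)
        (i := i) ⟨h.1, fun x hx => by
          change w x.succ = w' (i.predAbove x).succ
          rw [← hp]
          exact h.2 _ (by rw [hp]; exact fun e => hx (Fin.succ_injective _ e))⟩
      refine ⟨w 0 :: u, v, x, y, z, h1, ?_, ?_⟩
      · rw [List.ofFn_succ, h2, List.cons_append]
      · have h0 : i.succ.predAbove 0 = 0 := Fin.ext (by rw [Partition.predAbove_val]; simp)
        rw [List.ofFn_succ, h3, List.cons_append,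
          h.2 0 (by rw [h0]; exact (Fin.succ_ne_zero i).symm), h0]

/-- Words that differ at most at `i` are lists that differ at most in one letter. -/
lemma exists_ofFn_split {w : Fin n → L} (i : Fin n) : ∃ u v, ∀ w' : Fin n → L,
    (∀ j, j ≠ i → w j = w' j) → List.ofFn w' = u ++ w' i :: v := by
  induction n with
  | zero => exact i.elim0
  | succ n ih =>
    induction i using Fin.cases with
    | zero =>
      refine ⟨[], List.ofFn fun j => w j.succ, fun w' h => ?_⟩
      rw [List.ofFn_succ, List.nil_append]
      congr 2
      funext j
      exact (h _ (Fin.succ_ne_zero j)).symm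
    | succ i =>
      obtain ⟨u, v, h⟩ := ih (w := fun j => w j.succ) i
      refine ⟨w 0 :: u, v, fun w' hw => ?_⟩
      rw [List.ofFn_succ, h (fun j => w' j.succ) fun j hj =>
        hw _ fun e => hj (Fin.succ_injective _ e), List.cons_append,
        hw 0 (Fin.succ_ne_zero i).symm]

lemma wordFun_get (E : WordFun L) (l : List L) (h : l.length = n) :
    E l.length l.get = E n (fun i => l[i]) := by
  subst h
  rfl

lemma wordFun_ofFn (E : WordFun L) (w : Fin n → L) :
    E (List.ofFn w).length (List.ofFn w).get = E n w := by
  rw [wordFun_get E _ (List.length_ofFn)]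
  congr 1
  funext i
  simp

/-- A functional on words is a consistent functional on lists. -/
lemma mem_consistent {Lin : ℂ → L → L → L → Prop} {Mul : L → L → L → Prop} {E : WordFun L}
    (h1 : WordFun.IsLinear Lin E) (h2 : WordFun.MergesMoments Mul E) :
    (fun l : List L => E l.length l.get) ∈ consistent Lin Mul := by
  refine ⟨fun c x y z h u v => ?_, fun x y z h u v => ?_⟩
  · have hl : ∀ a, (u ++ a :: v).length = u.length + v.length + 1 := fun a => by simp; omega
    simp only [wordFun_get E _ (hl _)]
    have hne : ∀ a b (j : Fin (u.length + v.length + 1)), j ≠ ⟨u.length, by omega⟩ →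
        (u ++ a :: v)[j]'(by rw [hl]; exact j.isLt) =
          (u ++ b :: v)[j]'(by rw [hl]; exact j.isLt) := by
      intro a b j hj
      have hj' : j.val ≠ u.length := fun e => hj (Fin.ext e)
      simp only [Fin.getElem_fin, List.getElem_append, List.getElem_cons]
      split_ifs with h3 h4
      · rfl
      · omega
      · rfl
    refine h1 _ ⟨u.length, by omega⟩ c _ _ _ (hne _ _) (hne _ _) ?_
    simpa using h
  · have hl : (u ++ z :: v).length = u.length + v.length + 1 := by simp; omega
    have hl' : (u ++ x :: y :: v).length = u.length + v.length + 1 + 1 := by simp; omega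
    simp only [wordFun_get E _ hl, wordFun_get E _ hl']
    refine h2 _ ⟨u.length, by omega⟩ _ _ ⟨?_, fun j hj => ?_⟩
    · simpa [List.getElem_append] using h
    · have hv := Partition.predAbove_val ⟨u.length, by omega⟩ j
      have hj' : (Fin.predAbove ⟨u.length, by omega⟩ j : Fin (u.length + v.length + 1)).val
        ≠ u.length := fun e => hj (Fin.ext e)
      simp only [Fin.getElem_fin, List.getElem_append, List.getElem_cons, hv]
      simp only [hv] at hj'
      split_ifs at * <;> first | rfl | omega | (congr 1; omega)

end Words

end

noncomputable section

/-! ### Direct sums -/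

section DirectSum

variable {F : Type} {L₁ L₂ L₃ : Type u} {n : ℕ}

lemma sum_word_cases (w : Fin n → L₁ ⊕ L₂) :
    (∃ u, w = Sum.inl ∘ u) ∨ (∃ u, w = Sum.inr ∘ u) ∨
      ∃ i j, (w i).isLeft = true ∧ (w j).isRight = true := by
  by_cases h1 : ∀ i, (w i).isLeft
  · exact Or.inl ⟨fun i => (w i).getLeft (h1 i), funext fun i => by simp⟩
  by_cases h2 : ∀ i, (w i).isRight
  · exact Or.inr (Or.inl ⟨fun i => (w i).getRight (h2 i), funext fun i => by simp⟩)
  · push Not at h1 h2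
    obtain ⟨i, hi⟩ := h1
    obtain ⟨j, hj⟩ := h2
    exact Or.inr (Or.inr ⟨j, i, by simpa using hj, by simpa using hi⟩)

/-- The relation on the disjoint union of two alphabets given by relations on the alphabets. -/
inductive SumRel (R₁ : L₁ → L₁ → L₁ → Prop) (R₂ : L₂ → L₂ → L₂ → Prop) :
    L₁ ⊕ L₂ → L₁ ⊕ L₂ → L₁ ⊕ L₂ → Prop
  | inl {x y z : L₁} : R₁ x y z → SumRel R₁ R₂ (Sum.inl x) (Sum.inl y) (Sum.inl z)
  | inr {x y z : L₂} : R₂ x y z → SumRel R₁ R₂ (Sum.inr x) (Sum.inr y) (Sum.inr z)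

namespace WordFun

open Partition

variable (ψ₁ : WordFun L₁) (ψ₂ : WordFun L₂)

lemma directSum_inl (u : Fin n → L₁) : directSum ψ₁ ψ₂ n (Sum.inl ∘ u) = ψ₁ n u := by
  simp [directSum]

lemma directSum_inr (hn : 0 < n) (u : Fin n → L₂) :
    directSum ψ₁ ψ₂ n (Sum.inr ∘ u) = ψ₂ n u := by
  have : ¬ ∀ i : Fin n, ((Sum.inr ∘ u : Fin n → L₁ ⊕ L₂) i).isLeft = true := fun h => by
    simpa using h ⟨0, hn⟩
  simp only [directSum, dif_neg this]
  simp

variable {ψ₁ ψ₂}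

lemma directSum_mixed {w : Fin n → L₁ ⊕ L₂} {i j : Fin n} (hi : (w i).isLeft = true)
    (hj : (w j).isRight = true) : directSum ψ₁ ψ₂ n w = 0 := by
  have h1 : ¬ ∀ i, (w i).isLeft = true := fun h => by
    have := h j
    cases h' : w j <;> simp_all
  have h2 : ¬ ∀ i, (w i).isRight = true := fun h => by
    have := h i
    cases h' : w i <;> simp_all
  simp only [directSum, dif_neg h1, dif_neg h2]

lemma directSum_congr {ψ₁' : WordFun L₁} {ψ₂' : WordFun L₂}
    (h₁ : ∀ n, 0 < n → ∀ w, ψ₁ n w = ψ₁' n w) (h₂ : ∀ n, 0 < n → ∀ w, ψ₂ n w = ψ₂' n w)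
    (n : ℕ) (hn : 0 < n) (w : Fin n → L₁ ⊕ L₂) :
    directSum ψ₁ ψ₂ n w = directSum ψ₁' ψ₂' n w := by
  rcases sum_word_cases w with ⟨u, rfl⟩ | ⟨u, rfl⟩ | ⟨i, j, hi, hj⟩
  · rw [directSum_inl, directSum_inl, h₁ n hn]
  · rw [directSum_inr _ _ hn, directSum_inr _ _ hn, h₂ n hn]
  · rw [directSum_mixed hi hj, directSum_mixed hi hj]

lemma directSum_map {L₁' L₂' : Type u} (g₁ : L₁' → L₁) (g₂ : L₂' → L₂) (hn : 0 < n)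
    (w : Fin n → L₁' ⊕ L₂') : directSum ψ₁ ψ₂ n (Sum.map g₁ g₂ ∘ w) =
      directSum (fun n w => ψ₁ n (g₁ ∘ w)) (fun n w => ψ₂ n (g₂ ∘ w)) n w := by
  rcases sum_word_cases w with ⟨u, rfl⟩ | ⟨u, rfl⟩ | ⟨i, j, hi, hj⟩
  · rw [directSum_inl]
    exact directSum_inl ψ₁ ψ₂ (g₁ ∘ u)
  · rw [directSum_inr _ _ hn]
    exact directSum_inr ψ₁ ψ₂ hn (g₂ ∘ u)
  · rw [directSum_mixed hi hj]
    exact directSum_mixed (i := i) (j := j) (by simpa using hi) (by simpa using hj)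

lemma directSum_swap (hn : 0 < n) (w : Fin n → L₁ ⊕ L₂) :
    directSum ψ₂ ψ₁ n (Sum.swap ∘ w) = directSum ψ₁ ψ₂ n w := by
  rcases sum_word_cases w with ⟨u, rfl⟩ | ⟨u, rfl⟩ | ⟨i, j, hi, hj⟩
  · rw [directSum_inl]
    exact directSum_inr ψ₂ ψ₁ hn u
  · rw [directSum_inr _ _ hn]
    exact directSum_inl ψ₂ ψ₁ u
  · rw [directSum_mixed hi hj]
    exact directSum_mixed (i := j) (j := i) (by simpa using hj) (by simpa using hi)

lemma directSum_assoc {ψ₃ : WordFun L₃} (hn : 0 < n) (w : Fin n → (L₁ ⊕ L₂) ⊕ L₃) :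
    directSum ψ₁ (directSum ψ₂ ψ₃) n (Equiv.sumAssoc L₁ L₂ L₃ ∘ w) =
      directSum (directSum ψ₁ ψ₂) ψ₃ n w := by
  rcases sum_word_cases w with ⟨u, rfl⟩ | ⟨u, rfl⟩ | ⟨i, j, hi, hj⟩
  · rw [directSum_inl]
    rcases sum_word_cases u with ⟨v, rfl⟩ | ⟨v, rfl⟩ | ⟨i, j, hi, hj⟩
    · rw [directSum_inl]
      exact directSum_inl _ _ v
    · rw [directSum_inr _ _ hn, ← directSum_inl ψ₂ ψ₃]
      exact directSum_inr _ _ hn (Sum.inl ∘ v)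
    · rw [directSum_mixed hi hj]
      refine directSum_mixed (i := i) (j := j) ?_ ?_
      · cases h : u i <;> simp_all
      · cases h : u j <;> simp_all
  · rw [directSum_inr _ _ hn, ← directSum_inr ψ₂ ψ₃ hn]
    exact directSum_inr _ _ hn (Sum.inr ∘ u)
  · rw [directSum_mixed hi hj]
    obtain ⟨c, hc⟩ := Sum.isRight_iff.1 hj
    obtain ⟨a, ha⟩ := Sum.isLeft_iff.1 hi
    rcases sum_word_cases (Equiv.sumAssoc L₁ L₂ L₃ ∘ w) with ⟨v, hv⟩ | ⟨v, hv⟩ | ⟨k, l, hk, hl⟩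
    · have := congrFun hv j
      simp [hc] at this
    · rw [hv, directSum_inr _ _ hn]
      have h1 := congrFun hv j
      have h2 := congrFun hv i
      refine directSum_mixed (i := i) (j := j) ?_ ?_
      · cases a <;> simp [ha] at h2
        rw [← h2]
        rfl
      · simp [hc] at h1
        rw [← h1]
        rfl
    · exact directSum_mixed hk hl

lemma IsLinear.directSum {R₁ : ℂ → L₁ → L₁ → L₁ → Prop} {R₂ : ℂ → L₂ → L₂ → L₂ → Prop}
    (h₁ : IsLinear R₁ ψ₁) (h₂ : IsLinear R₂ ψ₂) :
    IsLinear (fun c => SumRel (R₁ c) (R₂ c)) (directSum ψ₁ ψ₂) := by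
  intro n i c w w' w'' h' h'' hR
  have hs : ∀ k, (w' k).isLeft = (w k).isLeft ∧ (w' k).isRight = (w k).isRight ∧
      (w'' k).isLeft = (w k).isLeft ∧ (w'' k).isRight = (w k).isRight := by
    intro k
    by_cases hk : k = i
    · subst hk
      generalize w k = x, w' k = y, w'' k = z at hR
      cases hR <;> simp
    · simp [← h' k hk, ← h'' k hk]
  rcases sum_word_cases w with ⟨u, rfl⟩ | ⟨u, rfl⟩ | ⟨k, l, hk, hl⟩
  · rcases sum_word_cases w' with ⟨u', rfl⟩ | ⟨u', rfl⟩ | ⟨k, l, hk, hl⟩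
    · rcases sum_word_cases w'' with ⟨u'', rfl⟩ | ⟨u'', rfl⟩ | ⟨k, l, hk, hl⟩
      · rw [directSum_inl, directSum_inl, directSum_inl]
        refine h₁ n i c _ _ _ (fun j hj => Sum.inl_injective (h' j hj))
          (fun j hj => Sum.inl_injective (h'' j hj)) ?_
        cases hR
        assumption
      · simpa using (hs i).2.2.1
      · rw [(hs l).2.2.2] at hl
        simp at hl
    · simpa using (hs i).1
    · rw [(hs l).2.1] at hl
      simp at hl
  · rcases sum_word_cases w' with ⟨u', rfl⟩ | ⟨u', rfl⟩ | ⟨k, l, hk, hl⟩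
    · simpa using (hs i).1
    · rcases sum_word_cases w'' with ⟨u'', rfl⟩ | ⟨u'', rfl⟩ | ⟨k, l, hk, hl⟩
      · simpa using (hs i).2.2.1
      · rw [directSum_inr _ _ i.pos, directSum_inr _ _ i.pos, directSum_inr _ _ i.pos]
        refine h₂ n i c _ _ _ (fun j hj => Sum.inr_injective (h' j hj))
          (fun j hj => Sum.inr_injective (h'' j hj)) ?_
        cases hR
        assumption
      · rw [(hs k).2.2.1] at hk
        simp at hk
    · rw [(hs k).1] at hk
      simp at hk
  · rw [directSum_mixed hk hl, directSum_mixed (w := w') ((hs k).1 ▸ hk) ((hs l).2.1 ▸ hl),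
      directSum_mixed (w := w'') ((hs k).2.2.1 ▸ hk) ((hs l).2.2.2 ▸ hl)]
    ring

/-- `mergedEv` is natural with respect to colour preserving maps of letters. -/
lemma mergedEv_letters {L L' : Type u} {α : Weights F} {col : L → F} {col' : L' → F} {g : L → L'}
    (hg : ∀ x, col' (g x) = col x) {ψ : WordFun L} {ψ' : WordFun L'}
    (hψ : ∀ n, 0 < n → ∀ w, ψ' n (g ∘ w) = ψ n w) (w : Fin n → L) {i j : Fin n}
    {B : Finset (Fin n)} (hi : i ∈ B) (hj : j ∈ B) :
    mergedEv α col' ψ' (g ∘ w) i j B = mergedEv α col ψ w i j B := by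
  have hc : col' ∘ g ∘ w = col ∘ w := funext fun x => hg _
  have hev : ∀ (C : Finset (Fin n)) (x), x ∈ C → ev ψ' (g ∘ w) C = ev ψ w C := fun C x hx =>
    hψ _ (Finset.card_pos.2 ⟨x, hx⟩) _
  have hc' : ∀ C : Finset (Fin n), col' ∘ (g ∘ w) ∘ enum C = col ∘ w ∘ enum C := fun C => by
    change (col' ∘ g ∘ w) ∘ enum C = _
    rw [hc]
    rfl
  unfold mergedEv
  rw [hev B i hi]
  congr 1
  refine Finset.sum_congr rfl fun C hC => ?_
  rw [Finset.mem_filter] at hC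
  rw [hev C i hC.2.1, hev (B \ C) j (Finset.mem_sdiff.2 ⟨hj, hC.2.2⟩), hc']

/-- The formula for cumulants with products as entries passes to direct sums: in a word with letters
from both alphabets, the two letters which are multiplied come from the same alphabet, hence each
of the two blocks separating them contains a letter from this alphabet, and one of the blocks
contains a letter from the other one. -/
lemma MergesCumulants.directSum {α : Weights F} {col₁ : L₁ → F} {col₂ : L₂ → F}
    {R₁ : L₁ → L₁ → L₁ → Prop} {R₂ : L₂ → L₂ → L₂ → Prop}
    (h₁ : MergesCumulants α col₁ R₁ ψ₁) (h₂ : MergesCumulants α col₂ R₂ ψ₂) :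
    MergesCumulants α (Sum.elim col₁ col₂) (SumRel R₁ R₂) (directSum ψ₁ ψ₂) := by
  intro n i w w' h
  have hs : ∀ x, (w x).isLeft = (w' (i.predAbove x)).isLeft ∧
      (w x).isRight = (w' (i.predAbove x)).isRight := by
    intro x
    by_cases hx : i.predAbove x = i
    · have hR := h.1
      rcases eq_or_of_predAbove_eq (hx.trans (predAbove_castSucc i).symm) with
        rfl | ⟨rfl, -⟩ | ⟨rfl, -⟩ <;> rw [hx] <;>
      · generalize w i.castSucc = x, w i.succ = y, w' i = z at hR
        cases hR <;> simp
    · rw [h.2 x hx]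
      exact ⟨rfl, rfl⟩
  rcases sum_word_cases w' with ⟨u', rfl⟩ | ⟨u', rfl⟩ | ⟨k, l, hk, hl⟩
  · rcases sum_word_cases w with ⟨u, rfl⟩ | ⟨u, rfl⟩ | ⟨k, l, hk, hl⟩
    · rw [directSum_inl, mergedEv_letters (g := Sum.inl) (col := col₁) (ψ := ψ₁) (fun _ => rfl)
        (fun n _ u => directSum_inl ψ₁ ψ₂ u) _ (Finset.mem_univ _) (Finset.mem_univ _)]
      refine h₁ n i u u' ⟨?_, fun x hx => Sum.inl_injective (h.2 x hx)⟩
      cases h.1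
      assumption
    · simpa using (hs i.castSucc).1
    · rw [(hs l).2] at hl
      simp at hl
  · rcases sum_word_cases w with ⟨u, rfl⟩ | ⟨u, rfl⟩ | ⟨k, l, hk, hl⟩
    · simpa using (hs i.castSucc).1
    · rw [directSum_inr _ _ i.pos, mergedEv_letters (g := Sum.inr) (col := col₂) (ψ := ψ₂)
        (fun _ => rfl) (fun n hn u => directSum_inr ψ₁ ψ₂ hn u) _ (Finset.mem_univ _) (Finset.mem_univ _)]
      refine h₂ n i u u' ⟨?_, fun x hx => Sum.inr_injective (h.2 x hx)⟩
      cases h.1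
      assumption
    · rw [(hs k).1] at hk
      simp at hk
  · obtain ⟨k, rfl⟩ := predAbove_surjective i k
    obtain ⟨l, rfl⟩ := predAbove_surjective i l
    have hev : ∀ (B : Finset (Fin (n + 1))) (a b), a ∈ B → b ∈ B → (w a).isLeft = true →
        (w b).isRight = true → ev (WordFun.directSum ψ₁ ψ₂) w B = 0 := by
      intro B a b ha hb ha' hb'
      obtain ⟨a, rfl⟩ := (mem_iff_enum a).1 ha
      obtain ⟨b, rfl⟩ := (mem_iff_enum b).1 hb
      exact directSum_mixed (i := a) (j := b) ha' hb'
    rw [directSum_mixed hk hl, mergedEv]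
    rw [← (hs k).1] at hk
    rw [← (hs l).2] at hl
    rw [hev _ k l (Finset.mem_univ _) (Finset.mem_univ _) hk hl, zero_add]
    refine Finset.sum_eq_zero fun B hB => mul_eq_zero_of_right _ ?_
    rw [Finset.mem_filter] at hB
    have hjB : i.succ ∈ Finset.univ \ B := by simpa using hB.2.2
    have h1 := hs i.castSucc
    have h2 := hs i.succ
    rw [predAbove_castSucc] at h1
    rw [predAbove_succ] at h2
    rw [mul_eq_zero]
    cases hw' : (w' i).isLeft
    · have hr : (w' i).isRight = true := by simpa using hw'
      rw [hr] at h1 h2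
      by_cases hkB : k ∈ B
      · exact Or.inl (hev B _ _ hkB hB.2.1 hk h1.2)
      · exact Or.inr (hev _ _ _ (by simpa using hkB) hjB hk h2.2)
    · rw [hw'] at h1 h2
      by_cases hlB : l ∈ B
      · exact Or.inl (hev B _ _ hB.2.1 hlB h1.1 hl)
      · exact Or.inr (hev _ _ _ hjB (by simpa using hlB) h2.1 hl)

end WordFun

end DirectSum

end

noncomputable section

namespace MFAlg

variable {F : Type} {A B A₁ A₂ A₃ B₁ B₂ : MFAlg.{u} F} {n : ℕ}

/-! ### Letters -/

/-- The map of letters given by a homomorphism. -/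
def Letter.map (h : Hom A B) (x : A.Letter) : B.Letter := ⟨x.1, h (x.2 : A), h.map_face _ _ x.2.2⟩

lemma Functional.hat_comp (φ : B.Functional) (h : Hom A B) (w : Fin n → A.Letter) :
    (φ.comp h).hat n w = φ.hat n (Letter.map h ∘ w) := by
  unfold Functional.hat
  rw [Functional.comp_apply, Hom.map_ordProd, List.map_ofFn]
  rfl

variable {α : Weights F} (hα : α.Admissible)

/-- The letters of the free product coming from the letters of the factors. -/
def coprodLetter (A₁ A₂ : MFAlg.{u} F) : A₁.Letter ⊕ A₂.Letter → (A₁.coprod A₂).Letter :=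
  Sum.elim (Letter.map (inl A₁ A₂)) (Letter.map (inr A₁ A₂))

lemma coprodLetter_fst (x : A₁.Letter ⊕ A₂.Letter) :
    (coprodLetter A₁ A₂ x).1 = Sum.elim Sigma.fst Sigma.fst x := by
  cases x <;> rfl

lemma coprodLetter_snd (x : A₁.Letter ⊕ A₂.Letter) :
    ((coprodLetter A₁ A₂ x).2 : A₁.coprod A₂) = letterToCoprod A₁ A₂ x := by
  cases x <;> rfl

lemma mem_adjoin_letters (a : A) :
    a ∈ NonUnitalAlgebra.adjoin ℂ (Set.range fun x : A.Letter => (x.2 : A)) :=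
  mem_adjoin_of_face A (fun q x hx => NonUnitalAlgebra.subset_adjoin ℂ
    (Set.mem_range_self (⟨q, x, hx⟩ : A.Letter))) a

lemma mem_adjoin_letterToCoprod (a : A₁.coprod A₂) :
    a ∈ NonUnitalAlgebra.adjoin ℂ (Set.range (letterToCoprod A₁ A₂)) :=
  mem_adjoin_coprod (fun q x hx => NonUnitalAlgebra.subset_adjoin ℂ
      (Set.mem_range_self (Sum.inl ⟨q, x, hx⟩ : A₁.Letter ⊕ A₂.Letter)))
    (fun q x hx => NonUnitalAlgebra.subset_adjoin ℂ
      (Set.mem_range_self (Sum.inr ⟨q, x, hx⟩ : A₁.Letter ⊕ A₂.Letter))) a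

lemma functional_ext_range {L : Type u} {f : L → A}
    (hf : ∀ a, a ∈ NonUnitalAlgebra.adjoin ℂ (Set.range f)) {φ ψ : A.Functional}
    (h : ∀ n, 0 < n → ∀ w : Fin n → L, φ (ordProd (List.ofFn (fun i => f (w i)))) =
      ψ (ordProd (List.ofFn (fun i => f (w i))))) : φ = ψ := by
  refine functional_ext hf fun l hl hS => ?_
  choose g hg using fun i : Fin l.length => hS l[i] (List.getElem_mem _)
  have := h l.length (List.length_pos_iff.2 hl) g
  simp only [hg] at this
  have e : List.ofFn (fun i : Fin l.length => l[i]) = l := List.ofFn_getElem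
  rwa [e] at this

lemma hom_letterToCoprod (h : Hom (A₁.coprod A₂) B) (w : Fin n → A₁.Letter ⊕ A₂.Letter) :
    h (ordProd (List.ofFn fun i => letterToCoprod A₁ A₂ (w i))) =
      ordProd (List.ofFn fun i => h (letterToCoprod A₁ A₂ (w i))) := by
  rw [Hom.map_ordProd, List.map_ofFn]
  rfl

/-! ### Moments and cumulants of a functional -/

lemma Functional.hat_isLinear (φ : A.Functional) : WordFun.IsLinear A.LetterLin φ.hat := by
  intro n i c w w' w'' h' h'' hR
  obtain ⟨u, v, hs⟩ := exists_ofFn_split (w := fun j => ((w j).2 : A)) i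
  have e := hs _ fun _ _ => rfl
  have e' := hs (fun j => ((w' j).2 : A)) fun j hj => by rw [h' j hj]
  have e'' := hs (fun j => ((w'' j).2 : A)) fun j hj => by rw [h'' j hj]
  have hx : ((w i).2 : A) = c • ((w' i).2 : A) + ((w'' i).2 : A) := by
    generalize w i = x, w' i = y, w'' i = z at hR
    cases hR
    rfl
  unfold Functional.hat
  rw [e, e', e'', hx]
  have : (ordProd (u ++ (c • ((w' i).2 : A) + ((w'' i).2 : A)) :: v)) =
      c • ordProd (u ++ ((w' i).2 : A) :: v) + ordProd (u ++ ((w'' i).2 : A) :: v) := by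
    apply Unitization.inr_injective (R := ℂ)
    rw [Unitization.inr_add, Unitization.inr_smul, inr_ordProd (by simp), inr_ordProd (by simp),
      inr_ordProd (by simp)]
    simp [mul_add, add_mul]
  rw [this, map_add, map_smul]
  rfl

lemma Functional.hat_mergesMoments (φ : A.Functional) :
    WordFun.MergesMoments A.LetterMul φ.hat := by
  intro n i w w' h
  obtain ⟨u, v, x, y, z, hR, e, e'⟩ := exists_ofFn_merge h
  have hl : ∀ {m} (w : Fin m → A.Letter), List.ofFn (fun i => ((w i).2 : A)) =
      (List.ofFn w).map (fun x => (x.2 : A)) := fun w => by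
    rw [List.map_ofFn]
    rfl
  have hx : (x.2 : A) * (y.2 : A) = (z.2 : A) := by
    cases hR
    rfl
  unfold Functional.hat
  rw [hl, hl, e, e']
  congr 1
  apply Unitization.inr_injective (R := ℂ)
  rw [inr_ordProd (by simp), inr_ordProd (by simp)]
  simp [← hx, mul_assoc]

lemma LetterLin.fst {c : ℂ} {x y z : A.Letter} (h : A.LetterLin c x y z) :
    x.1 = y.1 ∧ x.1 = z.1 := by
  cases h
  exact ⟨rfl, rfl⟩

lemma LetterMul.fst {x y z : A.Letter} (h : A.LetterMul x y z) : x.1 = z.1 ∧ y.1 = z.1 := by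
  cases h
  exact ⟨rfl, rfl⟩

include hα in
lemma exp_logHat (φ : A.Functional) (hn : 0 < n) (w : Fin n → A.Letter) :
    WordFun.exp α Sigma.fst (φ.logHat α) n w = φ.hat n w :=
  WordFun.exp_log _ hα.one_block _ hn w

include hα in
lemma logHat_comp (φ : B.Functional) (h : Hom A B) (hn : 0 < n) (w : Fin n → A.Letter) :
    (φ.comp h).logHat α n w = φ.logHat α n (Letter.map h ∘ w) := by
  unfold Functional.logHat
  rw [← WordFun.log_comp Sigma.fst hα.one_block Sigma.fst (Letter.map h) (fun _ => rfl) _ hn]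
  exact WordFun.log_congr _ hα.one_block (fun n _ w => φ.hat_comp h w) n hn w

/-! ### The product defined by cumulants -/

lemma exists_coprod_lift {C : Type u} [NonUnitalRing C] [Module ℂ C] [IsScalarTower ℂ C C]
    [SMulCommClass ℂ C C] (g₁ : A₁ →ₙₐ[ℂ] C) (g₂ : A₂ →ₙₐ[ℂ] C) :
    ∃ g : A₁.coprod A₂ →ₙₐ[ℂ] C, (∀ x, g (inl A₁ A₂ x) = g₁ x) ∧ ∀ x, g (inr A₁ A₂ x) = g₂ x :=
  ⟨FreeProd.lift g₁ g₂, FreeProd.lift_inl g₁ g₂, FreeProd.lift_inr g₁ g₂⟩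

/-- A consistent functional on lists of letters descends to every algebra which acts on consistent
functionals in such a way that letters act by appending: apply the product of the letters to the
given functional and evaluate at the empty list. -/
lemma exists_functional_of_consistent {L : Type u} {Lin : ℂ → L → L → L → Prop}
    {Mul : L → L → L → Prop} (f : L → A) (ρ : A →ₙₐ[ℂ] Module.End ℂ (consistent Lin Mul))
    (hρ : ∀ x, ρ (f x) = appendOp Lin Mul x) {Φ : List L → ℂ} (hΦ : Φ ∈ consistent Lin Mul) :
    ∃ φ : A.Functional, ∀ n, 0 < n → ∀ w : Fin n → L,
      φ (ordProd (List.ofFn fun i => f (w i))) = Φ (List.ofFn w) := by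
  refine ⟨(LinearMap.proj [] : (List L → ℂ) →ₗ[ℂ] ℂ) ∘ₗ (consistent Lin Mul).subtype ∘ₗ
    (LinearMap.applyₗ ⟨Φ, hΦ⟩) ∘ₗ (ρ : A →ₗ[ℂ] Module.End ℂ (consistent Lin Mul)),
    fun n hn w => ?_⟩
  change (ρ (ordProd _) ⟨Φ, hΦ⟩).1 [] = _
  have hl : (List.ofFn fun i => f (w i)).map ρ = (List.ofFn w).map (appendOp Lin Mul) := by
    rw [List.map_ofFn, List.map_ofFn]
    congr 1
    funext i
    exact hρ (w i)
  have hm : ρ (ordProd (List.ofFn fun i => f (w i))) =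
      ordProd ((List.ofFn fun i => f (w i)).map ρ) :=
    map_ordProd (B := Module.End ℂ (consistent Lin Mul)) ρ _
  rw [hm, hl, ordProd_appendOp (fun e => by
    have := congrArg List.length e
    simp at this
    omega)]
  rfl

include hα in
/-- The functional on words `exp_α(log_α φ̂₁ ⊕ log_α φ̂₂)` descends to the free product. -/
lemma exists_cumulantProduct (φ₁ : A₁.Functional) (φ₂ : A₂.Functional) :
    ∃ φ : (A₁.coprod A₂).Functional, ∀ n, 0 < n → ∀ w : Fin n → A₁.Letter ⊕ A₂.Letter,
      φ (ordProd (List.ofFn fun i => letterToCoprod A₁ A₂ (w i))) =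
        cumulantProduct α φ₁ φ₂ n w := by
  let Lin : ℂ → A₁.Letter ⊕ A₂.Letter → A₁.Letter ⊕ A₂.Letter → A₁.Letter ⊕ A₂.Letter → Prop :=
    fun c => SumRel (A₁.LetterLin c) (A₂.LetterLin c)
  let Mul : A₁.Letter ⊕ A₂.Letter → A₁.Letter ⊕ A₂.Letter → A₁.Letter ⊕ A₂.Letter → Prop :=
    SumRel A₁.LetterMul A₂.LetterMul
  have h1 : WordFun.IsLinear Lin (cumulantProduct α φ₁ φ₂) := by
    refine WordFun.IsLinear.exp _ (WordFun.IsLinear.directSum ?_ ?_) ?_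
    · exact φ₁.hat_isLinear.log _ fun c x y z => LetterLin.fst
    · exact φ₂.hat_isLinear.log _ fun c x y z => LetterLin.fst
    · intro c x y z h
      rcases h with h | h
      · exact h.fst
      · exact h.fst
  have h2 : WordFun.MergesMoments Mul (cumulantProduct α φ₁ φ₂) := by
    refine WordFun.MergesCumulants.exp _ ?_ hα (WordFun.MergesCumulants.directSum ?_ ?_)
    · intro x y z h
      rcases h with h | h
      · exact h.fst
      · exact h.fst
    · exact φ₁.hat_mergesMoments.log _ (fun _ _ _ => LetterMul.fst) hα
    · exact φ₂.hat_mergesMoments.log _ (fun _ _ _ => LetterMul.fst) hα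
  obtain ⟨g₁, hg₁⟩ := exists_hom_appendOp A₁ Sum.inl Lin Mul (fun _ _ _ _ h => .inl h)
    (fun _ _ _ h => .inl h)
  obtain ⟨g₂, hg₂⟩ := exists_hom_appendOp A₂ Sum.inr Lin Mul (fun _ _ _ _ h => .inr h)
    (fun _ _ _ h => .inr h)
  obtain ⟨ρ, hρ₁, hρ₂⟩ :=
    exists_coprod_lift (C := Module.End ℂ (consistent Lin Mul)) g₁ g₂
  obtain ⟨φ, hφ⟩ := exists_functional_of_consistent (letterToCoprod A₁ A₂) ρ
    (by
      rintro (x | x)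
      · exact (hρ₁ _).trans (hg₁ x)
      · exact (hρ₂ _).trans (hg₂ x)) (mem_consistent h1 h2)
  exact ⟨φ, fun n hn w => (hφ n hn w).trans (wordFun_ofFn _ w)⟩

/-- The product `φ₁ ⊙ φ₂` with `(φ₁ ⊙ φ₂)^ = exp_α(log_α φ̂₁ ⊕ log_α φ̂₂)` on letters of the
factors. -/
def cumulantOp (φ₁ : A₁.Functional) (φ₂ : A₂.Functional) : (A₁.coprod A₂).Functional :=
  (exists_cumulantProduct hα φ₁ φ₂).choose

lemma cumulantOp_apply (φ₁ : A₁.Functional) (φ₂ : A₂.Functional) (hn : 0 < n)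
    (w : Fin n → A₁.Letter ⊕ A₂.Letter) :
    cumulantOp hα φ₁ φ₂ (ordProd (List.ofFn fun i => letterToCoprod A₁ A₂ (w i))) =
      cumulantProduct α φ₁ φ₂ n w :=
  (exists_cumulantProduct hα φ₁ φ₂).choose_spec n hn w

/-- The cumulants of the product are the direct sum of the cumulants of the factors. -/
lemma logHat_cumulantOp (φ₁ : A₁.Functional) (φ₂ : A₂.Functional) (hn : 0 < n)
    (w : Fin n → A₁.Letter ⊕ A₂.Letter) :
    (cumulantOp hα φ₁ φ₂).logHat α n (coprodLetter A₁ A₂ ∘ w) =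
      WordFun.directSum (φ₁.logHat α) (φ₂.logHat α) n w := by
  unfold Functional.logHat
  rw [← WordFun.log_comp (Sum.elim Sigma.fst Sigma.fst) hα.one_block Sigma.fst
    (coprodLetter A₁ A₂) coprodLetter_fst _ hn]
  refine WordFun.log_unique _ hα.one_block _ _ (fun n hn w => ?_) n hn w
  refine (cumulantOp_apply hα φ₁ φ₂ hn w).symm.trans ?_
  unfold Functional.hat
  simp only [Function.comp, coprodLetter_snd]

lemma cumulantOp_comp_inl (φ₁ : A₁.Functional) (φ₂ : A₂.Functional) :
    (cumulantOp hα φ₁ φ₂).comp (inl A₁ A₂) = φ₁ := by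
  refine functional_ext_range mem_adjoin_letters fun n hn w => ?_
  rw [Functional.comp_apply, Hom.map_ordProd, List.map_ofFn]
  refine (cumulantOp_apply hα φ₁ φ₂ hn (Sum.inl ∘ w)).trans ?_
  rw [cumulantProduct, ← WordFun.exp_comp Sigma.fst _ Sum.inl (fun _ => rfl)]
  simp only [WordFun.directSum_inl]
  exact exp_logHat hα φ₁ hn w

lemma cumulantOp_symm (φ₁ : A₁.Functional) (φ₂ : A₂.Functional) :
    cumulantOp hα φ₁ φ₂ = (cumulantOp hα φ₂ φ₁).comp (swap A₁ A₂) := by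
  refine functional_ext_range mem_adjoin_letterToCoprod fun n hn w => ?_
  rw [Functional.comp_apply, hom_letterToCoprod, cumulantOp_apply hα _ _ hn]
  have hs : ∀ x, swap A₁ A₂ (letterToCoprod A₁ A₂ x) = letterToCoprod A₂ A₁ x.swap := by
    rintro (x | x)
    · exact lift_inl _ _ _
    · exact lift_inr _ _ _
  simp only [hs]
  refine Eq.trans ?_ (cumulantOp_apply hα φ₂ φ₁ hn (Sum.swap ∘ w)).symm
  rw [cumulantProduct, cumulantProduct, ← WordFun.exp_comp (Sum.elim Sigma.fst Sigma.fst) _ Sum.swap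
    (by rintro (x | x) <;> rfl)]
  exact WordFun.exp_congr _ (fun n hn w => (WordFun.directSum_swap hn w).symm) w

/-- The universal product defined by cumulants. -/
def cumulantUniversalProduct : UniversalProduct.{u} F where
  op := cumulantOp hα
  universality {A₁ A₂ B₁ B₂} φ₁ φ₂ h₁ h₂ := by
    refine functional_ext_range mem_adjoin_letterToCoprod fun n hn w => ?_
    rw [Functional.comp_apply, hom_letterToCoprod, cumulantOp_apply hα _ _ hn]
    have hs : ∀ x, map h₁ h₂ (letterToCoprod B₁ B₂ x) =
        letterToCoprod A₁ A₂ (Sum.map (Letter.map h₁) (Letter.map h₂) x) := by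
      rintro (x | x)
      · exact lift_inl _ _ _
      · exact lift_inr _ _ _
    simp only [hs]
    refine Eq.trans ?_ (cumulantOp_apply hα φ₁ φ₂ hn (Sum.map _ _ ∘ w)).symm
    rw [cumulantProduct, cumulantProduct, ← WordFun.exp_comp (Sum.elim Sigma.fst Sigma.fst) _
      (Sum.map (Letter.map h₁) (Letter.map h₂)) (by rintro (x | x) <;> rfl)]
    refine WordFun.exp_congr _ (fun n hn w => ?_) w
    rw [WordFun.directSum_map _ _ hn]
    exact WordFun.directSum_congr (fun n hn w => logHat_comp hα _ _ hn w)
      (fun n hn w => logHat_comp hα _ _ hn w) n hn w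
  associativity {A₁ A₂ A₃} φ₁ φ₂ φ₃ := by
    let f := letterToCoprod (A₁.coprod A₂) A₃ ∘ Sum.map (coprodLetter A₁ A₂) id
    have hf : ∀ a, a ∈ NonUnitalAlgebra.adjoin ℂ (Set.range f) := by
      intro a
      refine mem_adjoin_coprod (fun q x _ => ?_) (fun q x hx => ?_) a
      · refine hom_mem_adjoin (inl (A₁.coprod A₂) A₃) mem_adjoin_letterToCoprod ?_ x
        rintro _ ⟨y, rfl⟩
        rw [← coprodLetter_snd]
        exact NonUnitalAlgebra.subset_adjoin ℂ ⟨Sum.inl y, rfl⟩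
      · exact NonUnitalAlgebra.subset_adjoin ℂ ⟨Sum.inr ⟨q, x, hx⟩, rfl⟩
    refine functional_ext_range hf fun n hn w => ?_
    refine (cumulantOp_apply hα _ φ₃ hn (Sum.map (coprodLetter A₁ A₂) id ∘ w)).trans ?_
    rw [Functional.comp_apply]
    have hs : ∀ x, assoc A₁ A₂ A₃ (f x) = letterToCoprod A₁ (A₂.coprod A₃)
        (Sum.map id (coprodLetter A₂ A₃) (Equiv.sumAssoc _ _ _ x)) := by
      rintro ((x | x) | x)
      · exact (lift_inl _ _ _).trans (lift_inl _ _ _)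
      · exact (lift_inl _ _ _).trans (lift_inr _ _ _)
      · exact lift_inr _ _ _
    rw [Hom.map_ordProd, List.map_ofFn]
    have hs' : (assoc A₁ A₂ A₃ ∘ fun i => f (w i)) = fun i => letterToCoprod A₁ (A₂.coprod A₃)
        ((Sum.map id (coprodLetter A₂ A₃) ∘ Equiv.sumAssoc _ _ _ ∘ w) i) :=
      funext fun i => hs (w i)
    rw [hs', cumulantOp_apply hα _ _ hn]
    let col : (A₁.Letter ⊕ A₂.Letter) ⊕ A₃.Letter → F :=
      Sum.elim (Sum.elim Sigma.fst Sigma.fst) Sigma.fst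
    have e1 := WordFun.exp_comp (α := α) col (Sum.elim Sigma.fst Sigma.fst)
      (Sum.map (coprodLetter A₁ A₂) id) (by rintro ((x | x) | x) <;> rfl)
      (WordFun.directSum ((cumulantOp hα φ₁ φ₂).logHat α) (φ₃.logHat α)) w
    have e2 := WordFun.exp_comp (α := α) col (Sum.elim Sigma.fst Sigma.fst)
      (Sum.map id (coprodLetter A₂ A₃) ∘ Equiv.sumAssoc _ _ _) (by rintro ((x | x) | x) <;> rfl)
      (WordFun.directSum (φ₁.logHat α) ((cumulantOp hα φ₂ φ₃).logHat α)) w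
    refine (e1.symm.trans ?_).trans e2
    refine WordFun.exp_congr _ (fun n hn w => ?_) w
    rw [WordFun.directSum_map _ _ hn, Function.comp_assoc, WordFun.directSum_map _ _ hn]
    refine (WordFun.directSum_congr (fun n hn w => logHat_cumulantOp hα φ₁ φ₂ hn w)
      (ψ₂' := φ₃.logHat α) (fun n hn w => rfl) n hn _).trans ?_
    refine Eq.trans ?_ (WordFun.directSum_congr (ψ₁' := φ₁.logHat α) (fun n hn w => rfl)
      (fun n hn w => logHat_cumulantOp hα φ₂ φ₃ hn w) n hn _).symm
    exact (WordFun.directSum_assoc hn w).symm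
  restrict_left φ₁ φ₂ := cumulantOp_comp_inl hα φ₁ φ₂
  restrict_right {A₁ A₂} φ₁ φ₂ := by
    rw [cumulantOp_symm]
    have e : ((cumulantOp hα φ₂ φ₁).comp (swap A₁ A₂)).comp (inr A₁ A₂) =
        (cumulantOp hα φ₂ φ₁).comp (inl A₂ A₁) := by
      ext x
      rw [Functional.comp_apply, Functional.comp_apply, Functional.comp_apply]
      exact congrArg _ (lift_inr _ _ _)
    rw [e, cumulantOp_comp_inl]

lemma cumulantUniversalProduct_isSymmetric : (cumulantUniversalProduct.{u} hα).IsSymmetric :=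
  fun φ₁ φ₂ => cumulantOp_symm hα φ₁ φ₂

end MFAlg

end

noncomputable section

/-! ### Derivatives of cumulants -/

/-- A product of at least two functions vanishing at `0` has derivative `0`. -/
lemma hasDerivAt_prod_zero {ι : Type*} {s : Finset ι} {g : ι → ℂ → ℂ} {d : ι → ℂ}
    (hg : ∀ i ∈ s, HasDerivAt (g i) (d i) 0) {i j : ι} (hi : i ∈ s) (hj : j ∈ s) (hij : i ≠ j)
    (hi0 : g i 0 = 0) (hj0 : g j 0 = 0) : HasDerivAt (fun t => ∏ i ∈ s, g i t) 0 0 := by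
  classical
  refine (HasDerivAt.fun_finsetProd hg).congr_deriv (Finset.sum_eq_zero fun k _ => ?_)
  rw [smul_eq_mul, mul_eq_zero]
  left
  by_cases hk : k = i
  · subst hk
    exact Finset.prod_eq_zero (Finset.mem_erase.2 ⟨hij.symm, hj⟩) hj0
  · exact Finset.prod_eq_zero (Finset.mem_erase.2 ⟨fun e => hk e.symm, hi⟩) hi0

/-- Mixed partial derivatives of sums of products of functions of one variable. -/
lemma hasMixedPartial_sum_prod {ι : Type*} (s : Finset ι) (k : ℕ) (c : ι → ℂ)
    (p : ι → Fin k → ℂ → ℂ) (p' : ι → Fin k → ℂ) (hp : ∀ i κ, HasDerivAt (p i κ) (p' i κ) 0) :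
    HasMixedPartial k (fun t => ∑ i ∈ s, c i * ∏ κ, p i κ (t κ)) (∑ i ∈ s, c i * ∏ κ, p' i κ) := by
  induction k generalizing c with
  | zero => simp [HasMixedPartial]
  | succ k ih =>
    refine ⟨fun t => ∑ i ∈ s, (c i * p i 0 t) * ∏ κ : Fin k, p' i κ.succ, fun t => ?_, ?_⟩
    · have := ih (fun i => c i * p i 0 t) (fun i κ => p i κ.succ) (fun i κ => p' i κ.succ)
        (fun i κ => hp i κ.succ)
      have e : (fun x : Fin k → ℂ =>
          ∑ i ∈ s, c i * ∏ κ, p i κ ((Fin.cons t x : Fin (k + 1) → ℂ) κ)) =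
          fun x => ∑ i ∈ s, (c i * p i 0 t) * ∏ κ : Fin k, p i κ.succ (x κ) := by
        funext x
        refine Finset.sum_congr rfl fun i _ => ?_
        rw [Fin.prod_univ_succ]
        simp only [Fin.cons_zero, Fin.cons_succ]
        ring
      rw [e]
      exact this
    · simp only [Fin.prod_univ_succ]
      refine HasDerivAt.fun_sum fun i _ => ?_
      rw [← mul_assoc]
      exact ((hp i 0).const_mul (c i)).mul_const _

namespace WordFun

open Partition

variable {F : Type} {L : Type u} {n : ℕ} {α : Weights F} (col : L → F)
  (hα : ∀ (n : ℕ) (f : Fin n → F), α n f ⊤ = 1)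
include hα

lemma log_zero (hn : 0 < n) (w : Fin n → L) : log α col (fun _ _ ↦ 0) n w = 0 :=
  log_unique col hα _ (fun _ _ => 0) (fun _ hn _ => Finset.sum_eq_zero fun π _ =>
    mul_eq_zero_of_right _ (Finset.prod_eq_zero (block_mem_blocks π ⟨0, hn⟩) rfl)) n hn w

lemma log_zero_smul (Φ : WordFun L) (hn : 0 < n) (w : Fin n → L) :
    log α col (fun n w => (0 : ℂ) * Φ n w) n w = 0 := by
  simp only [zero_mul]
  exact log_zero col hα hn w

/-- The linear part of the cumulants is the moment. -/
lemma hasDerivAt_log (Φ : WordFun L) (hn : 0 < n) (w : Fin n → L) :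
    HasDerivAt (fun t : ℂ => log α col (fun n w => t * Φ n w) n w) (Φ n w) 0 := by
  classical
  induction n using Nat.strong_induction_on with
  | _ n ih =>
    simp only [log_eq]
    have h1 : HasDerivAt (fun t : ℂ => t * Φ n w) (Φ n w) 0 := by
      simpa using (hasDerivAt_id (0 : ℂ)).mul_const (Φ n w)
    have h2 : HasDerivAt (fun t : ℂ => ∑ π ∈ Finset.univ.filter (fun π : Setoid (Fin n) => π ≠ ⊤),
        α n (col ∘ w) π * ∏ β ∈ blocks π, ev (log α col (fun n w => t * Φ n w)) w β)
        (∑ π ∈ Finset.univ.filter (fun π : Setoid (Fin n) => π ≠ ⊤), α n (col ∘ w) π * 0) 0 := by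
      refine HasDerivAt.fun_sum fun π hπ => HasDerivAt.const_mul _ ?_
      have hπ' : π ≠ ⊤ := (Finset.mem_filter.1 hπ).2
      obtain ⟨i, j, hij⟩ : ∃ i j, ¬ π i j := by
        by_contra! h
        exact hπ' (by ext a b; simpa using h a b)
      have hz : ∀ i, ev (log α col (fun n w => (0 : ℂ) * Φ n w)) w (block π i) = 0 := fun i =>
        log_zero_smul col hα Φ (card_pos_of_mem_blocks (block_mem_blocks π i)) _
      exact hasDerivAt_prod_zero (fun β hβ => ih _ (card_lt_of_mem_blocks hπ' hβ)
        (card_pos_of_mem_blocks hβ) _) (block_mem_blocks π i) (block_mem_blocks π j)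
        (fun e => hij (block_eq_iff.1 e)) (hz i) (hz j)
    exact (h1.fun_sub h2).congr_deriv (by simp)

end WordFun

/-! ### Iterated products -/

namespace MFAlg

variable {F : Type}

lemma iterEmb_castSucc (k : ℕ) (A : Fin (k + 2) → MFAlg.{u} F) (i : Fin (k + 1)) :
    iterEmb (k + 1) A i.castSucc = (inl _ _).comp (iterEmb k (fun i => A i.castSucc) i) := by
  rw [iterEmb]
  exact Fin.lastCases_castSucc (motive := fun i => Hom (A i) (iterCoprod (k + 1) A)) i

lemma iterEmb_last (k : ℕ) (A : Fin (k + 2) → MFAlg.{u} F) :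
    iterEmb (k + 1) A (Fin.last (k + 1)) = inr _ _ := by
  rw [iterEmb]
  exact Fin.lastCases_last (motive := fun i => Hom (A i) (iterCoprod (k + 1) A))

lemma iter_comp_iterEmb (P : UniversalProduct.{u} F) (k : ℕ) (A : Fin (k + 1) → MFAlg.{u} F)
    (φ : ∀ κ, (A κ).Functional) (κ : Fin (k + 1)) :
    (P.iter k A φ).comp (iterEmb k A κ) = φ κ := by
  induction k with
  | zero =>
    obtain rfl : κ = 0 := Fin.ext (by omega)
    rfl
  | succ k ih =>
    induction κ using Fin.lastCases with
    | last =>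
      rw [iterEmb_last]
      exact P.restrict_right _ _
    | cast κ =>
      rw [iterEmb_castSucc]
      exact (congrArg (Functional.comp · _) (P.restrict_left _ _)).trans (ih _ _ κ)

variable {α : Weights F} (hα : α.Admissible)

/-- The mixed cumulants of an iterated product vanish. -/
lemma logHat_iter_eq_zero (k : ℕ) (A : Fin (k + 1) → MFAlg.{u} F)
    (φ : ∀ κ, (A κ).Functional) {n : ℕ} (b : Fin n → Fin (k + 1)) (y : ∀ ℓ, (A (b ℓ)).Letter)
    {i j : Fin n} (hij : b i ≠ b j) :
    ((cumulantUniversalProduct hα).iter k A φ).logHat α n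
      (fun ℓ => Letter.map (iterEmb k A (b ℓ)) (y ℓ)) = 0 := by
  induction k generalizing n with
  | zero => exact absurd (Fin.ext (by omega)) hij
  | succ k ih =>
    have key : ∀ (κ : Fin (k + 2)) (y : (A κ).Letter), ∃ z,
        coprodLetter (iterCoprod k fun i => A i.castSucc) (A (Fin.last (k + 1))) z =
          Letter.map (iterEmb (k + 1) A κ) y ∧
        ((∃ (κ' : Fin (k + 1)) (y' : (A κ'.castSucc).Letter), κ = κ'.castSucc ∧
          z = Sum.inl (Letter.map (iterEmb k (fun i => A i.castSucc) κ') y')) ∨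
          (κ = Fin.last (k + 1) ∧ ∃ y', z = Sum.inr y')) := by
      intro κ
      induction κ using Fin.lastCases with
      | last =>
        intro y
        refine ⟨Sum.inr y, ?_, Or.inr ⟨rfl, y, rfl⟩⟩
        rw [iterEmb_last]
        rfl
      | cast κ =>
        intro y
        refine ⟨Sum.inl (Letter.map (iterEmb k (fun i => A i.castSucc) κ) y), ?_,
          Or.inl ⟨κ, y, rfl, rfl⟩⟩
        rw [iterEmb_castSucc]
        rfl
    choose z hz hz' using fun ℓ => key (b ℓ) (y ℓ)
    have e : (fun ℓ => Letter.map (iterEmb (k + 1) A (b ℓ)) (y ℓ)) =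
        coprodLetter (iterCoprod k fun i => A i.castSucc) (A (Fin.last (k + 1))) ∘ z :=
      funext fun ℓ => (hz ℓ).symm
    rw [e]
    refine (logHat_cumulantOp hα _ _ i.pos z).trans ?_
    rcases sum_word_cases z with ⟨u, rfl⟩ | ⟨u, rfl⟩ | ⟨i, j, hi, hj⟩
    · have h : ∀ ℓ, ∃ (κ' : Fin (k + 1)) (y' : (A κ'.castSucc).Letter), b ℓ = κ'.castSucc ∧
          u ℓ = Letter.map (iterEmb k (fun i => A i.castSucc) κ') y' := by
        intro ℓ
        rcases hz' ℓ with ⟨κ', y', h1, h2⟩ | ⟨-, y', h2⟩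
        · exact ⟨κ', y', h1, Sum.inl_injective h2⟩
        · simp at h2
      choose b' y' h1 h2 using h
      rw [WordFun.directSum_inl, funext h2]
      refine ih (fun i => A i.castSucc) (fun i => φ i.castSucc) b' y' (i := i) (j := j)
        fun e => hij ?_
      rw [h1, h1, e]
    · have h : ∀ ℓ, b ℓ = Fin.last (k + 1) := by
        intro ℓ
        rcases hz' ℓ with ⟨κ', y', h1, h2⟩ | ⟨h1, -⟩
        · simp at h2
        · exact h1
      exact absurd ((h i).trans (h j).symm) hij
    · exact WordFun.directSum_mixed hi hj

end MFAlg

open Partition in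
/-- The product over the positions with property `p`, as the product over the enumeration of these
positions. -/
lemma ordProd_filter {A : Type u} [NonUnitalRing A] {n : ℕ} (a : Fin n → A)
    (p : Fin n → Prop) [DecidablePred p] {β : Finset (Fin n)} (hβ : ∀ i, i ∈ β ↔ p i) :
    ordProd (((List.finRange n).filter p).map a) = ordProd (List.ofFn (a ∘ enum β)) := by
  let l := (List.finRange n).filter p
  have hl : l.Pairwise (· < ·) := (List.pairwise_lt_finRange n).filter _
  have := enum_transport (β := β) (g := l.get) (fun i j hij => List.pairwise_iff_get.1 hl i j hij)
    (fun x => by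
      rw [hβ, ← List.mem_iff_get]
      simp [l])
    (fun k e => ordProd (List.ofFn (a ∘ e)))
  rw [this]
  congr 1
  rw [← List.map_ofFn, List.ofFn_get]

end

noncomputable section

/-! ### Highest coefficients of the product defined by cumulants -/

namespace MFAlg

open Partition WordFun

variable {F : Type} {α : Weights F} (hα : α.Admissible)

/-- The cumulants of an iterated product on a block of a word with letters from the factors. -/
lemma ev_logHat_iter (k : ℕ) (A : Fin (k + 1) → MFAlg.{u} F) (φ : ∀ κ, (A κ).Functional) {n : ℕ}
    (b : Fin n → Fin (k + 1)) (y : ∀ κ, Fin n → (A κ).Letter) {β : Finset (Fin n)} {i : Fin n}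
    (hi : i ∈ β) :
    ev (((cumulantUniversalProduct hα).iter k A φ).logHat α)
      (fun ℓ => Letter.map (iterEmb k A (b ℓ)) (y (b ℓ) ℓ)) β =
      if ∀ j ∈ β, b j = b i then ev ((φ (b i)).logHat α) (y (b i)) β else 0 := by
  split_ifs with h
  · rw [ev_congr _ (w' := Letter.map (iterEmb k A (b i)) ∘ y (b i)) fun j hj => by
      rw [h j hj]
      rfl]
    rw [← iter_comp_iterEmb (cumulantUniversalProduct hα) k A φ (b i)]
    exact (logHat_comp hα _ _ (Finset.card_pos.2 ⟨i, hi⟩) _).symm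
  · push Not at h
    obtain ⟨j, hj, hne⟩ := h
    obtain ⟨i, rfl⟩ := (mem_iff_enum i).1 hi
    obtain ⟨j, rfl⟩ := (mem_iff_enum j).1 hj
    exact logHat_iter_eq_zero hα k A φ (b ∘ enum β) (fun ℓ => y (b (enum β ℓ)) (enum β ℓ)) hne

open Classical in
/-- The contribution of the block `β` to a summand of the moments of an iterated product, as a
function of the scaling parameter of the factor `κ`; it is `1` if the block does not belong to this
factor. -/
def blockFactor (α : Weights F) {A : MFAlg.{u} F} (φ : A.Functional) {n : ℕ} (S : Finset (Fin n))
    (y : Fin n → A.Letter) (β : Finset (Fin n)) (t : ℂ) : ℂ :=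
  if β ⊆ S then ev ((t • φ).logHat α) y β else 1

include hα in
lemma hasDerivAt_ev_logHat {A : MFAlg.{u} F} (φ : A.Functional) {n : ℕ} (y : Fin n → A.Letter)
    {β : Finset (Fin n)} (hβ : 0 < β.card) :
    HasDerivAt (fun t : ℂ => ev ((t • φ).logHat α) y β) (ev φ.hat y β) 0 :=
  hasDerivAt_log _ hα.one_block φ.hat hβ _

include hα in
lemma ev_logHat_zero {A : MFAlg.{u} F} (φ : A.Functional) {n : ℕ} (y : Fin n → A.Letter)
    {β : Finset (Fin n)} (hβ : 0 < β.card) : ev (((0 : ℂ) • φ).logHat α) y β = 0 :=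
  log_zero_smul _ hα.one_block φ.hat hβ _

include hα in
lemma differentiableAt_blockFactor {A : MFAlg.{u} F} (φ : A.Functional) {n : ℕ}
    (S : Finset (Fin n)) (y : Fin n → A.Letter) {β : Finset (Fin n)} (hβ : 0 < β.card) :
    DifferentiableAt ℂ (blockFactor α φ S y β) 0 := by
  classical
  by_cases h : β ⊆ S
  · have : blockFactor α φ S y β = fun t : ℂ => ev ((t • φ).logHat α) y β :=
      funext fun t => if_pos h
    rw [this]
    exact (hasDerivAt_ev_logHat hα φ y hβ).differentiableAt
  · have : blockFactor α φ S y β = fun t : ℂ => 1 := funext fun t => if_neg h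
    rw [this]
    exact differentiableAt_const _

/-- The moments of `t₁φ₁ ⊙ ⋯ ⊙ t_kφ_k` are a sum over partitions of products of functions of one
variable, with linear parts given by the moments of the factors. -/
lemma cumulantUniversalProduct_hasHighestCoefficients :
    (cumulantUniversalProduct.{u} hα).HasHighestCoefficients α := by
  classical
  intro k n b f hb A φ a ha
  have hn : 0 < n := (hb 0).choose.pos
  let P := cumulantUniversalProduct.{u} hα
  let y : ∀ κ, Fin n → (A κ).Letter := fun κ ℓ =>
    if h : a κ ℓ ∈ (A κ).face (f ℓ) then ⟨f ℓ, a κ ℓ, h⟩ else ⟨f ℓ, 0⟩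
  have hy1 : ∀ κ ℓ, (y κ ℓ).1 = f ℓ := fun κ ℓ => by
    simp only [y]
    split_ifs <;> rfl
  have hy2 : ∀ κ ℓ, b ℓ = κ → ((y κ ℓ).2 : A κ) = a κ ℓ := by
    rintro _ ℓ rfl
    have : y (b ℓ) ℓ = ⟨f ℓ, a (b ℓ) ℓ, ha ℓ⟩ := dif_pos (ha ℓ)
    rw [this]
  let S : Fin (k + 1) → Finset (Fin n) := fun κ => Finset.univ.filter (b · = κ)
  let x : Fin n → (iterCoprod k A).Letter := fun ℓ => Letter.map (iterEmb k A (b ℓ)) (y (b ℓ) ℓ)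
  let c : Setoid (Fin n) → ℂ := fun π => if π ≤ Setoid.ker b then α n f π else 0
  let p : Setoid (Fin n) → Fin (k + 1) → ℂ → ℂ := fun π κ t =>
    ∏ β ∈ blocks π, blockFactor α (φ κ) (S κ) (y κ) β t
  have hp : ∀ π κ, HasDerivAt (p π κ) (deriv (p π κ) 0) 0 := fun π κ => by
    refine DifferentiableAt.hasDerivAt ?_
    exact DifferentiableAt.fun_finsetProd fun β hβ =>
      differentiableAt_blockFactor hα _ _ _ (card_pos_of_mem_blocks hβ)
  have key := hasMixedPartial_sum_prod Finset.univ (k + 1) c p (fun π κ => deriv (p π κ) 0) hp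
  -- the moments of the iterated product
  have e1 : ∀ t : Fin (k + 1) → ℂ, P.iter k A (fun κ => t κ • φ κ)
      (ordProd (List.ofFn (fun ℓ => iterEmb k A (b ℓ) (a (b ℓ) ℓ)))) =
      ∑ π, c π * ∏ κ, p π κ (t κ) := by
    intro t
    have : P.iter k A (fun κ => t κ • φ κ)
        (ordProd (List.ofFn (fun ℓ => iterEmb k A (b ℓ) (a (b ℓ) ℓ)))) =
        (P.iter k A (fun κ => t κ • φ κ)).hat n x := by
      unfold Functional.hat
      congr 3
      funext ℓ
      rw [← hy2 _ ℓ rfl]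
      rfl
    rw [this, ← exp_logHat hα _ hn, exp_eq_ev]
    refine Finset.sum_congr rfl fun π _ => ?_
    have hcol : Sigma.fst ∘ x = f := funext fun ℓ => hy1 _ ℓ
    rw [hcol]
    by_cases hπ : π ≤ Setoid.ker b
    · simp only [c, if_pos hπ, p]
      rw [Finset.prod_comm]
      congr 1
      refine Finset.prod_congr rfl fun β hβ => ?_
      obtain ⟨i, rfl⟩ := mem_blocks.1 hβ
      have hbi : ∀ j ∈ block π i, b j = b i := fun j hj => (hπ (mem_block.1 hj)).symm
      rw [ev_logHat_iter hα k A _ b y (self_mem_block π i), if_pos hbi,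
        Finset.prod_eq_single (b i)]
      · exact (if_pos fun j hj => by simpa [S] using hbi j hj).symm
      · intro κ _ hκ
        refine if_neg fun h => hκ ?_
        simpa [S] using (Finset.mem_filter.1 (h (self_mem_block π i))).2.symm
      · simp
    · simp only [c, if_neg hπ, zero_mul]
      refine mul_eq_zero_of_right _ ?_
      have : ∃ i j, π i j ∧ b i ≠ b j := by
        by_contra! h
        exact hπ fun {i j} hij => h i j hij
      obtain ⟨i, j, hij, hne⟩ := this
      refine Finset.prod_eq_zero (block_mem_blocks π i) ?_
      rw [ev_logHat_iter hα k A _ b y (self_mem_block π i), if_neg]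
      exact fun h => hne (h j (mem_block.2 hij)).symm
  simp only [← e1] at key
  convert key using 1
  -- only the partition into the fibres of `b` contributes to the mixed derivative
  rw [Finset.sum_eq_single (Setoid.ker b)]
  · simp only [c, if_pos le_rfl]
    congr 1
    refine Finset.prod_congr rfl fun κ _ => ?_
    obtain ⟨i, rfl⟩ := hb κ
    have hS : block (Setoid.ker b) i = S (b i) := by
      ext j
      rw [mem_block]
      simp only [S, Finset.mem_filter, Finset.mem_univ, true_and]
      exact eq_comm
    have hpi : p (Setoid.ker b) (b i) =
        fun t => ev ((t • φ (b i)).logHat α) (y (b i)) (S (b i)) := by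
      funext t
      simp only [p]
      rw [Finset.prod_eq_single (S (b i))]
      · exact if_pos subset_rfl
      · intro β hβ hne
        refine if_neg fun h => hne ?_
        obtain ⟨j, rfl⟩ := mem_blocks.1 hβ
        rw [← hS, block_eq_iff]
        exact (Finset.mem_filter.1 (h (self_mem_block _ j))).2
      · intro h
        exact absurd (hS ▸ block_mem_blocks _ i) h
    have hpos : 0 < (S (b i)).card := Finset.card_pos.2 ⟨i, by simp [S]⟩
    rw [hpi, (hasDerivAt_ev_logHat hα _ _ hpos).deriv,
      ordProd_filter (a (b i)) _ (β := S (b i)) (fun j => by simp [S])]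
    unfold ev Functional.hat
    congr 3
    funext j
    exact (hy2 _ _ (Finset.mem_filter.1 (enum_mem (S (b i)) j)).2).symm
  · intro π _ hπ
    by_cases hle : π ≤ Setoid.ker b
    · -- a fibre of `b` contains two blocks of `π`
      have : ∃ i j, b i = b j ∧ ¬ π i j := by
        by_contra! h
        exact hπ (le_antisymm hle fun {i j} hij => h i j hij)
      obtain ⟨i, j, hij, hne⟩ := this
      refine mul_eq_zero_of_right _ (Finset.prod_eq_zero (Finset.mem_univ (b i)) ?_)
      have hsub : ∀ l, b l = b i → block π l ⊆ S (b i) := fun l hl m hm => by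
        simp only [S, Finset.mem_filter, Finset.mem_univ, true_and]
        exact (hle (mem_block.1 hm)).symm.trans hl
      have hzero : ∀ l, b l = b i → blockFactor α (φ (b i)) (S (b i)) (y (b i)) (block π l) 0 = 0 :=
        fun l hl => (if_pos (hsub l hl)).trans
          (ev_logHat_zero hα _ _ (card_pos_of_mem_blocks (block_mem_blocks π l)))
      exact (hasDerivAt_prod_zero (fun β hβ => (differentiableAt_blockFactor hα _ _ _
        (card_pos_of_mem_blocks hβ)).hasDerivAt) (block_mem_blocks π i) (block_mem_blocks π j)
        (fun e => hne (block_eq_iff.1 e)) (hzero i rfl) (hzero j hij.symm)).deriv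
    · simp only [c, if_neg hle, zero_mul]
  · simp

end MFAlg

end

noncomputable section

/-! ### The free multi-faced algebra on coloured letters -/

/-- The homomorphism from the free algebra that maps the letters to the elements `f x`. -/
def freeSemigroupLift {X A : Type u} [NonUnitalRing A] [Module ℂ A] [IsScalarTower ℂ A A]
    [SMulCommClass ℂ A A] (f : X → A) : MonoidAlgebra ℂ (FreeSemigroup X) →ₙₐ[ℂ] A :=
  MonoidAlgebra.liftMagma ℂ (FreeSemigroup.lift f)

lemma freeSemigroupLift_of {X A : Type u} [NonUnitalRing A] [Module ℂ A] [IsScalarTower ℂ A A]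
    [SMulCommClass ℂ A A] (f : X → A) (x : X) :
    freeSemigroupLift f (MonoidAlgebra.single (FreeSemigroup.of x) 1) = f x := by
  simp [freeSemigroupLift]

lemma freeSemigroup_hom_ext {X A : Type u} [NonUnitalRing A] [Module ℂ A]
    {f g : MonoidAlgebra ℂ (FreeSemigroup X) →ₙₐ[ℂ] A}
    (h : ∀ x, f (MonoidAlgebra.single (FreeSemigroup.of x) 1) =
      g (MonoidAlgebra.single (FreeSemigroup.of x) 1)) : f = g := by
  refine MonoidAlgebra.nonUnitalAlgHom_ext ℂ fun s => ?_
  induction s using FreeSemigroup.recOnMul with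
  | ih1 x => exact h x
  | ih2 x y hx hy =>
    have e : (MonoidAlgebra.single (FreeSemigroup.of x * y) 1 : MonoidAlgebra ℂ (FreeSemigroup X)) =
        MonoidAlgebra.single (FreeSemigroup.of x) 1 * MonoidAlgebra.single y 1 := by
      rw [MonoidAlgebra.single_mul_single, one_mul]
    rw [e, map_mul, map_mul, hx, hy]

/-- Homomorphisms from a generated subalgebra that agree on the generators are equal. -/
lemma eqOn_adjoin {A C : Type u} [NonUnitalRing A] [Module ℂ A] [IsScalarTower ℂ A A]
    [SMulCommClass ℂ A A] [NonUnitalRing C] [Module ℂ C] {S : Set A}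
    (f g : NonUnitalAlgebra.adjoin ℂ S →ₙₐ[ℂ] C)
    (h : ∀ x (hx : x ∈ S), f ⟨x, NonUnitalAlgebra.subset_adjoin ℂ hx⟩ =
      g ⟨x, NonUnitalAlgebra.subset_adjoin ℂ hx⟩) : f = g := by
  have key : ∀ x (hx : x ∈ NonUnitalAlgebra.adjoin ℂ S), f ⟨x, hx⟩ = g ⟨x, hx⟩ := by
    intro x hx
    induction hx using NonUnitalAlgebra.adjoin_induction with
    | mem x hx => exact h x hx
    | add x y hx hy ihx ihy =>
      have := congrArg₂ (· + ·) ihx ihy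
      simp only [← map_add] at this
      exact this
    | zero => exact (map_zero f).trans (map_zero g).symm
    | mul x y hx hy ihx ihy =>
      have := congrArg₂ (· * ·) ihx ihy
      simp only [← map_mul] at this
      exact this
    | smul r x hx ih =>
      have := congrArg (r • ·) ih
      simp only [← map_smul] at this
      exact this
  ext ⟨x, hx⟩
  exact key x hx

section freeAlg

variable {F X Y : Type} (col : X → F)

/-- The free multi-faced algebra on a set of coloured letters: the face of colour `q` is freely
generated by the letters of colour `q`. The letters live in the lowest universe, as finite sets of
letters suffice. -/
def freeAlg : MFAlg.{u} F where
  carrier := MonoidAlgebra ℂ (FreeSemigroup (ULift.{u} X))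
  face q := NonUnitalAlgebra.adjoin ℂ
    {a | ∃ x : ULift.{u} X, col x.down = q ∧ MonoidAlgebra.single (FreeSemigroup.of x) 1 = a}
  free C _ _ _ _ h := by
    have hS : ∀ x : ULift.{u} X, (MonoidAlgebra.single (FreeSemigroup.of x) 1 :
        MonoidAlgebra ℂ (FreeSemigroup (ULift.{u} X))) ∈ NonUnitalAlgebra.adjoin ℂ
          {a | ∃ y : ULift.{u} X, col y.down = col x.down ∧
            MonoidAlgebra.single (FreeSemigroup.of y) 1 = a} :=
      fun x => NonUnitalAlgebra.subset_adjoin ℂ ⟨x, rfl, rfl⟩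
    refine ⟨freeSemigroupLift (X := ULift.{u} X) (A := C) fun x => h (col x.down) ⟨_, hS x⟩,
      fun q x => ?_, fun g hg => ?_⟩
    · refine DFunLike.congr_fun (eqOn_adjoin (A := MonoidAlgebra ℂ (FreeSemigroup (ULift.{u} X)))
        ((freeSemigroupLift (A := C) fun x : ULift.{u} X => h (col x.down) ⟨_, hS x⟩).comp
        (NonUnitalSubalgebraClass.subtype _)) (h q) ?_) x
      rintro _ ⟨y, rfl, rfl⟩
      exact freeSemigroupLift_of (A := C) (fun x : ULift.{u} X => h (col x.down) ⟨_, hS x⟩) y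
    · refine freeSemigroup_hom_ext fun x => ?_
      rw [freeSemigroupLift_of]
      exact hg (col x.down) ⟨_, hS x⟩

variable {col}

/-- The letters of the free multi-faced algebra. -/
def gen (x : X) : freeAlg.{u} col :=
  (MonoidAlgebra.single (FreeSemigroup.of (ULift.up x)) 1 :
    MonoidAlgebra ℂ (FreeSemigroup (ULift.{u} X)))

lemma gen_mem_face (x : X) : gen x ∈ (freeAlg.{u} col).face (col x) :=
  NonUnitalAlgebra.subset_adjoin (A := MonoidAlgebra ℂ (FreeSemigroup (ULift.{u} X))) ℂ
    ⟨ULift.up x, rfl, rfl⟩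

lemma mem_adjoin_gen (a : freeAlg.{u} col) :
    a ∈ NonUnitalAlgebra.adjoin ℂ
      (Set.range fun x : ULift.{u} X => (gen x.down : freeAlg col)) := by
  refine MFAlg.mem_adjoin_of_face _ (fun q x hx => ?_) a
  refine NonUnitalAlgebra.adjoin_le (R := ℂ) (A := freeAlg.{u} col)
    (S := NonUnitalAlgebra.adjoin ℂ _) ?_ hx
  rintro _ ⟨x, -, rfl⟩
  exact NonUnitalAlgebra.subset_adjoin ℂ ⟨x, rfl⟩

variable {A B : MFAlg.{u} F}

/-- The homomorphism on the free algebra that maps the letters to the elements `g x`. -/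
def freeLift (g : X → A) (hg : ∀ x, g x ∈ A.face (col x)) : MFAlg.Hom (freeAlg.{u} col) A where
  toHom := freeSemigroupLift (fun x : ULift.{u} X => g x.down)
  map_face := by
    intro q x hx
    refine NonUnitalAlgebra.adjoin_le (R := ℂ) (A := MonoidAlgebra ℂ (FreeSemigroup (ULift.{u} X)))
      (S := (A.face q).comap (freeSemigroupLift (fun x : ULift.{u} X => g x.down))) ?_ hx
    rintro _ ⟨x, rfl, rfl⟩
    change freeSemigroupLift _ _ ∈ A.face _
    rw [freeSemigroupLift_of]
    exact hg x.down

@[simp] lemma freeLift_gen (g : X → A) (hg : ∀ x, g x ∈ A.face (col x)) (x : X) :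
    freeLift g hg (gen x) = g x :=
  freeSemigroupLift_of _ _

lemma free_hom_ext {f g : MFAlg.Hom (freeAlg.{u} col) A} (h : ∀ x, f (gen x) = g (gen x)) :
    f = g :=
  MFAlg.Hom.ext_iff'.2 fun x => DFunLike.congr_fun
    (freeSemigroup_hom_ext (f := f.toHom) (g := g.toHom) fun x => h x.down) x

/-- The values of a functional on the words in the letters. -/
def wordVal (φ : (freeAlg.{u} col).Functional) : WordFun X := fun _ w =>
  φ (ordProd (List.ofFn fun i => gen (w i)))

lemma free_functional_ext {φ ψ : (freeAlg.{u} col).Functional}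
    (h : ∀ n, 0 < n → ∀ w, wordVal φ n w = wordVal ψ n w) : φ = ψ :=
  MFAlg.functional_ext_range mem_adjoin_gen fun n hn w => h n hn fun i => (w i).down

/-- The values of a functional on words can be prescribed, since words in free letters satisfy no
relations. -/
lemma exists_functional (E : WordFun X) : ∃ φ : (freeAlg.{u} col).Functional,
    ∀ n, 0 < n → ∀ w, wordVal φ n w = E n w := by
  let Lin : ℂ → ULift.{u} X → ULift.{u} X → ULift.{u} X → Prop := fun _ _ _ _ => False
  let Mul : ULift.{u} X → ULift.{u} X → ULift.{u} X → Prop := fun _ _ _ => False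
  let ρ : freeAlg.{u} col →ₙₐ[ℂ] Module.End ℂ (consistent Lin Mul) :=
    freeSemigroupLift (X := ULift.{u} X) (appendOp Lin Mul)
  obtain ⟨φ, hφ⟩ := MFAlg.exists_functional_of_consistent (A := freeAlg.{u} col)
    (fun x : ULift.{u} X => gen x.down) ρ (fun x => freeSemigroupLift_of _ x)
    (Φ := fun l => E (l.map ULift.down).length (l.map ULift.down).get)
    ⟨fun _ _ _ _ h => h.elim, fun _ _ _ h => h.elim⟩
  refine ⟨φ, fun n hn w => ?_⟩
  have := hφ n hn fun i => ULift.up (w i)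
  refine this.trans ?_
  have e : (List.ofFn fun i => ULift.up.{u} (w i)).map ULift.down = List.ofFn w := by
    rw [List.map_ofFn]
    rfl
  have e' : ∀ l l' : List X, l = l' → E l.length l.get = E l'.length l'.get := by
    rintro l _ rfl
    rfl
  exact (e' _ _ e).trans (wordFun_ofFn E w)

/-- The functional with prescribed values on words. -/
def freeFunctional (col : X → F) (E : WordFun X) : (freeAlg.{u} col).Functional :=
  (exists_functional E).choose

lemma wordVal_freeFunctional (E : WordFun X) {n : ℕ} (hn : 0 < n) (w : Fin n → X) :
    wordVal (freeFunctional.{u} col E) n w = E n w :=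
  (exists_functional E).choose_spec n hn w

end freeAlg

/-! ### Multilinearity of products -/

section Multilinear

variable (A : Type u) [NonUnitalRing A] [Module ℂ A] [IsScalarTower ℂ A A] [SMulCommClass ℂ A A]

/-- The product of `n` elements as a multilinear map (with value `0` for `n = 0`). -/
def prodMultilinear (n : ℕ) : MultilinearMap ℂ (fun _ : Fin n => A) A :=
  ((Unitization.sndHom ℂ ℂ A).compMultilinearMap
    (MultilinearMap.mkPiAlgebraFin ℂ n (Unitization ℂ A))).compLinearMap
    (fun _ => Unitization.inrHom ℂ ℂ A)

variable {A}

lemma prodMultilinear_apply {n : ℕ} (hn : 0 < n) (v : Fin n → A) :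
    prodMultilinear A n v = ordProd (List.ofFn v) := by
  have : (List.ofFn v) ≠ [] := fun e => by
    have := congrArg List.length e
    simp at this
    omega
  change ((MultilinearMap.mkPiAlgebraFin ℂ n (Unitization ℂ A))
    (fun i => ((v i : A) : Unitization ℂ A))).snd = _
  have e : ((ordProd (List.ofFn v) : A) : Unitization ℂ A) =
      (List.ofFn fun i => ((v i : A) : Unitization ℂ A)).prod := by
    rw [inr_ordProd this]
    exact congrArg List.prod (List.map_ofFn (f := v) (g := fun a : A => (a : Unitization ℂ A)))
  rw [MultilinearMap.mkPiAlgebraFin_apply, ← e]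
  exact Unitization.snd_inr ℂ _

end Multilinear

section wordVal

variable {F X Y : Type} {col : X → F} {col' : Y → F} {A : MFAlg.{u} F} {n : ℕ}

lemma wordVal_comp (φ : A.Functional) (h : MFAlg.Hom (freeAlg.{u} col) A) (w : Fin n → X) :
    wordVal (φ.comp h) n w = φ (ordProd (List.ofFn fun i => h (gen (w i)))) := by
  unfold wordVal
  rw [MFAlg.Functional.comp_apply, MFAlg.Hom.map_ordProd, List.map_ofFn]
  rfl

lemma wordVal_comp_smul (φ : (freeAlg.{u} col').Functional)
    (h : MFAlg.Hom (freeAlg.{u} col) (freeAlg.{u} col')) (hn : 0 < n) (w : Fin n → X)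
    (v : Fin n → Y) (c : Fin n → ℂ) (e : ∀ i, h (gen (w i)) = c i • gen (v i)) :
    wordVal (φ.comp h) n w = (∏ i, c i) * wordVal φ n v := by
  rw [wordVal_comp]
  simp only [e]
  rw [← prodMultilinear_apply hn, MultilinearMap.map_smul_univ, map_smul, prodMultilinear_apply hn]
  rfl

/-- A functional on a word in sums of letters, expanded by multilinearity. -/
lemma wordVal_comp_sum {J : Type*} [Fintype J] (φ : (freeAlg.{u} col').Functional)
    (h : MFAlg.Hom (freeAlg.{u} col) (freeAlg.{u} col')) (hn : 0 < n) (w : Fin n → X)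
    (v : X → J → Y) (e : ∀ x, h (gen x) = ∑ j, gen (v x j)) :
    wordVal (φ.comp h) n w = ∑ c : Fin n → J, wordVal φ n fun i => v (w i) (c i) := by
  classical
  rw [wordVal_comp]
  simp only [e]
  rw [← prodMultilinear_apply hn, MultilinearMap.map_sum, map_sum]
  refine Finset.sum_congr rfl fun c _ => ?_
  rw [prodMultilinear_apply hn]
  rfl

end wordVal

end

noncomputable section

/-! ### Convolution of functionals on a free algebra -/

open MFAlg

section Convolution

variable {F X Y : Type} {col : X → F} {col' : Y → F}

lemma MFAlg.hom_add {A B : MFAlg.{u} F} (h : Hom A B) (a b : A) : h (a + b) = h a + h b :=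
  map_add h.toHom a b

lemma MFAlg.hom_zero {A B : MFAlg.{u} F} (h : Hom A B) : h (0 : A) = 0 :=
  map_zero h.toHom

lemma MFAlg.hom_smul {A B : MFAlg.{u} F} (h : Hom A B) (c : ℂ) (a : A) : h (c • a) = c • h a :=
  map_smul h.toHom c a

lemma MFAlg.hom_sum {A B : MFAlg.{u} F} (h : Hom A B) {J : Type*} (s : Finset J) (a : J → A) :
    h (∑ j ∈ s, a j) = ∑ j ∈ s, h (a j) :=
  map_sum h.toHom a s

variable (col) in
/-- The comultiplication `x ↦ x⁽¹⁾ + x⁽²⁾` of the free algebra. -/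
def delta : Hom (freeAlg.{u} col) ((freeAlg col).coprod (freeAlg col)) :=
  freeLift (fun x => inl _ _ (gen x) + inr _ _ (gen x)) fun x =>
    add_mem ((inl _ _).map_face _ _ (gen_mem_face x)) ((inr _ _).map_face _ _ (gen_mem_face x))

@[simp] lemma delta_gen (x : X) :
    delta.{u} col (gen x) = inl _ _ (gen x) + inr _ _ (gen x) := freeLift_gen _ _ _

namespace UniversalProduct

variable (P : UniversalProduct.{u} F)

/-- The convolution `φ ⋆ ψ = (φ ⊙ ψ) ∘ Δ` with respect to a universal product. -/
def conv (φ ψ : (freeAlg.{u} col).Functional) : (freeAlg.{u} col).Functional :=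
  (P.op φ ψ).comp (delta col)

/-- The convolution of pullbacks is a pullback of the product, by universality. -/
lemma conv_comp {A₁ A₂ : MFAlg.{u} F} (φ₁ : A₁.Functional) (φ₂ : A₂.Functional)
    (h₁ : Hom (freeAlg.{u} col) A₁) (h₂ : Hom (freeAlg.{u} col) A₂)
    (h : Hom (freeAlg.{u} col) (A₁.coprod A₂))
    (hh : ∀ x, h (gen x) = inl A₁ A₂ (h₁ (gen x)) + inr A₁ A₂ (h₂ (gen x))) :
    P.conv (φ₁.comp h₁) (φ₂.comp h₂) = (P.op φ₁ φ₂).comp h := by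
  have e : h = (MFAlg.map h₁ h₂).comp (delta col) := free_hom_ext fun x => by
    rw [hh, Hom.comp_apply, delta_gen, hom_add, MFAlg.map, lift_inl, lift_inr]
    rfl
  rw [e, conv, P.universality]
  rfl

lemma conv_assoc (φ ψ χ : (freeAlg.{u} col).Functional) :
    P.conv (P.conv φ ψ) χ = P.conv φ (P.conv ψ χ) := by
  let h : Hom (freeAlg.{u} col) (((freeAlg col).coprod (freeAlg col)).coprod (freeAlg col)) :=
    (MFAlg.map (delta col) (Hom.id _)).comp (delta col)
  have hh : ∀ x, h (gen x) = inl _ _ (inl _ _ (gen x) + inr _ _ (gen x)) + inr _ _ (gen x) := by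
    intro x
    rw [Hom.comp_apply, delta_gen, hom_add, MFAlg.map, lift_inl, lift_inr, Hom.comp_apply,
      delta_gen]
    rfl
  have e1 := P.conv_comp (P.op φ ψ) χ (delta col) (Hom.id _) h fun x => by
    rw [hh, delta_gen]
    rfl
  have e2 := P.conv_comp φ (P.op ψ χ) (Hom.id _) (delta col) ((assoc _ _ _).comp h) fun x => by
    rw [Hom.comp_apply, hh, hom_add, hom_add, hom_add, MFAlg.assoc, lift_inl, lift_inl, lift_inl,
      lift_inr, lift_inr, Hom.comp_apply, Hom.comp_apply, delta_gen, hom_add, add_assoc]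
    rfl
  rw [P.associativity] at e1
  exact e1.trans e2.symm

lemma conv_comm (hP : P.IsSymmetric) (φ ψ : (freeAlg.{u} col).Functional) :
    P.conv φ ψ = P.conv ψ φ := by
  have e := P.conv_comp ψ φ (Hom.id _) (Hom.id _) ((swap _ _).comp (delta col)) fun x => by
    rw [Hom.comp_apply, delta_gen, hom_add, swap, lift_inl, lift_inr, add_comm]
    rfl
  refine Eq.trans ?_ e.symm
  rw [conv, hP φ ψ]
  rfl

/-- The functional `0` is the pullback of itself along the zero homomorphism. -/
lemma conv_zero (φ : (freeAlg.{u} col).Functional) : P.conv φ 0 = φ := by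
  have e := P.conv_comp φ (0 : (freeAlg.{u} col).Functional) (Hom.id _)
    (freeLift (fun _ => 0) fun x => zero_mem _) (inl _ _) fun x => by
      rw [freeLift_gen, hom_zero, add_zero]
      rfl
  rw [P.restrict_left] at e
  exact e

end UniversalProduct

/-- The functionals on a free algebra, as a commutative monoid under convolution; it is written
additively. -/
@[nolint unusedArguments]
def ConvFun (P : UniversalProduct.{u} F) (_ : P.IsSymmetric) (col : X → F) : Type u :=
  (freeAlg.{u} col).Functional

variable {P : UniversalProduct.{u} F} {hP : P.IsSymmetric}

variable (P hP) in
/-- A functional as an element of the convolution monoid. -/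
def ConvFun.of (φ : (freeAlg.{u} col).Functional) : ConvFun P hP col := φ

instance : Add (ConvFun P hP col) := ⟨P.conv⟩

instance : Zero (ConvFun P hP col) := ⟨ConvFun.of P hP 0⟩

instance : AddCommMonoid (ConvFun P hP col) where
  add_assoc := P.conv_assoc
  zero_add φ := (P.conv_comm hP _ _).trans (P.conv_zero φ)
  add_zero := P.conv_zero
  add_comm := P.conv_comm hP
  nsmul := nsmulRec

/-- The values of a functional on words. -/
def ConvFun.val (φ : ConvFun P hP col) : WordFun X := wordVal φ

lemma ConvFun.ext {φ ψ : ConvFun P hP col} (h : ∀ m, 0 < m → ∀ w, φ.val m w = ψ.val m w) : φ = ψ :=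
  free_functional_ext h

variable (P hP) in
/-- The functional with prescribed values on words. -/
def ConvFun.mk (col : X → F) (E : WordFun X) : ConvFun P hP col := freeFunctional col E

lemma ConvFun.val_mk (E : WordFun X) {m : ℕ} (hm : 0 < m) (w : Fin m → X) :
    (ConvFun.mk P hP col E).val m w = E m w :=
  wordVal_freeFunctional E hm w

/-- The pullback of functionals along a homomorphism that commutes with the comultiplications. -/
def ConvFun.comap (h : Hom (freeAlg.{u} col) (freeAlg.{u} col'))
    (hh : ∀ x, delta col' (h (gen x)) = inl _ _ (h (gen x)) + inr _ _ (h (gen x))) :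
    ConvFun P hP col' →+ ConvFun P hP col where
  toFun φ := Functional.comp (A := freeAlg.{u} col) (B := freeAlg.{u} col') φ h
  map_zero' := rfl
  map_add' φ ψ := (P.conv_comp φ ψ h h ((delta col').comp h) hh).symm

variable (P hP) in
/-- The pullback along the homomorphism `y ↦ c y • g y`. -/
def ConvFun.subst (c : Y → ℂ) (g : Y → X) (hg : ∀ y, col (g y) = col' y) :
    ConvFun P hP col →+ ConvFun P hP col' :=
  ConvFun.comap (freeLift (fun y => c y • gen (g y)) fun y =>
    SMulMemClass.smul_mem _ (hg y ▸ gen_mem_face (g y))) fun x => by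
      simp only [freeLift_gen, hom_smul, delta_gen, smul_add]

lemma ConvFun.val_subst (c : Y → ℂ) (g : Y → X) (hg : ∀ y, col (g y) = col' y)
    (φ : ConvFun P hP col) {m : ℕ} (hm : 0 < m) (w : Fin m → Y) :
    (subst P hP c g hg φ).val m w = (∏ i, c (w i)) * φ.val m (g ∘ w) :=
  wordVal_comp_smul _ _ hm w (g ∘ w) (fun i => c (w i)) fun _ => freeLift_gen _ _ _

variable (P hP) in
/-- The pullback along the homomorphism `x ↦ ∑ j, (x, j)`. -/
def ConvFun.split (J : Type) [Fintype J] (col : X → F) :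
    ConvFun P hP (col ∘ Prod.fst (β := J)) →+ ConvFun P hP col :=
  ConvFun.comap (freeLift (fun x => ∑ j : J, gen (x, j)) fun x =>
    sum_mem fun j _ => gen_mem_face (x, j)) fun x => by
      simp only [freeLift_gen, hom_sum, delta_gen, Finset.sum_add_distrib]

lemma ConvFun.val_split {J : Type} [Fintype J] (φ : ConvFun P hP (col ∘ Prod.fst (β := J)))
    {m : ℕ} (hm : 0 < m) (w : Fin m → X) :
    (split P hP J col φ).val m w = ∑ c : Fin m → J, φ.val m fun i => (w i, c i) :=
  wordVal_comp_sum _ _ hm w (fun x j => (x, j)) fun _ => freeLift_gen _ _ _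

/-- A functional on an iterated free product of algebras pulls back to the sum of the pullbacks
of its factors. -/
lemma ConvFun.iter_comp (k : ℕ) (A : Fin (k + 1) → MFAlg.{u} F) (φ : ∀ κ, (A κ).Functional)
    (p : ∀ κ, Hom (freeAlg.{u} col) (A κ)) (h : Hom (freeAlg.{u} col) (iterCoprod k A))
    (hh : ∀ x, h (gen x) = ∑ κ, iterEmb k A κ (p κ (gen x))) :
    of P hP ((P.iter k A φ).comp h) = ∑ κ, of P hP ((φ κ).comp (p κ)) := by
  induction k with
  | zero =>
    have e : h = p 0 := free_hom_ext fun x => by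
      rw [hh, Fin.sum_univ_one]
      rfl
    rw [e]
    exact (Fin.sum_univ_one fun κ => of P hP ((φ κ).comp (p κ))).symm
  | succ k ih =>
    rw [Fin.sum_univ_castSucc]
    let h' : Hom (freeAlg.{u} col) (iterCoprod k fun i => A i.castSucc) :=
      freeLift (fun x => ∑ κ : Fin (k + 1), iterEmb k (fun i => A i.castSucc) κ
        (p κ.castSucc (gen x))) fun x => sum_mem fun κ _ =>
          (iterEmb _ _ _).map_face _ _ ((p _).map_face _ _ (gen_mem_face x))
    have e := ih (fun i => A i.castSucc) (fun i => φ i.castSucc) (fun i => p i.castSucc) h'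
      fun x => freeLift_gen _ _ _
    rw [← e]
    refine (P.conv_comp (P.iter k (fun i => A i.castSucc) fun i => φ i.castSucc)
      (φ (Fin.last (k + 1))) h' (p (Fin.last _)) h fun x => ?_).symm
    refine (hh x).trans ((Fin.sum_univ_castSucc _).trans (congrArg₂ (· + ·) ?_ ?_))
    · rw [freeLift_gen, hom_sum]
      refine Finset.sum_congr rfl fun κ _ => ?_
      rw [iterEmb_castSucc]
      rfl
    · rw [iterEmb_last]
      rfl

end Convolution

end

noncomputable section

/-! ### Multilinear words -/

section MixedPartial

lemma HasMixedPartial.unique {k : ℕ} {g : (Fin k → ℂ) → ℂ} {c c' : ℂ} (h : HasMixedPartial k g c)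
    (h' : HasMixedPartial k g c') : c = c' := by
  induction k generalizing c c' with
  | zero => exact h.symm.trans h'
  | succ k ih =>
    obtain ⟨g₁, h₁, d₁⟩ := h
    obtain ⟨g₂, h₂, d₂⟩ := h'
    obtain rfl : g₁ = g₂ := funext fun t => ih (h₁ t) (h₂ t)
    exact d₁.unique d₂

lemma hasMixedPartial_const_mul_prod (k : ℕ) (c : ℂ) :
    HasMixedPartial k (fun t => c * ∏ κ, t κ) c := by
  have := hasMixedPartial_sum_prod {()} k (fun _ => c) (fun _ _ t => t) (fun _ _ => 1)
    fun _ _ => hasDerivAt_id _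
  simpa using this

end MixedPartial

namespace ConvFun

open MFAlg Function Classical

variable {F X Y : Type} {col : X → F} {P : UniversalProduct.{u} F} {hP : P.IsSymmetric}

/-- The pullback along the homomorphism that keeps the letters with the property `p` and maps the
other letters to zero. -/
def restr (p : X → Prop) : ConvFun P hP col →+ ConvFun P hP col :=
  subst P hP (fun x => if p x then 1 else 0) id fun _ => rfl

lemma val_restr (p : X → Prop) (φ : ConvFun P hP col) {m : ℕ} (hm : 0 < m) (w : Fin m → X) :
    (restr p φ).val m w = if ∀ i, p (w i) then φ.val m w else 0 := by
  rw [restr, val_subst _ _ _ _ hm, Finset.prod_ite_zero]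
  simp

/-- On the word of all letters, a convolution is the sum, over all ways of assigning the letters to
the factors, of the convolutions of the factors restricted to the letters assigned to them. -/
lemma val_sum_eq_sum_restr {J : Type} [Fintype J] {n : ℕ} (hn : 0 < n) {col : Fin n → F}
    (φ : J → ConvFun P hP col) :
    (∑ j, φ j).val n id = ∑ c : Fin n → J, (∑ j, restr (fun x => c x = j) (φ j)).val n id := by
  let Q : J → ConvFun P hP col →+ ConvFun P hP (col ∘ Prod.fst (β := J)) := fun j =>
    subst P hP (fun y => if y.2 = j then 1 else 0) Prod.fst fun _ => rfl
  have hQ : ∀ j, split P hP J col (Q j (φ j)) = φ j := fun j => ConvFun.ext fun m hm w => by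
    rw [val_split _ hm, Fintype.sum_eq_single fun _ => j]
    · rw [val_subst _ _ _ _ hm]
      simp [Function.comp_def]
    · intro c hc
      obtain ⟨i, hi⟩ := Function.ne_iff.1 hc
      rw [val_subst _ _ _ _ hm, Finset.prod_eq_zero (Finset.mem_univ i) (by simp [hi]), zero_mul]
  have e : ∑ j, φ j = split P hP J col (∑ j, Q j (φ j)) := by
    rw [map_sum]
    exact Finset.sum_congr rfl fun j _ => (hQ j).symm
  rw [e, val_split _ hn]
  refine Finset.sum_congr rfl fun c _ => ?_
  let r : ConvFun P hP (col ∘ Prod.fst (β := J)) →+ ConvFun P hP col :=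
    subst P hP (fun _ => 1) (fun x => (x, c x)) fun _ => rfl
  have h1 : ∀ ψ, (r ψ).val n id = ψ.val n fun i => (i, c i) := fun ψ => by
    rw [val_subst _ _ _ _ hn]
    simp [Function.comp_def]
  refine (h1 _).symm.trans ?_
  rw [map_sum]
  congr 2
  funext j
  refine ConvFun.ext fun m hm w => ?_
  rw [val_restr _ _ hm, val_subst _ _ _ _ hm, val_subst _ _ _ _ hm, Finset.prod_ite_zero]
  simp [Function.comp_def]

/-- Two functionals agree on words without repetitions. -/
def EqOnInj (φ ψ : ConvFun P hP col) : Prop :=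
  ∀ m, 0 < m → ∀ w : Fin m → X, Injective w → φ.val m w = ψ.val m w

/-- The values of `φ ⋆ χ` on words without repetitions depend only on the values of `φ` on such
words. -/
lemma EqOnInj.add_right {φ φ' : ConvFun P hP col} (h : EqOnInj φ φ') (χ : ConvFun P hP col) :
    EqOnInj (φ + χ) (φ' + χ) := by
  intro m hm w hw
  -- A functional `Θ` on words in two copies of the letters which interpolates between `φ` and `φ'`.
  -- A word with repetitions gets one additional lift, in which exactly one of two equal letters is
  -- replaced by its copy.
  have hl : ∀ (m : ℕ) (u : Fin m → X), ∃ l : Fin m → Bool, ¬ Injective u →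
      ∃ i j, u i = u j ∧ l i = true ∧ l j = false := by
    intro m u
    by_cases hu : Injective u
    · exact ⟨fun _ => false, fun h => absurd hu h⟩
    · obtain ⟨i, j, hij, hne⟩ : ∃ i j, u i = u j ∧ i ≠ j := by
        simpa [Injective] using hu
      exact ⟨fun a => decide (a = i), fun _ => ⟨i, j, hij, by simp, by simpa using hne.symm⟩⟩
  choose l hl using hl
  let Θ : ConvFun P hP (col ∘ Prod.fst (β := Bool)) := mk P hP _ fun m v =>
    (if ∀ i, (v i).2 = false then φ.val m (Prod.fst ∘ v) else 0) +
      if ¬ Injective (Prod.fst ∘ v) ∧ Prod.snd ∘ v = l m (Prod.fst ∘ v) then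
        φ'.val m (Prod.fst ∘ v) - φ.val m (Prod.fst ∘ v) else 0
  have hΘ : ∀ (m : ℕ), 0 < m → ∀ v : Fin m → X × Bool, Θ.val m v =
      (if ∀ i, (v i).2 = false then φ.val m (Prod.fst ∘ v) else 0) +
      if ¬ Injective (Prod.fst ∘ v) ∧ Prod.snd ∘ v = l m (Prod.fst ∘ v) then
        φ'.val m (Prod.fst ∘ v) - φ.val m (Prod.fst ∘ v) else 0 :=
    fun m hm v => val_mk _ hm v
  let χ' : ConvFun P hP (col ∘ Prod.fst (β := Bool)) :=
    subst P hP (fun y => if y.2 = false then 1 else 0) Prod.fst (fun _ => rfl) χ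
  have hχ' : ∀ (m : ℕ), 0 < m → ∀ v : Fin m → X × Bool, χ'.val m v =
      if ∀ i, (v i).2 = false then χ.val m (Prod.fst ∘ v) else 0 := fun m hm v => by
    rw [val_subst _ _ _ _ hm, Finset.prod_ite_zero]
    simp
  have sΘ : split P hP Bool col Θ = φ' := ConvFun.ext fun m hm u => by
    rw [val_split _ hm]
    simp only [hΘ m hm, Function.comp_def]
    rw [Finset.sum_add_distrib, Fintype.sum_eq_single fun _ => false,
      Fintype.sum_eq_single (l m u)]
    · by_cases hu : Injective u
      · simp [hu, h m hm u hu]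
      · simp [hu]
    · intro c hc
      rw [if_neg]
      exact fun h => hc h.2
    · intro c hc
      rw [if_neg]
      exact fun h => hc (funext h)
  have sχ : split P hP Bool col χ' = χ := ConvFun.ext fun m hm u => by
    rw [val_split _ hm]
    simp only [hχ' m hm, Function.comp_def]
    rw [Fintype.sum_eq_single fun _ => false]
    · simp
    · intro c hc
      rw [if_neg]
      exact fun h => hc (funext h)
  let ι : ConvFun P hP (col ∘ Prod.fst (β := Bool)) →+ ConvFun P hP col :=
    subst P hP (fun _ => 1) (fun x => (x, false)) fun _ => rfl
  have ιval : ∀ ψ m, 0 < m → ∀ u : Fin m → X, (ι ψ).val m u = ψ.val m fun i => (u i, false) :=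
    fun ψ m hm u => by
      rw [val_subst _ _ _ _ hm]
      simp [Function.comp_def]
  have iΘ : ι Θ = φ := ConvFun.ext fun m hm u => by
    rw [ιval _ m hm, hΘ m hm, if_pos fun _ => rfl, if_neg, add_zero]
    · rfl
    · rintro ⟨hu, hlu⟩
      obtain ⟨i, j, -, hi, -⟩ := hl m u hu
      have := congrFun hlu i
      exact absurd (this.trans hi) (by simp)
  have iχ : ι χ' = χ := ConvFun.ext fun m hm u => by
    rw [ιval _ m hm, hχ' m hm, if_pos fun _ => rfl]
    rfl
  have e1 : φ + χ = ι (Θ + χ') := by rw [map_add, iΘ, iχ]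
  have e2 : φ' + χ = split P hP Bool col (Θ + χ') := by rw [map_add, sΘ, sχ]
  rw [e1, e2, ιval _ m hm, val_split _ hm, Fintype.sum_eq_single fun _ => false]
  intro c hc
  obtain ⟨i, hi⟩ := Function.ne_iff.1 hc
  -- On words in the letters of an injective word, `Θ` and `χ'` involve no copied letters.
  let v : Fin m → X × Bool := fun i => (w i, c i)
  have e3 : (Θ + χ').val m v = (restr (· ∈ Set.range v) (Θ + χ')).val m v := by
    rw [val_restr _ _ hm, if_pos fun i => ⟨i, rfl⟩]
  have e4 : restr (· ∈ Set.range v) Θ =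
      restr (fun y => y ∈ Set.range v ∧ y.2 = false) Θ := ConvFun.ext fun p hp u => by
    rw [val_restr _ _ hp, val_restr _ _ hp]
    by_cases h1 : ∀ i, u i ∈ Set.range v
    · rw [if_pos h1]
      by_cases h2 : ∀ i, (u i).2 = false
      · rw [if_pos fun i => ⟨h1 i, h2 i⟩]
      · rw [if_neg fun h => h2 fun i => (h i).2, hΘ p hp, if_neg h2, if_neg, add_zero]
        rintro ⟨hu, hlu⟩
        obtain ⟨i, j, hij, hi, hj⟩ := hl p _ hu
        obtain ⟨a, ha⟩ := h1 i
        obtain ⟨b, hb⟩ := h1 j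
        have hab : a = b := hw (by
          have : (v a).1 = (v b).1 := by rw [ha, hb]; exact hij
          exact this)
        rw [← hlu] at hi hj
        have : (u i).2 = (u j).2 := by rw [← ha, ← hb, hab]
        exact absurd (hi.symm.trans (this.trans hj)) (by simp)
    · rw [if_neg h1, if_neg fun h => h1 fun i => (h i).1]
  have e5 : restr (· ∈ Set.range v) χ' =
      restr (fun y => y ∈ Set.range v ∧ y.2 = false) χ' := ConvFun.ext fun p hp u => by
    rw [val_restr _ _ hp, val_restr _ _ hp, hχ' p hp]
    by_cases h1 : ∀ i, u i ∈ Set.range v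
    · by_cases h2 : ∀ i, (u i).2 = false
      · rw [if_pos h1, if_pos h2, if_pos fun i => ⟨h1 i, h2 i⟩]
      · rw [if_pos h1, if_neg h2, if_neg fun h => h2 fun i => (h i).2]
    · rw [if_neg h1, if_neg fun h => h1 fun i => (h i).1]
  refine e3.trans ?_
  rw [map_add, e4, e5, ← map_add, val_restr _ _ hm, if_neg]
  exact fun h => hi (h i).2

lemma EqOnInj.add {φ φ' χ χ' : ConvFun P hP col} (h : EqOnInj φ φ') (h' : EqOnInj χ χ') :
    EqOnInj (φ + χ) (φ' + χ') := by
  intro m hm w hw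
  refine (h.add_right χ m hm w hw).trans ?_
  rw [add_comm φ', add_comm φ']
  exact h'.add_right φ' m hm w hw

end ConvFun
end

noncomputable section

/-! ### Convolution powers and the exponential -/

namespace ConvFun

open MFAlg Function Partition Classical

variable {F X : Type} {col : X → F} {P : UniversalProduct.{u} F} {hP : P.IsSymmetric}
  {α : Weights F}

section HighestCoefficient

variable {n k : ℕ} {b : Fin n → Fin (k + 1)} {col : Fin n → F}

/-- Convolutions of functionals concentrated on words in the letters from the fibres of `b` are
values of the iterated product on words in which every letter is taken from one factor. -/
lemma of_iter_comp {e : Fin (k + 1) → (freeAlg.{u} col).Functional}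
    (he : ∀ κ m, 0 < m → ∀ w : Fin m → Fin n, wordVal (e κ) m w ≠ 0 → ∀ i, b (w i) = κ)
    (h : Hom (freeAlg.{u} col) (iterCoprod k fun _ => freeAlg col))
    (hh : ∀ x, h (gen x) = iterEmb k (fun _ => freeAlg col) (b x) (gen x)) :
    of P hP ((P.iter k (fun _ => freeAlg col) e).comp h) = ∑ κ, of P hP (e κ) := by
  let c : Fin (k + 1) → Fin n → ℂ := fun κ x => if b x = κ then 1 else 0
  let p : Fin (k + 1) → Hom (freeAlg.{u} col) (freeAlg.{u} col) := fun κ =>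
    freeLift (fun x => c κ x • gen x) fun x => SMulMemClass.smul_mem _ (gen_mem_face x)
  have hp : ∀ κ x, p κ (gen x) = c κ x • gen x := fun κ x => freeLift_gen _ _ _
  have hrestr : ∀ κ, of P hP ((e κ).comp (p κ)) = of P hP (e κ) :=
    fun κ => ConvFun.ext fun m hm w => by
      refine (wordVal_comp_smul (e κ) (p κ) hm w w _ fun i => hp κ (w i)).trans ?_
      change _ = wordVal (e κ) m w
      by_cases h0 : wordVal (e κ) m w = 0
      · rw [h0, mul_zero]
      · rw [Finset.prod_eq_one fun i _ => if_pos (he κ m hm w h0 i), one_mul]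
  rw [iter_comp k (fun _ => freeAlg.{u} col) e p h]
  · exact Finset.sum_congr rfl fun κ _ => hrestr κ
  · intro x
    rw [hh, Finset.sum_eq_single (b x)]
    · simp only [hp, c]
      rw [if_pos trivial, one_smul]
    · intro κ _ hκ
      simp only [hp, c]
      rw [if_neg hκ.symm, zero_smul, hom_zero]
    · exact fun h => absurd (Finset.mem_univ _) h

/-- The highest coefficients determine convolutions of functionals which are concentrated on words
in which every letter from a fibre of `b` occurs exactly once. -/
lemma val_sum_of_support (hP' : P.HasHighestCoefficients α) (hb : Surjective b)
    {e : Fin (k + 1) → (freeAlg.{u} col).Functional}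
    (he : ∀ κ m, 0 < m → ∀ w : Fin m → Fin n, wordVal (e κ) m w ≠ 0 →
      Injective w ∧ ∀ x, (∃ i, w i = x) ↔ b x = κ) :
    (∑ κ, of P hP (e κ)).val n id = α n col (Setoid.ker b) *
      ∏ κ, wordVal (e κ) _ (enum (Finset.univ.filter fun x => b x = κ)) := by
  have hn : 0 < n := by
    obtain ⟨x, -⟩ := hb 0
    exact x.pos
  choose x hx using hb
  let s : (Fin (k + 1) → ℂ) → Fin n → ℂ := fun t i => if i = x (b i) then t (b i) else 1
  have hs : ∀ t, ∏ i, s t i = ∏ κ, t κ := fun t => by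
    rw [← Finset.prod_fiberwise Finset.univ b]
    refine Finset.prod_congr rfl fun κ _ => ?_
    rw [Finset.prod_eq_single (x κ)]
    · simp [s, hx]
    · intro i hi hne
      obtain rfl : b i = κ := (Finset.mem_filter.1 hi).2
      exact if_neg hne
    · intro h
      simp [hx] at h
  let h : Hom (freeAlg.{u} col) (iterCoprod k fun _ => freeAlg col) :=
    freeLift (fun i => iterEmb k (fun _ => freeAlg col) (b i) (gen i)) fun i =>
      (iterEmb _ _ _).map_face _ _ (gen_mem_face i)
  have hh : ∀ i, h (gen i) = iterEmb k (fun _ => freeAlg col) (b i) (gen i) :=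
    fun i => freeLift_gen _ _ _
  have hsm : ∀ (t : Fin (k + 1) → ℂ) κ m (w : Fin m → Fin n), wordVal (t κ • e κ) m w =
      t κ * wordVal (e κ) m w :=
    fun t κ m w => rfl
  -- Multiplying the functional number `κ` by `t κ` amounts to rescaling one letter of its support.
  have hscale : ∀ (t : Fin (k + 1) → ℂ) κ, of P hP (t κ • e κ) =
      subst P hP (s t) id (fun _ => rfl) (of P hP (e κ)) := fun t κ => ConvFun.ext fun m hm w => by
    rw [val_subst _ _ _ _ hm]
    change wordVal (t κ • e κ) m w = _ * wordVal (e κ) m w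
    rw [hsm]
    by_cases h0 : wordVal (e κ) m w = 0
    · rw [h0, mul_zero, mul_zero]
    · obtain ⟨hw, hr⟩ := he κ m hm w h0
      obtain ⟨i₀, hi₀⟩ := (hr (x κ)).2 (hx κ)
      have hbw : ∀ i, b (w i) = κ := fun i => (hr _).1 ⟨i, rfl⟩
      congr 1
      rw [Finset.prod_eq_single i₀]
      · simp [s, hi₀, hx]
      · intro i _ hi
        simp only [s, hbw]
        rw [if_neg]
        exact fun h => hi (hw (h.trans hi₀.symm))
      · exact fun h => absurd (Finset.mem_univ _) h
  have hfun : ∀ t : Fin (k + 1) → ℂ, P.iter k (fun _ => freeAlg.{u} col) (fun κ => t κ • e κ)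
      (ordProd (List.ofFn fun ℓ => iterEmb k (fun _ => freeAlg.{u} col) (b ℓ) (gen ℓ))) =
      (∑ κ, of P hP (e κ)).val n id * ∏ κ, t κ := fun t => by
    have e1 : P.iter k (fun _ => freeAlg.{u} col) (fun κ => t κ • e κ)
        (ordProd (List.ofFn fun ℓ => iterEmb k (fun _ => freeAlg.{u} col) (b ℓ) (gen ℓ))) =
        (of P hP ((P.iter k (fun _ => freeAlg.{u} col) (fun κ => t κ • e κ)).comp h)).val n id := by
      refine Eq.trans ?_ (wordVal_comp _ h id).symm
      simp only [hh]
      rfl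
    rw [e1, of_iter_comp (b := b) _ h hh]
    · simp only [hscale]
      rw [← map_sum, val_subst _ _ _ _ hn]
      simp only [id]
      rw [hs, mul_comm]
      rfl
    · intro κ m hm w h0 i
      rw [hsm] at h0
      exact ((he κ m hm w (right_ne_zero_of_mul h0)).2 _).1 ⟨i, rfl⟩
  have key := hP' k n b col (fun κ => ⟨x κ, hx κ⟩) (fun _ => freeAlg.{u} col) e (fun _ ℓ => gen ℓ)
    fun ℓ => gen_mem_face ℓ
  simp only [hfun] at key
  rw [(hasMixedPartial_const_mul_prod _ _).unique key]
  congr 1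
  refine Finset.prod_congr rfl fun κ _ => ?_
  rw [ordProd_filter _ (fun ℓ => b ℓ = κ) (β := Finset.univ.filter fun x => b x = κ) (by simp)]
  rfl

end HighestCoefficient

section Parts

variable {X : Type} {col : X → F}

variable (P hP col) in
/-- The part of a functional that is concentrated on the words in which exactly the letters from `S`
occur, each of them once. -/
def part (ψ : WordFun X) (S : Finset X) : ConvFun P hP col :=
  mk P hP col fun m w => if Injective w ∧ Finset.univ.image w = S then ψ m w else 0

lemma val_part (ψ : WordFun X) (S : Finset X) {m : ℕ} (hm : 0 < m) (w : Fin m → X) :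
    (part P hP col ψ S).val m w =
      if Injective w ∧ Finset.univ.image w = S then ψ m w else 0 :=
  val_mk _ hm w

lemma part_empty (ψ : WordFun X) : part P hP col ψ ∅ = 0 := ConvFun.ext fun m hm w => by
  rw [val_part _ _ hm, if_neg]
  · rfl
  · rintro ⟨-, h⟩
    have := Finset.mem_image_of_mem w (Finset.mem_univ (⟨0, hm⟩ : Fin m))
    rw [h] at this
    simp at this

lemma restr_part (ψ : WordFun X) (S : Finset X) (p : X → Prop) :
    restr p (part P hP col ψ S) = if ∀ x ∈ S, p x then part P hP col ψ S else 0 := by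
  refine ConvFun.ext fun m hm w => ?_
  rw [val_restr _ _ hm, val_part _ _ hm]
  by_cases h1 : Injective w ∧ Finset.univ.image w = S
  · have e : (∀ i, p (w i)) ↔ ∀ x ∈ S, p x := by
      rw [← h1.2]
      simp
    rw [if_pos h1]
    by_cases h2 : ∀ x ∈ S, p x
    · rw [if_pos (e.2 h2), if_pos h2, val_part _ _ hm, if_pos h1]
    · rw [if_neg (mt e.1 h2), if_neg h2]
      rfl
  · rw [if_neg h1, ite_self]
    split_ifs
    · rw [val_part _ _ hm, if_neg h1]
    · rfl

end Parts

variable (P hP) in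
/-- The convolution of all parts of a functional. -/
def partSum [Fintype X] (col : X → F) (ψ : WordFun X) : ConvFun P hP col :=
  ∑ S : Finset X, part P hP col ψ S

/-- The convolution of the parts of `ψ` for the blocks of a partition. -/
lemma val_sum_part_blocks (hP' : P.HasHighestCoefficients α) {n : ℕ} (hn : 0 < n) {col : Fin n → F}
    (ψ : WordFun (Fin n)) (π : Setoid (Fin n)) :
    (∑ S ∈ blocks π, part P hP col ψ S).val n id =
      α n col π * ∏ β ∈ blocks π, ψ β.card (enum β) := by
  obtain ⟨k, hk⟩ : ∃ k, (blocks π).card = k + 1 := by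
    exact Nat.exists_eq_succ_of_ne_zero
      (Finset.card_ne_zero_of_mem (block_mem_blocks π ⟨0, hn⟩))
  let e : Fin (k + 1) ≃ blocks π := ((blocks π).equivFinOfCardEq hk).symm
  let b : Fin n → Fin (k + 1) := fun i => e.symm ⟨block π i, block_mem_blocks π i⟩
  have hb : ∀ i κ, b i = κ ↔ i ∈ (e κ).1 := by
    intro i κ
    rw [Equiv.symm_apply_eq, Subtype.ext_iff]
    constructor
    · rintro h
      rw [← h]
      exact self_mem_block π i
    · exact fun h => (eq_block_of_mem (e κ).2 h).symm
  have hsurj : Surjective b := fun κ => by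
    obtain ⟨i, hi⟩ := mem_blocks.1 (e κ).2
    exact ⟨i, (hb i κ).2 (hi ▸ self_mem_block π i)⟩
  have hker : Setoid.ker b = π := Setoid.ext fun i j => by
    rw [Setoid.ker_def, e.symm.injective.eq_iff, Subtype.mk.injEq, block_eq_iff]
  have hfib : ∀ κ, (Finset.univ.filter fun x => b x = κ) = (e κ).1 := fun κ => by
    ext i
    simp [hb]
  have hsum : ∑ S ∈ blocks π, part P hP col ψ S = ∑ κ, of P hP (part P hP col ψ (e κ).1) := by
    rw [← Finset.sum_coe_sort, ← e.sum_comp]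
    rfl
  have key := val_sum_of_support (hP := hP) (e := fun κ => part P hP col ψ (e κ).1) hP' hsurj ?_
  rw [hker] at key
  rw [hsum]
  refine key.trans ?_
  · congr 1
    rw [← Finset.prod_coe_sort (blocks π), ← e.prod_comp]
    refine Finset.prod_congr rfl fun κ _ => ?_
    have hpos := card_pos_of_mem_blocks (e κ).2
    rw [hfib]
    refine (val_part ψ _ hpos _).trans (if_pos ⟨(enum_strictMono _).injective, ?_⟩)
    ext i
    rw [mem_iff_enum (β := (e κ).1)]
    simp
  · intro κ m hm w h0
    have h1 : (part P hP col ψ (e κ).1).val m w ≠ 0 := h0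
    rw [val_part _ _ hm] at h1
    split_ifs at h1 with hw
    · refine ⟨hw.1, fun x => ?_⟩
      rw [hb, ← hw.2]
      simp
    · exact absurd rfl h1

/-- The convolution of all parts of `ψ` is `exp_α ψ` on the word consisting of all letters. -/
lemma val_partSum_id (hP' : P.HasHighestCoefficients α) {n : ℕ} (hn : 0 < n) (col : Fin n → F)
    (ψ : WordFun (Fin n)) : (partSum P hP col ψ).val n id = WordFun.exp α col ψ n id := by
  unfold partSum
  rw [val_sum_eq_sum_restr hn]
  symm
  refine Fintype.sum_of_injective (fun π : Setoid (Fin n) => block π) ?_ _ _ ?_ ?_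
  · intro π σ h
    ext i j
    rw [← mem_block, ← mem_block]
    exact iff_of_eq (congrArg (j ∈ ·) (congrFun h i))
  · -- If `c` is not the block map of a partition, then some letter occurs in none of the parts.
    intro c hc
    by_cases hcx : ∀ x, x ∈ c x ∧ ∀ y ∈ c x, c y = c x
    · refine absurd ⟨Setoid.ker c, ?_⟩ hc
      funext x
      ext y
      rw [mem_block, Setoid.ker_def]
      exact ⟨fun h => h ▸ (hcx y).1, fun h => ((hcx x).2 y h).symm⟩
    · obtain ⟨x, hx⟩ := not_forall.1 hcx
      have e : ∑ S, restr (fun x => c x = S) (part P hP col ψ S) =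
          restr (· ≠ x) (∑ S, restr (fun x => c x = S) (part P hP col ψ S)) := by
        rw [map_sum]
        refine Finset.sum_congr rfl fun S _ => ?_
        rw [restr_part]
        split_ifs with h
        · rw [restr_part, if_pos]
          rintro y hy rfl
          refine hx ⟨?_, fun z hz => ?_⟩
          · rw [h _ hy]
            exact hy
          · rw [h _ hy] at hz ⊢
            exact h z hz
        · rw [map_zero]
      rw [e, val_restr _ _ hn, if_neg]
      exact fun h => h x rfl
  · intro π
    have e : ∑ S, restr (fun x => block π x = S) (part P hP col ψ S) =
        ∑ S ∈ blocks π, part P hP col ψ S := by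
      rw [← Finset.sum_subset (Finset.subset_univ (blocks π))]
      · refine Finset.sum_congr rfl fun S hS => ?_
        rw [restr_part, if_pos fun x hx => (eq_block_of_mem hS hx).symm]
      · intro S _ hS
        rw [restr_part]
        split_ifs with h
        · obtain rfl | ⟨x, hx⟩ := S.eq_empty_or_nonempty
          · exact part_empty ψ
          · exact absurd (h x hx ▸ block_mem_blocks π x) hS
        · rfl
    rw [e, val_sum_part_blocks hP' hn]
    rfl

/-- The convolution of all parts of `ψ` is `exp_α ψ` on words without repetitions. -/
lemma val_partSum (hP' : P.HasHighestCoefficients α) [Fintype X] (ψ : WordFun X) {m : ℕ}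
    (hm : 0 < m) {w : Fin m → X} (hw : Injective w) :
    (partSum P hP col ψ).val m w = WordFun.exp α col ψ m w := by
  let r : ConvFun P hP col →+ ConvFun P hP (col ∘ w) := subst P hP (fun _ => 1) w fun _ => rfl
  have hr : ∀ φ p, 0 < p → ∀ v : Fin p → Fin m, (r φ).val p v = φ.val p (w ∘ v) :=
    fun φ p hp v => by
      rw [val_subst _ _ _ _ hp]
      simp
  have e : r (partSum P hP col ψ) = partSum P hP (col ∘ w) fun p v => ψ p (w ∘ v) := by
    unfold partSum
    rw [map_sum]
    symm
    refine Fintype.sum_of_injective (fun S => S.map ⟨w, hw⟩) (Finset.map_injective _) _ _ ?_ ?_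
    · intro S hS
      refine ConvFun.ext fun p hp v => ?_
      rw [hr _ p hp, val_part _ _ hp, if_neg]
      · rfl
      · rintro ⟨-, h⟩
        refine hS ⟨Finset.univ.image v, ?_⟩
        rw [← h]
        simp [Finset.map_eq_image, Finset.image_image]
    · intro S
      refine ConvFun.ext fun p hp v => ?_
      rw [hr _ p hp, val_part _ _ hp]
      refine (val_part (fun p v => ψ p (w ∘ v)) S hp v).trans ?_
      congr 1
      rw [hw.of_comp_iff, ← (Finset.map_injective ⟨w, hw⟩).eq_iff]
      simp [Finset.map_eq_image, Finset.image_image]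
  refine (hr (partSum P hP col ψ) m hm id).symm.trans ?_
  rw [e, val_partSum_id hP' hm]
  exact WordFun.exp_comp _ _ w (fun _ => rfl) ψ id

/-- The convolution of two functionals whose cumulants are concentrated on words in disjoint sets
of letters. -/
lemma val_add_eq_exp (hα : ∀ n f, α n f ⊤ = 1) (hP' : P.HasHighestCoefficients α) {n : ℕ}
    (hn : 0 < n) {col : Fin n → F} (φ₁ φ₂ : ConvFun P hP col) (p : Fin n → Prop)
    (h₁ : ∀ m (w : Fin m → Fin n) i, ¬ p (w i) → WordFun.log α col φ₁.val m w = 0)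
    (h₂ : ∀ m (w : Fin m → Fin n) i, p (w i) → WordFun.log α col φ₂.val m w = 0) :
    (φ₁ + φ₂).val n id = WordFun.exp α col
      (fun m w => WordFun.log α col φ₁.val m w + WordFun.log α col φ₂.val m w) n id := by
  have key : ∀ φ : ConvFun P hP col,
      EqOnInj φ (partSum P hP col (WordFun.log α col φ.val)) := fun φ m hm w hw => by
    rw [val_partSum hP' _ hm hw, WordFun.exp_log col hα _ hm]
  rw [(key φ₁).add (key φ₂) n hn id injective_id,
    ← val_partSum_id hP' hn (hP := hP)]
  unfold partSum
  rw [← Finset.sum_add_distrib]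
  congr 2
  funext S
  have part_zero : ∀ (ψ : WordFun (Fin n)) x, x ∈ S →
      (∀ m (w : Fin m → Fin n) i, w i = x → ψ m w = 0) → part P hP col ψ S = 0 := by
    intro ψ x hx hψ
    refine ConvFun.ext fun m hm w => ?_
    rw [val_part _ _ hm]
    split_ifs with h
    · rw [← h.2] at hx
      obtain ⟨i, hi⟩ : ∃ i, w i = x := by simpa using hx
      exact hψ m w i hi
    · rfl
  have part_congr : ∀ ψ ψ' : WordFun (Fin n), ∀ x, x ∈ S →
      (∀ m (w : Fin m → Fin n) i, w i = x → ψ m w = ψ' m w) →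
      part P hP col ψ S = part P hP col ψ' S := by
    intro ψ ψ' x hx hψ
    refine ConvFun.ext fun m hm w => ?_
    rw [val_part _ _ hm, val_part _ _ hm]
    split_ifs with h
    · rw [← h.2] at hx
      obtain ⟨i, hi⟩ : ∃ i, w i = x := by simpa using hx
      exact hψ m w i hi
    · rfl
  obtain rfl | ⟨x, hx⟩ := S.eq_empty_or_nonempty
  · simp only [part_empty, add_zero]
  · by_cases hpx : p x
    · rw [part_zero _ x hx fun m w i hi => h₂ m w i (hi ▸ hpx), add_zero]
      refine part_congr _ _ x hx fun m w i hi => ?_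
      rw [h₂ m w i (hi ▸ hpx), add_zero]
    · rw [part_zero _ x hx fun m w i hi => h₁ m w i (hi ▸ hpx), zero_add]
      refine part_congr _ _ x hx fun m w i hi => ?_
      rw [h₁ m w i (hi ▸ hpx), zero_add]

end ConvFun
end

noncomputable section

/-! ### Uniqueness -/

namespace MFAlg

open WordFun

variable {F : Type} {A A₁ A₂ : MFAlg.{u} F} {α : Weights F}

lemma Functional.hat_eq_zero (φ : A.Functional) {n : ℕ} {w : Fin n → A.Letter} {i : Fin n}
    (hi : ((w i).2 : A) = 0) : φ.hat n w = 0 := by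
  rw [Functional.hat, ← prodMultilinear_apply i.pos, MultilinearMap.map_coord_zero _ i hi, map_zero]

lemma Functional.logHat_eq_zero (hα : α.Admissible) (φ : A.Functional) {n : ℕ}
    {w : Fin n → A.Letter} {i : Fin n} (hi : ((w i).2 : A) = 0) : φ.logHat α n w = 0 :=
  log_eq_zero_of_mem _ hα.one_block {x : A.Letter | (x.2 : A) = 0} φ.hat
    (fun _ w ⟨j, hj⟩ => φ.hat_eq_zero (w := w) (i := j) hj) w ⟨i, hi⟩

/-- The left letters, with all right letters replaced by zero. -/
def leftLetter : A₁.Letter ⊕ A₂.Letter → A₁.Letter := Sum.elim id fun y => ⟨y.1, 0⟩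

/-- The right letters, with all left letters replaced by zero. -/
def rightLetter : A₁.Letter ⊕ A₂.Letter → A₂.Letter := Sum.elim (fun x => ⟨x.1, 0⟩) id

lemma leftLetter_fst (x : A₁.Letter ⊕ A₂.Letter) :
    (leftLetter x).1 = Sum.elim Sigma.fst Sigma.fst x := by
  cases x <;> rfl

lemma rightLetter_fst (x : A₁.Letter ⊕ A₂.Letter) :
    (rightLetter x).1 = Sum.elim Sigma.fst Sigma.fst x := by
  cases x <;> rfl

lemma letterToCoprod_mem_face (x : A₁.Letter ⊕ A₂.Letter) :
    letterToCoprod A₁ A₂ x ∈ (A₁.coprod A₂).face (Sum.elim Sigma.fst Sigma.fst x) := by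
  rcases x with x | x
  · exact (inl A₁ A₂).map_face _ _ x.2.2
  · exact (inr A₁ A₂).map_face _ _ x.2.2

lemma letterToCoprod_eq_add (x : A₁.Letter ⊕ A₂.Letter) :
    letterToCoprod A₁ A₂ x =
      inl A₁ A₂ ((leftLetter x).2 : A₁) + inr A₁ A₂ ((rightLetter x).2 : A₂) := by
  rcases x with x | x
  · exact ((congrArg _ (hom_zero (inr A₁ A₂))).trans (add_zero _)).symm
  · exact ((congrArg (· + _) (hom_zero (inl A₁ A₂))).trans (zero_add _)).symm

/-- The homomorphism that maps the letters of a free algebra to given letters of `A`. -/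
def lettersHom {X : Type} {col : X → F} (g : X → A.Letter) (hg : ∀ x, (g x).1 = col x) :
    Hom (freeAlg.{u} col) A :=
  freeLift (fun x => ((g x).2 : A)) fun x => hg x ▸ (g x).2.2

lemma wordVal_lettersHom {X : Type} {col : X → F} (g : X → A.Letter) (hg : ∀ x, (g x).1 = col x)
    (φ : A.Functional) (m : ℕ) (v : Fin m → X) :
    wordVal (φ.comp (lettersHom g hg)) m v = φ.hat m (g ∘ v) := by
  rw [wordVal_comp]
  simp only [lettersHom, freeLift_gen]
  rfl

lemma log_wordVal_lettersHom (hα : α.Admissible) {X : Type} {col : X → F} (g : X → A.Letter)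
    (hg : ∀ x, (g x).1 = col x) (φ : A.Functional) {m : ℕ} (hm : 0 < m) (v : Fin m → X) :
    log α col (wordVal (φ.comp (lettersHom g hg))) m v = φ.logHat α m (g ∘ v) := by
  have e : wordVal (φ.comp (lettersHom g hg)) = fun m v => φ.hat m (g ∘ v) :=
    funext fun m => funext fun v => wordVal_lettersHom g hg φ m v
  rw [e, log_comp _ hα.one_block Sigma.fst g hg _ hm]
  rfl

end MFAlg

open MFAlg WordFun

variable {F : Type} {A₁ A₂ : MFAlg.{u} F} {α : Weights F}

/-- A symmetric universal product with highest coefficients `α` is given by `α`-cumulants. -/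
lemma UniversalProduct.op_eq_cumulantProduct (hα : α.Admissible) (P : UniversalProduct.{u} F)
    (hP : P.IsSymmetric) (hP' : P.HasHighestCoefficients α) (φ₁ : A₁.Functional)
    (φ₂ : A₂.Functional) {n : ℕ} (hn : 0 < n) (w : Fin n → A₁.Letter ⊕ A₂.Letter) :
    P.op φ₁ φ₂ (ordProd (List.ofFn fun i => letterToCoprod A₁ A₂ (w i))) =
      cumulantProduct α φ₁ φ₂ n w := by
  let c : A₁.Letter ⊕ A₂.Letter → F := Sum.elim Sigma.fst Sigma.fst
  let h₁ : Hom (freeAlg.{u} (c ∘ w)) A₁ :=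
    lettersHom (fun i => leftLetter (w i)) fun i => leftLetter_fst (w i)
  let h₂ : Hom (freeAlg.{u} (c ∘ w)) A₂ :=
    lettersHom (fun i => rightLetter (w i)) fun i => rightLetter_fst (w i)
  let h : Hom (freeAlg.{u} (c ∘ w)) (A₁.coprod A₂) :=
    freeLift (fun i => letterToCoprod A₁ A₂ (w i)) fun i => letterToCoprod_mem_face (w i)
  have e1 : P.op φ₁ φ₂ (ordProd (List.ofFn fun i => letterToCoprod A₁ A₂ (w i))) =
      (ConvFun.of P hP (φ₁.comp h₁) + ConvFun.of P hP (φ₂.comp h₂)).val n id := by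
    have e := P.conv_comp φ₁ φ₂ h₁ h₂ h fun i => by
      rw [freeLift_gen, letterToCoprod_eq_add]
      simp only [h₁, h₂, lettersHom, freeLift_gen]
    refine Eq.trans ?_ (congrArg (fun φ => wordVal φ n id) e).symm
    refine Eq.trans ?_ (wordVal_comp _ h id).symm
    simp only [h, freeLift_gen]
    rfl
  have l₁ : ∀ {m : ℕ}, 0 < m → ∀ v : Fin m → Fin n,
      log α (c ∘ w) (ConvFun.of P hP (φ₁.comp h₁)).val m v =
        φ₁.logHat α m fun i => leftLetter (w (v i)) :=
    fun hm v => log_wordVal_lettersHom hα _ _ φ₁ hm v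
  have l₂ : ∀ {m : ℕ}, 0 < m → ∀ v : Fin m → Fin n,
      log α (c ∘ w) (ConvFun.of P hP (φ₂.comp h₂)).val m v =
        φ₂.logHat α m fun i => rightLetter (w (v i)) :=
    fun hm v => log_wordVal_lettersHom hα _ _ φ₂ hm v
  have z₁ : ∀ m (v : Fin m → Fin n) i, ¬ (w (v i)).isLeft = true →
      log α (c ∘ w) (ConvFun.of P hP (φ₁.comp h₁)).val m v = 0 := fun m v i hi => by
    rw [l₁ i.pos]
    refine φ₁.logHat_eq_zero hα (i := i) ?_
    revert hi
    rcases w (v i) with x | x <;> intro hi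
    · exact absurd rfl hi
    · rfl
  have z₂ : ∀ m (v : Fin m → Fin n) i, (w (v i)).isLeft = true →
      log α (c ∘ w) (ConvFun.of P hP (φ₂.comp h₂)).val m v = 0 := fun m v i hi => by
    rw [l₂ i.pos]
    refine φ₂.logHat_eq_zero hα (i := i) ?_
    revert hi
    rcases w (v i) with x | x <;> intro hi
    · rfl
    · exact absurd hi (by simp)
  rw [e1, ConvFun.val_add_eq_exp hα.one_block hP' hn _ _ (fun i => (w i).isLeft = true) z₁ z₂]
  have e2 : ∀ m, 0 < m → ∀ v : Fin m → Fin n,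
      log α (c ∘ w) (ConvFun.of P hP (φ₁.comp h₁)).val m v +
        log α (c ∘ w) (ConvFun.of P hP (φ₂.comp h₂)).val m v =
      directSum (φ₁.logHat α) (φ₂.logHat α) m (w ∘ v) := by
    intro m hm v
    rcases sum_word_cases (w ∘ v) with ⟨u, hu⟩ | ⟨u, hu⟩ | ⟨i, j, hi, hj⟩
    · have hu' : ∀ i, w (v i) = Sum.inl (u i) := congrFun hu
      rw [hu, directSum_inl, z₂ m v ⟨0, hm⟩ (by rw [hu']; rfl), add_zero, l₁ hm]
      simp only [hu']
      rfl
    · have hu' : ∀ i, w (v i) = Sum.inr (u i) := congrFun hu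
      rw [hu, directSum_inr _ _ hm, z₁ m v ⟨0, hm⟩ (by rw [hu']; simp), zero_add, l₂ hm]
      simp only [hu']
      rfl
    · rw [directSum_mixed hi hj, z₁ m v j (Bool.not_eq_true _ ▸ Sum.isLeft_eq_false.2 hj),
        z₂ m v i hi, add_zero]
  rw [exp_congr _ e2]
  exact exp_comp (c ∘ w) c w (fun _ => rfl) _ (id : Fin n → Fin n)

lemma UniversalProduct.ext_op {P Q : UniversalProduct.{u} F}
    (h : ∀ {A₁ A₂ : MFAlg.{u} F} (φ₁ : A₁.Functional) (φ₂ : A₂.Functional),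
      P.op φ₁ φ₂ = Q.op φ₁ φ₂) : P = Q := by
  have e : @UniversalProduct.op F P = @UniversalProduct.op F Q := by
    funext A₁ A₂ φ₁ φ₂
    exact h φ₁ φ₂
  cases P
  cases Q
  congr

theorem theorem8p2 {F : Type} [Finite F] (α : Weights F) (hα : α.Admissible) :
    (∃! P : UniversalProduct.{u} F, P.IsSymmetric ∧ P.HasHighestCoefficients α) ∧
    ∀ P : UniversalProduct.{u} F, P.IsSymmetric → P.HasHighestCoefficients α →
      ∀ (A₁ A₂ : MFAlg.{u} F) (φ₁ : A₁.Functional) (φ₂ : A₂.Functional) (n : ℕ), 0 < n →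
      ∀ w : Fin n → A₁.Letter ⊕ A₂.Letter,
        P.op φ₁ φ₂ (ordProd (List.ofFn (fun i => MFAlg.letterToCoprod A₁ A₂ (w i)))) =
          MFAlg.cumulantProduct α φ₁ φ₂ n w := by
  refine ⟨⟨cumulantUniversalProduct hα, ⟨cumulantUniversalProduct_isSymmetric hα,
    cumulantUniversalProduct_hasHighestCoefficients hα⟩, fun P hP => ?_⟩,
    fun P hP hP' A₁ A₂ φ₁ φ₂ n hn w => P.op_eq_cumulantProduct hα hP hP' φ₁ φ₂ hn w⟩
  refine UniversalProduct.ext_op fun φ₁ φ₂ =>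
    functional_ext_range mem_adjoin_letterToCoprod fun n hn w => ?_
  rw [P.op_eq_cumulantProduct hα hP.1 hP.2 φ₁ φ₂ hn w]
  exact (cumulantOp_apply hα φ₁ φ₂ hn w).symm

end
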